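/- **Setting.** Let $M$ be a topological disk (a space homeomorphic to the closed unit disk) with boundary circle $\partial M$, and let $f\colon M\to\mathbf{S}^2$ be a topological immersion into the unit sphere of $\mathbf{R}^3$, i.e. a continuous, locally one-to-one map. Assume that $f|_{\partial M}$ is $\mathcal{C}^2$ with nonvanishing differential, i.e. there is a homeomorphism $\varphi\colon\mathbf{S}^1\to\partial M$ such that $\gamma(\theta)=f(\varphi(e^{i\theta}))$ is a $\mathcal{C}^2$ curve in $\mathbf{R}^3$ with $\gamma'\neq 0$ everywhere. A closed set $C\subset M$ is a *circle* if $f$ is injective on $C$ and $f(C)$ is a (nondegenerate, round) circle of $\mathbf{S}^2$. A subset of $M$ lies *inside* a circle $C'$ if it is contained in the union of $C'$ and the points of $M\setminus C'$ whose component in $M\setminus C'$ does not meet $\partial M$. For $p\in\partial M$, a circle through $p$ is *maximal* at $p$ if it is not contained inside any other circle through $p$; a *maximal circle* of $M$ is a circle that is maximal at some $p\in\partial M$. The *rank* of a maximal circle $C$ is the number of connected components of $C\cap\partial M$, and $C$ is *singular* if $C\cap\partial M$ is connected. Let $\mathcal{S}$ be the number of singular maximal circles, and let $\mathcal{T}_0$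 be the number of maximal circles of rank at least $3$. Also put $$\mathcal{T}=\sum_{\mathrm{rank}(C)\ge 3}\bigl(\mathrm{rank}(C)-2\bigr)\ \ge\ \mathcal{T}_0,$$ where the sum is over all maximal circles of rank at least $3$. Let $\kappa$ be the geodesic curvature of $f|_{\partial M}$ with respect to a continuous unit normal (the choice of normal does not matter here), and let $\mathcal{V}$ be the number of points of $\partial M$ at which $\kappa$ has a local minimum or a local maximum, in the non-strict sense. All these numbers take values in $\{0,1,2,\dots\}\cup\{\infty\}$. **Corollary 2.4.** Suppose that $\partial M$ is not a circle. Then: 1. For every $p\in\partial M$ there is exactly one maximal circle $C_p$ at $p$. 2. For every maximal circle $C$, each connected component of $\partial M\setminus C$ contains a point $p$ such that $C_p$ is singular. 3. $\mathcal{S}\ge\mathcal{T}+2$; in particular $\mathcal{S}\ge\mathcal{T}_0+2$. 4. $\mathcal{V}\ge 2\mathcal{S}$. Hence $\mathcal{V}\ge 2\mathcal{S}\ge 2(\mathcal{T}+2)$, and in particular $\mathcal{V}\ge 4$. -/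

import Mathlib

noncomputable section

namespace ImmersedDisk

/-- Euclidean three-space. -/
abbrev E3 : Type := EuclideanSpace ℝ (Fin 3)

/-- The unit sphere of Euclidean three-space. -/
abbrev S2 : Type := Metric.sphere (0 : E3) 1

/-- The closed unit disk; a topological disk is a space with a homeomorphism to it. -/
abbrev UnitDisk : Type := Metric.closedBall (0 : ℂ) 1

/-- The set of (connected) components of a subset `S` of a topological space. -/
def componentsOf {X : Type*} [TopologicalSpace X] (S : Set X) : Set (Set X) :=
  {K | ∃ x ∈ S, K = connectedComponentIn S x}

/-- A (nondegenerate) circle in the sphere: a plane section with more than one point. -/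
def IsRoundCircle (K : Set S2) : Prop :=
  ∃ (n : E3) (t : ℝ), ‖n‖ = 1 ∧ |t| < 1 ∧ K = {x : S2 | inner ℝ n (x : E3) = t}

/-- A topological immersion: a continuous, locally one-to-one map. -/
def IsTopImmersion {X Y : Type*} [TopologicalSpace X] [TopologicalSpace Y] (f : X → Y) : Prop :=
  Continuous f ∧ ∀ x, ∃ U ∈ nhds x, Set.InjOn f U

section Disk

variable {M : Type*} [TopologicalSpace M]

/-- The boundary circle of a topological disk. -/
def bdry (h : M ≃ₜ UnitDisk) : Set M := {p | ‖(h p : ℂ)‖ = 1}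

/-- A closed subset `C` of `M` is a circle (with respect to `f`) if `f` maps it injectively
onto a circle of the sphere; by compactness `C` is then a simple closed curve. -/
def IsCircle (f : M → S2) (C : Set M) : Prop :=
  IsClosed C ∧ Set.InjOn f C ∧ IsRoundCircle (f '' C)

/-- The closed region of the disk bounded by `C`: the points of `C` together with all points
that `C` separates from the boundary of the disk. -/
def enclosed (h : M ≃ₜ UnitDisk) (C : Set M) : Set M :=
  C ∪ {x | x ∉ C ∧ Disjoint (connectedComponentIn Cᶜ x) (bdry h)}

/-- `C` is a maximal circle at `p`: a circle through `p` which is not contained inside any other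
circle through `p`. -/
def IsMaximalCircleAt (h : M ≃ₜ UnitDisk) (f : M → S2) (p : M) (C : Set M) : Prop :=
  IsCircle f C ∧ p ∈ C ∧
    ∀ C' : Set M, IsCircle f C' → p ∈ C' → C ⊆ enclosed h C' → C' = C

/-- `C` is a maximal circle: it is a maximal circle at some boundary point. -/
def IsMaximalCircle (h : M ≃ₜ UnitDisk) (f : M → S2) (C : Set M) : Prop :=
  ∃ p ∈ bdry h, IsMaximalCircleAt h f p C

/-- A circle is singular if its contact set with the boundary is connected. -/
def IsSingular (h : M ≃ₜ UnitDisk) (C : Set M) : Prop :=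
  IsConnected (C ∩ bdry h)

/-- The rank of a circle: the number of components of its contact set with the boundary. -/
def rank (h : M ≃ₜ UnitDisk) (C : Set M) : ℕ∞ :=
  (componentsOf (C ∩ bdry h)).encard

/-- The number of singular maximal circles. -/
def numSingular (h : M ≃ₜ UnitDisk) (f : M → S2) : ℕ∞ :=
  {C : Set M | IsMaximalCircle h f C ∧ IsSingular h C}.encard

/-- The set of maximal circles of rank at least three. -/
def triangularCircles (h : M ≃ₜ UnitDisk) (f : M → S2) : Set (Set M) :=
  {C | IsMaximalCircle h f C ∧ 3 ≤ rank h C}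

/-- The number of maximal circles of rank at least three. -/
def numTriangular (h : M ≃ₜ UnitDisk) (f : M → S2) : ℕ∞ :=
  (triangularCircles h f).encard

/-- The sum of `rank C - 2` over all maximal circles `C` of rank at least three, as the supremum
of the finite partial sums. -/
def triangularity (h : M ≃ₜ UnitDisk) (f : M → S2) : ℕ∞ :=
  ⨆ (A : Finset (Set M)) (_ : (A : Set (Set M)) ⊆ triangularCircles h f),
    ∑ C ∈ A, (rank h C - 2)

/-- The boundary curve of the immersion, as a periodic curve in space, for a given
parametrization of the boundary of the disk by the unit circle. -/
def boundaryCurve (h : M ≃ₜ UnitDisk) (f : M → S2) (φ : Circle ≃ₜ bdry h) (θ : ℝ) : E3 :=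
  (f (φ (Circle.exp θ) : M) : E3)

/-- The boundary values are of class C² with nonvanishing differential. -/
def IsC2Boundary (h : M ≃ₜ UnitDisk) (f : M → S2) (φ : Circle ≃ₜ bdry h) : Prop :=
  ContDiff ℝ 2 (boundaryCurve h f φ) ∧ ∀ θ, deriv (boundaryCurve h f φ) θ ≠ 0

end Disk

/-- The geodesic curvature `det (γ, γ', γ'') / |γ'|³` of a regular curve `γ` in the unit sphere,
with respect to the unit normal `γ × γ' / |γ'|`; the opposite normal changes the sign only. -/
def geodesicCurvature (γ : ℝ → E3) (θ : ℝ) : ℝ :=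
  Matrix.det (Matrix.of ![(γ θ).ofLp, (deriv γ θ).ofLp, (deriv (deriv γ) θ).ofLp]) /
    ‖deriv γ θ‖ ^ 3

/-- The number of vertices: boundary points where the geodesic curvature of the boundary curve
has a local minimum or a local maximum. -/
def numVertices {M : Type*} [TopologicalSpace M] (h : M ≃ₜ UnitDisk) (f : M → S2)
    (φ : Circle ≃ₜ bdry h) : ℕ∞ :=
  {z : Circle | ∃ θ : ℝ, Circle.exp θ = z ∧
    IsLocalExtr (geodesicCurvature (boundaryCurve h f φ)) θ}.encard

end ImmersedDisk

end

open ImmersedDisk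

/-! ### Plane topology from logarithms: invariance of domain and crossing paths -/

noncomputable section

open Complex Set Filter Topology

namespace ImmersedDisk

/-- A nowhere vanishing homotopy starting at an exponential is an exponential. -/
theorem exists_log_of_homotopy {X : Type*} [TopologicalSpace X] (H : unitInterval × X → ℂ)
    (hH : Continuous H) (h0 : ∀ p, H p ≠ 0) (L : X → ℂ) (hL : Continuous L)
    (h : ∀ x, H (0, x) = exp (L x)) :
    ∃ L' : unitInterval × X → ℂ, Continuous L' ∧ ∀ p, H p = exp (L' p) := by
  let H' : C(unitInterval × X, {z : ℂ // z ≠ 0}) := ⟨fun p => ⟨H p, h0 p⟩, by fun_prop⟩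
  have e : ∀ x, H' (0, x) = (⟨exp ((⟨L, hL⟩ : C(X, ℂ)) x), exp_ne_zero _⟩ : {z : ℂ // z ≠ 0}) :=
    fun x => Subtype.ext (h x)
  refine ⟨isCoveringMap_exp.liftHomotopy H' ⟨L, hL⟩ e, (ContinuousMap.continuous _), fun p => ?_⟩
  have := congrFun (isCoveringMap_exp.liftHomotopy_lifts H' ⟨L, hL⟩ e) p
  exact (congrArg Subtype.val this).symm

/-- A nowhere vanishing continuous function on the closed unit disk has a logarithm. -/
theorem exists_log_of_closedBall (g : ℂ → ℂ) (hg : ContinuousOn g (Metric.closedBall 0 1))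
    (h0 : ∀ z ∈ Metric.closedBall (0 : ℂ) 1, g z ≠ 0) :
    ∃ L : Circle → ℂ, Continuous L ∧ ∀ z : Circle, g z = exp (L z) := by
  have mem : ∀ p : unitInterval × Circle, ((p.1 : ℝ) : ℂ) * (p.2 : ℂ) ∈ Metric.closedBall (0 : ℂ) 1 := by
    intro p
    simp only [mem_closedBall_zero_iff, norm_mul, Circle.norm_coe, mul_one, norm_real]
    rw [Real.norm_of_nonneg p.1.2.1]
    exact p.1.2.2
  obtain ⟨L, hL, h⟩ := exists_log_of_homotopy
    (fun p : unitInterval × Circle => g (((p.1 : ℝ) : ℂ) * (p.2 : ℂ)))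
    (hg.comp_continuous (by fun_prop) mem) (fun p => h0 _ (mem p))
    (fun _ => log (g 0)) continuous_const (fun x => by
      simp [exp_log (h0 0 (by simp))])
  refine ⟨fun z => L (1, z), by fun_prop, fun z => ?_⟩
  simpa using h (1, z)

/-- The increment of a logarithm over half a turn changes sign when its start moves by half a turn,
because the two increments add up to a full period. Its imaginary part therefore vanishes somewhere,
and there the exponential of a real number would be -1. -/
theorem not_exists_log_of_odd (g : Circle → ℂ) (hodd : ∀ θ : ℝ, g (Circle.exp (θ + Real.pi)) =
    -g (Circle.exp θ)) : ¬ ∃ L : Circle → ℂ, Continuous L ∧ ∀ z, g z = exp (L z) := by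
  rintro ⟨L, hL, h⟩
  have key : ∀ θ : ℝ, exp (L (Circle.exp (θ + Real.pi)) - L (Circle.exp θ)) = -1 := by
    intro θ
    rw [exp_sub, ← h, ← h, hodd, neg_div, div_self]
    rw [h]; exact exp_ne_zero _
  let d : ℝ → ℝ := fun θ => (L (Circle.exp (θ + Real.pi)) - L (Circle.exp θ)).im
  have hd : Continuous d := by
    have := hL
    fun_prop
  have hd' : d Real.pi = - d 0 := by
    have : Circle.exp (Real.pi + Real.pi) = Circle.exp 0 := by
      rw [← two_mul, Circle.exp_two_pi, Circle.exp_zero]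
    simp only [d, this, zero_add, sub_im]
    ring
  obtain ⟨θ, hθ⟩ : ∃ θ, d θ = 0 := by
    rcases le_total (d 0) 0 with h1 | h1
    · exact mem_range_of_exists_le_of_exists_ge hd ⟨0, h1⟩ ⟨Real.pi, by linarith⟩
    · exact mem_range_of_exists_le_of_exists_ge hd ⟨Real.pi, by linarith⟩ ⟨0, h1⟩
  have h2 := congrArg Complex.re (key θ)
  rw [exp_re] at h2
  have h3 : (L (Circle.exp (θ + Real.pi)) - L (Circle.exp θ)).im = 0 := hθ
  rw [h3] at h2
  simp only [Real.cos_zero, mul_one, neg_re, one_re] at h2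
  linarith [Real.exp_pos (L (Circle.exp (θ + Real.pi)) - L (Circle.exp θ)).re]

/-- The points `a = z/(1+t)` and `b = -tz/(1+t)` are distinct, so injectivity makes `F a - F b` a
nonvanishing homotopy. It runs from `F z - F 0` to the odd function `F (z/2) - F (-z/2)`, which has
no logarithm. -/
theorem not_exists_log_of_injOn (F : ℂ → ℂ) (hF : ContinuousOn F (Metric.closedBall 0 1))
    (hi : InjOn F (Metric.closedBall 0 1)) :
    ¬ ∃ L : Circle → ℂ, Continuous L ∧ ∀ z : Circle, F z - F 0 = exp (L z) := by
  rintro ⟨L, hL, h⟩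
  let a : unitInterval × Circle → ℂ := fun p => ((1 / (1 + (p.1 : ℝ)) : ℝ) : ℂ) * p.2
  let b : unitInterval × Circle → ℂ := fun p => ((-(p.1 : ℝ) / (1 + (p.1 : ℝ)) : ℝ) : ℂ) * p.2
  have pos : ∀ p : unitInterval × Circle, (0 : ℝ) < 1 + (p.1 : ℝ) := fun p => by linarith [p.1.2.1]
  have na : ∀ p, ‖a p‖ = 1 / (1 + (p.1 : ℝ)) := fun p => by
    simp only [a, norm_mul, Circle.norm_coe, mul_one, norm_real]
    exact Real.norm_of_nonneg (by have := pos p; positivity)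
  have nb : ∀ p, ‖b p‖ = (p.1 : ℝ) / (1 + (p.1 : ℝ)) := fun p => by
    simp only [b, norm_mul, Circle.norm_coe, mul_one, norm_real, neg_div, norm_neg]
    exact Real.norm_of_nonneg (div_nonneg p.1.2.1 (pos p).le)
  have ma : ∀ p, a p ∈ Metric.closedBall (0 : ℂ) 1 := fun p => by
    rw [mem_closedBall_zero_iff, na, div_le_one (pos p)]; linarith [p.1.2.1]
  have mb : ∀ p, b p ∈ Metric.closedBall (0 : ℂ) 1 := fun p => by
    rw [mem_closedBall_zero_iff, nb, div_le_one (pos p)]; linarith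
  have ca : Continuous a := by
    refine Continuous.mul (continuous_ofReal.comp (Continuous.div (by fun_prop) (by fun_prop) fun p => (pos p).ne')) (by fun_prop)
  have cb : Continuous b := by
    refine Continuous.mul (continuous_ofReal.comp (Continuous.div (by fun_prop) (by fun_prop) fun p => (pos p).ne')) (by fun_prop)
  obtain ⟨L', hL', h'⟩ := exists_log_of_homotopy (fun p : unitInterval × Circle => F (a p) - F (b p))
    ((hF.comp_continuous ca ma).sub (hF.comp_continuous cb mb)) (fun p hp => by
      have e := hi (ma p) (mb p) (sub_eq_zero.1 hp)
      have e2 : ((1 / (1 + (p.1 : ℝ)) : ℝ) : ℂ) = ((-(p.1 : ℝ) / (1 + (p.1 : ℝ)) : ℝ) : ℂ) :=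
        mul_right_cancel₀ (Circle.coe_ne_zero p.2) e
      have e3 := ofReal_injective e2
      rw [div_left_inj' (pos p).ne'] at e3
      linarith [p.1.2.1]) L hL (fun x => by
      simp only [a, b]
      simpa using h x)
  refine not_exists_log_of_odd (fun z => F (a (1, z)) - F (b (1, z))) (fun θ => ?_)
    ⟨fun z => L' (1, z), by fun_prop, fun z => h' (1, z)⟩
  have e1 : ((Circle.exp (θ + Real.pi) : Circle) : ℂ) = -(Circle.exp θ : ℂ) := by
    simp [Circle.coe_exp]
  have e2 : a (1, Circle.exp (θ + Real.pi)) = b (1, Circle.exp θ) := by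
    simp only [a, b, e1]; push_cast; ring
  have e3 : b (1, Circle.exp (θ + Real.pi)) = a (1, Circle.exp θ) := by
    simp only [a, b, e1]; push_cast; ring
  simp only [e2, e3]; ring

/-- If a value y near `F 0` were missed, `F - y` would have a logarithm on the unit circle. Sliding
y to `F 0` along a segment that avoids the image of the circle would carry it to a logarithm of `F -
F 0`. -/
theorem image_closedBall_mem_nhds (F : ℂ → ℂ) (hF : ContinuousOn F (Metric.closedBall 0 1))
    (hi : InjOn F (Metric.closedBall 0 1)) : F '' Metric.closedBall 0 1 ∈ 𝓝 (F 0) := by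
  have mc : ∀ z : Circle, (z : ℂ) ∈ Metric.closedBall (0 : ℂ) 1 := fun z => by
    rw [mem_closedBall_zero_iff, Circle.norm_coe]
  have hK : IsCompact (F '' Metric.sphere 0 1) :=
    (isCompact_sphere 0 1).image_of_continuousOn (hF.mono Metric.sphere_subset_closedBall)
  have hn : F 0 ∉ F '' Metric.sphere 0 1 := by
    rintro ⟨z, hz, e⟩
    have := hi (Metric.sphere_subset_closedBall hz) (by simp) e
    subst this; simp at hz
  obtain ⟨δ, hδ, hb⟩ := Metric.isOpen_iff.1 hK.isClosed.isOpen_compl _ hn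
  refine Filter.mem_of_superset (Metric.ball_mem_nhds _ hδ) fun y hy => ?_
  by_contra hy'
  obtain ⟨L, hL, h⟩ := exists_log_of_closedBall (fun z => F z - y) (hF.sub continuousOn_const)
    (fun z hz e => hy' ⟨z, hz, sub_eq_zero.1 e⟩)
  have hFc : Continuous fun p : unitInterval × Circle => F p.2 :=
    hF.comp_continuous (by fun_prop) (fun p => mc p.2)
  obtain ⟨L', hL', h'⟩ := exists_log_of_homotopy
    (fun p : unitInterval × Circle => F p.2 - (y + ((p.1 : ℝ) : ℂ) * (F 0 - y)))
    (hFc.sub (by fun_prop)) (fun p hp => by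
      have e : F p.2 = y + ((p.1 : ℝ) : ℂ) * (F 0 - y) := sub_eq_zero.1 hp
      refine hb (?_ : y + ((p.1 : ℝ) : ℂ) * (F 0 - y) ∈ Metric.ball (F 0) δ)
        ⟨p.2, by rw [mem_sphere_zero_iff_norm, Circle.norm_coe], e⟩
      have e2 : y + ((p.1 : ℝ) : ℂ) * (F 0 - y) - F 0 = ((1 - (p.1 : ℝ) : ℝ) : ℂ) * (y - F 0) := by
        push_cast; ring
      rw [Metric.mem_ball, dist_eq, e2, norm_mul, norm_real,
        Real.norm_of_nonneg (by linarith [p.1.2.2])]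
      rw [Metric.mem_ball, dist_eq] at hy
      nlinarith [p.1.2.1, p.1.2.2, norm_nonneg (y - F 0)]) L hL (fun z => by simpa using h z)
  exact not_exists_log_of_injOn F hF hi ⟨fun z => L' (1, z), by fun_prop, fun z => by
    simpa using h' (1, z)⟩

/-- Invariance of domain in the plane, at a point. -/
theorem image_mem_nhds_of_injOn {F : ℂ → ℂ} {U : Set ℂ} {x : ℂ} (hU : U ∈ 𝓝 x)
    (hF : ContinuousOn F U) (hi : InjOn F U) : F '' U ∈ 𝓝 (F x) := by
  obtain ⟨r, hr, hb⟩ := Metric.nhds_basis_closedBall.mem_iff.1 hU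
  have hm : MapsTo (fun z : ℂ => x + r * z) (Metric.closedBall 0 1) U := fun z hz => by
    refine hb ?_
    rw [mem_closedBall_zero_iff] at hz
    rw [Metric.mem_closedBall, dist_eq, add_sub_cancel_left, norm_mul, norm_real,
      Real.norm_of_nonneg hr.le]
    nlinarith
  have := image_closedBall_mem_nhds (fun z => F (x + r * z))
    (hF.comp (by fun_prop) hm) (fun a ha b hb' e => by
      have := hi (hm ha) (hm hb') e
      have h2 := add_left_cancel this
      exact mul_left_cancel₀ (ofReal_ne_zero.2 hr.ne') h2)
  simp only [mul_zero, add_zero] at this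
  refine Filter.mem_of_superset this ?_
  rintro _ ⟨z, hz, rfl⟩
  exact ⟨_, hm hz, rfl⟩

/-- Two continuous logarithms of the same path have the same increment. -/
theorem log_increment_eq {m₁ m₂ : unitInterval → ℂ} (h₁ : Continuous m₁) (h₂ : Continuous m₂)
    (h : ∀ t, exp (m₁ t) = exp (m₂ t)) : m₁ 1 - m₁ 0 = m₂ 1 - m₂ 0 := by
  have h0 : exp (m₁ 0 - m₂ 0) = 1 := by rw [exp_sub, h, div_self (exp_ne_zero _)]
  have := isCoveringMap_exp.eq_of_comp_eq (g₁ := m₁) (g₂ := fun t => m₂ t + (m₁ 0 - m₂ 0)) h₁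
    (by fun_prop) (by ext t; simp [exp_add, h0, h]) 0 (by ring)
  have := congrFun this 1
  linear_combination this

theorem one_sub_mem_slitPlane {w : ℂ} (h : ‖w‖ ≤ 1) (h1 : w ≠ 1) : 1 - w ∈ slitPlane := by
  left
  have h2 : w.re ≤ 1 := (re_le_norm w).trans h
  rcases h2.lt_or_eq with h3 | h3
  · simp; linarith
  · exfalso
    have h4 : w.im = 0 := by
      have : ‖w‖ ^ 2 = w.re ^ 2 + w.im ^ 2 := by rw [Complex.sq_norm, normSq_apply]; ring
      have h5 : ‖w‖ ^ 2 ≤ 1 := pow_le_one₀ (norm_nonneg _) h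
      rw [h3] at this
      nlinarith
    exact h1 (Complex.ext (by simpa using h3) (by simpa using h4))

/-- Half-angle formula: `1 - exp (iφ)` has modulus `2 sin (φ/2)` and argument `(φ - π)/2`, and the
second term is its conjugate. -/
theorem log_one_sub_exp_sub {φ : ℝ} (h0 : 0 < φ) (h1 : φ < 2 * Real.pi) :
    log (1 - exp (φ * I)) - log (1 - exp (-φ * I)) = (φ - Real.pi) * I := by
  have hs : 0 < 2 * Real.sin (φ / 2) := by
    have := Real.sin_pos_of_pos_of_lt_pi (x := φ / 2) (by linarith) (by linarith)
    linarith
  have e1 : 1 - exp (φ * I) = ((2 * Real.sin (φ / 2) : ℝ) : ℂ) *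
      (Complex.cos (((φ - Real.pi) / 2 : ℝ) : ℂ) + Complex.sin (((φ - Real.pi) / 2 : ℝ) : ℂ) * I) := by
    have ec : Real.cos ((φ - Real.pi) / 2) = Real.sin (φ / 2) := by
      rw [sub_div, Real.cos_sub_pi_div_two]
    have es : Real.sin ((φ - Real.pi) / 2) = -Real.cos (φ / 2) := by
      rw [sub_div, Real.sin_sub_pi_div_two]
    rw [← ofReal_cos, ← ofReal_sin, ec, es, exp_mul_I, ← ofReal_cos, ← ofReal_sin]
    have e3 : φ = 2 * (φ / 2) := by ring
    rw [e3, Real.cos_two_mul, Real.sin_two_mul, ← e3]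
    have := Real.sin_sq_add_cos_sq (φ / 2)
    have h4 : ((Real.sin (φ / 2) : ℂ)) ^ 2 + (Real.cos (φ / 2) : ℂ) ^ 2 = 1 := by
      exact_mod_cast this
    push_cast at h4 ⊢
    linear_combination (-2 : ℂ) * h4
  have earg : (1 - exp (φ * I)).arg = (φ - Real.pi) / 2 := by
    rw [e1, arg_mul_cos_add_sin_mul_I hs ⟨by linarith, by linarith⟩]
  have e2 : 1 - exp (-φ * I) = (starRingEnd ℂ) (1 - exp (φ * I)) := by
    rw [map_sub, map_one, ← exp_conj, map_mul, conj_ofReal, conj_I]; ring_nf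
  rw [e2, log_conj _ (by rw [earg]; intro h; linarith [Real.pi_pos])]
  have := sub_conj (log (1 - exp (φ * I)))
  rw [this, log_im, earg]
  push_cast; ring

/-- Two paths in the closed unit disk with interlaced end points on the circle meet. -/
theorem exists_crossing (α β : unitInterval → ℂ) (hα : Continuous α) (hβ : Continuous β)
    (nα : ∀ t, ‖α t‖ ≤ 1) (nβ : ∀ t, ‖β t‖ ≤ 1) {a b c d : ℝ} (hab : a < b) (hbc : b < c)
    (hcd : c < d) (hda : d < a + 2 * Real.pi)
    (ea : α 0 = exp (a * Complex.I)) (ec : α 1 = exp (c * Complex.I))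
    (eb : β 0 = exp (b * Complex.I)) (ed : β 1 = exp (d * Complex.I)) : ∃ s t, α s = β t := by
  by_contra! hne
  have nrm : ∀ (w : ℂ) (x : ℝ), ‖w‖ ≤ 1 → ‖w * exp (-x * Complex.I)‖ ≤ 1 := fun w x hw => by
    have := norm_exp_ofReal_mul_I (-x)
    push_cast at this
    rw [norm_mul, this, mul_one]; exact hw
  have ne1 : ∀ (w : ℂ) (x : ℝ), w ≠ exp (x * Complex.I) → w * exp (-x * Complex.I) ≠ 1 :=
    fun w x hw e => hw (by
      rw [← mul_one (exp _), ← e, mul_left_comm, ← exp_add]; simp)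
  have hlog : ∀ (g : unitInterval → ℂ) (x : ℝ), Continuous g → (∀ t, ‖g t‖ ≤ 1) →
      (∀ t, g t ≠ exp (x * Complex.I)) →
      Continuous fun t => log (1 - g t * exp (-x * Complex.I)) := fun g x hg hn hne =>
    Continuous.clog (by fun_prop) fun t => one_sub_mem_slitPlane (nrm _ _ (hn t)) (ne1 _ _ (hne t))
  have hexp : ∀ (w : ℂ) (x : ℝ), w ≠ exp (x * Complex.I) →
      exp (x * Complex.I + log (1 - w * exp (-x * Complex.I))) = exp (x * Complex.I) - w :=
    fun w x hw => by
      rw [exp_add, exp_log (sub_ne_zero.2 (ne1 _ _ hw).symm), mul_sub, mul_left_comm, ← exp_add]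
      simp
  have h1 : ∀ t, β t ≠ exp (a * Complex.I) := fun t e => hne 0 t (by rw [ea, e])
  have h2 : ∀ t, β t ≠ exp (c * Complex.I) := fun t e => hne 1 t (by rw [ec, e])
  have h3 : ∀ t, α t ≠ exp (b * Complex.I) := fun t e => hne t 0 (by rw [eb, e])
  have h4 : ∀ t, α t ≠ exp (d * Complex.I) := fun t e => hne t 1 (by rw [ed, e])
  -- If the paths never meet, `α s - β t` has a logarithm on the whole square, so its increments
  -- around the boundary of the square cancel. On each side one path rests at a point of the unit
  -- circle, and the increment is computed with the principal logarithm. The four values give a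
  -- total of 2πi instead of 0.
  obtain ⟨L, hL, h⟩ := exists_log_of_homotopy (fun p : unitInterval × unitInterval => α p.1 - β p.2) (by fun_prop)
    (fun p e => hne _ _ (sub_eq_zero.1 e))
    (fun t => a * Complex.I + log (1 - β t * exp (-a * Complex.I)))
    (continuous_const.add (hlog β a hβ nβ h1)) (fun t => by rw [hexp _ _ (h1 t), ea])
  have expneg : ∀ z : ℂ, exp (Real.pi * Complex.I + z) = - exp z := fun z => by
    rw [exp_add, exp_pi_mul_I]; ring
  have k1 := log_increment_eq (m₁ := fun t => L (0, t))
    (m₂ := fun t => a * Complex.I + log (1 - β t * exp (-a * Complex.I))) (by fun_prop)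
    (continuous_const.add (hlog β a hβ nβ h1))
    (fun t => by rw [← h, hexp _ _ (h1 t), ea])
  have k2 := log_increment_eq (m₁ := fun t => L (1, t))
    (m₂ := fun t => c * Complex.I + log (1 - β t * exp (-c * Complex.I))) (by fun_prop)
    (continuous_const.add (hlog β c hβ nβ h2))
    (fun t => by rw [← h, hexp _ _ (h2 t), ec])
  have k3 := log_increment_eq (m₁ := fun t => L (t, 0)) (m₂ := fun t => Real.pi * Complex.I +
      (b * Complex.I + log (1 - α t * exp (-b * Complex.I)))) (by fun_prop)
    (continuous_const.add (continuous_const.add (hlog α b hα nα h3)))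
    (fun t => by rw [← h, expneg, hexp _ _ (h3 t), eb]; ring)
  have k4 := log_increment_eq (m₁ := fun t => L (t, 1)) (m₂ := fun t => Real.pi * Complex.I +
      (d * Complex.I + log (1 - α t * exp (-d * Complex.I)))) (by fun_prop)
    (continuous_const.add (continuous_const.add (hlog α d hα nα h4)))
    (fun t => by rw [← h, expneg, hexp _ _ (h4 t), ed]; ring)
  simp only [ea, eb, ec, ed, ← exp_add] at k1 k2 k3 k4
  have r : ∀ x y : ℝ, (x : ℂ) * Complex.I + -y * Complex.I = ((x - y : ℝ) : ℂ) * Complex.I :=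
    fun x y => by push_cast; ring
  simp only [r] at k1 k2 k3 k4
  have j1 := log_one_sub_exp_sub (φ := b - a) (by linarith) (by linarith)
  have j2 := log_one_sub_exp_sub (φ := c - b) (by linarith) (by linarith)
  have j3 := log_one_sub_exp_sub (φ := d - c) (by linarith) (by linarith)
  have j4 := log_one_sub_exp_sub (φ := d - a) (by linarith) (by linarith)
  have q : ∀ x y : ℝ, -((x - y : ℝ) : ℂ) = ((y - x : ℝ) : ℂ) := fun x y => by push_cast; ring
  simp only [q] at j1 j2 j3 j4
  have fin : (2 * Real.pi : ℂ) * Complex.I = 0 := by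
    push_cast at j1 j2 j3 j4 k1 k2 k3 k4
    linear_combination -k1 + k2 - k4 + k3 - j4 + j1 + j2 + j3
  have := congrArg im fin
  simp at this

theorem eq_of_circleExp_eq {x y : ℝ} (h : Circle.exp x = Circle.exp y)
    (h1 : |x - y| < 2 * Real.pi) : x = y := by
  obtain ⟨m, hm⟩ := Circle.exp_eq_exp.1 h
  have hp := Real.two_pi_pos
  rw [hm, add_sub_cancel_left, abs_mul, abs_of_pos hp] at h1
  have h2 : |(m : ℝ)| < 1 := by
    by_contra! h3
    nlinarith
  have h3 : |m| < 1 := by exact_mod_cast h2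
  rw [Int.abs_lt_one_iff] at h3
  simp [hm, h3]

/-- A homeomorphism of the circle lifts to a map of the line that is monotone on every interval
shorter than a period. -/
theorem exists_lift_circle_homeo (k : Circle ≃ₜ Circle) :
    ∃ G : ℝ → ℝ, (∀ θ, Circle.exp (G θ) = k (Circle.exp θ)) ∧
      ∀ a d, a < d → d < a + 2 * Real.pi →
        (StrictMonoOn G (Icc a d) ∧ G d < G a + 2 * Real.pi) ∨
        (StrictAntiOn G (Icc a d) ∧ G a < G d + 2 * Real.pi) := by
  obtain ⟨e₀, he₀⟩ : ∃ e₀, Circle.exp e₀ = k (Circle.exp 0) := by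
    obtain ⟨x, hx⟩ := Circle.argEquiv.symm.surjective (k (Circle.exp 0))
    exact ⟨x, hx⟩
  obtain ⟨G, ⟨-, hG⟩, -⟩ := Circle.isCoveringMap_exp.existsUnique_continuousMap_lifts
    (⟨fun θ => k (Circle.exp θ), by fun_prop⟩ : C(ℝ, Circle)) 0 e₀ he₀
  have hG' : ∀ θ, Circle.exp (G θ) = k (Circle.exp θ) := fun θ => congrFun hG θ
  have hinj : ∀ x y, Circle.exp (G x) = Circle.exp (G y) → |x - y| < 2 * Real.pi → x = y :=
    fun x y h h1 => eq_of_circleExp_eq (k.injective (by rw [← hG', ← hG', h])) h1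
  have hp := Real.two_pi_pos
  refine ⟨G, hG', fun a d had hda => ?_⟩
  have hi : InjOn G (Icc a d) := fun x hx y hy h => hinj x y (by rw [h])
    (abs_lt.2 ⟨by linarith [hx.1, hy.2], by linarith [hx.2, hy.1]⟩)
  have hc : ContinuousOn G (Icc a d) := G.continuous.continuousOn
  -- Gaining or losing a full turn would return to the image of `a`, which is impossible within less
  -- than one period.
  have wrap : ∀ e ∈ Icc a d, G e ≠ G a + 2 * Real.pi ∧ G e ≠ G a - 2 * Real.pi := by
    intro e he
    have key : Circle.exp (G e) = Circle.exp (G a) → e = a := fun h => hinj e a h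
      (abs_lt.2 ⟨by linarith [he.1], by linarith [he.2]⟩)
    constructor
    · intro h
      have := key (by rw [h, Circle.exp_add, Circle.exp_two_pi, mul_one])
      rw [this] at h; linarith
    · intro h
      have := key (by rw [h, Circle.exp_sub, Circle.exp_two_pi, div_one])
      rw [this] at h; linarith
  rcases hc.strictMonoOn_of_injOn_Icc' had.le hi with h | h
  · refine Or.inl ⟨h, ?_⟩
    by_contra! h2
    obtain ⟨e, he, h3⟩ := intermediate_value_Icc had.le hc
      (show G a + 2 * Real.pi ∈ Icc (G a) (G d) from ⟨by linarith, h2⟩)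
    exact (wrap e he).1 h3
  · refine Or.inr ⟨h, ?_⟩
    by_contra! h2
    obtain ⟨e, he, h3⟩ := intermediate_value_Icc' had.le hc
      (show G a - 2 * Real.pi ∈ Icc (G d) (G a) from ⟨by linarith, by linarith⟩)
    exact (wrap e he).2 h3

/-- The homeomorphism may reverse the orientation. In that case running both paths backwards and
exchanging them restores increasing angles. -/
theorem exists_crossing_of_homeo (k : Circle ≃ₜ Circle) (α β : unitInterval → ℂ)
    (hα : Continuous α) (hβ : Continuous β)
    (nα : ∀ t, ‖α t‖ ≤ 1) (nβ : ∀ t, ‖β t‖ ≤ 1) {a b c d : ℝ} (hab : a < b) (hbc : b < c)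
    (hcd : c < d) (hda : d < a + 2 * Real.pi)
    (ea : α 0 = k (Circle.exp a)) (ec : α 1 = k (Circle.exp c))
    (eb : β 0 = k (Circle.exp b)) (ed : β 1 = k (Circle.exp d)) : ∃ s t, α s = β t := by
  obtain ⟨G, hG, hm⟩ := exists_lift_circle_homeo k
  have e : ∀ x, (k (Circle.exp x) : ℂ) = exp (G x * I) := fun x => by
    rw [← hG, Circle.coe_exp]
  rw [e] at ea eb ec ed
  have ia : a ∈ Icc a d := ⟨le_rfl, by linarith⟩
  have ib : b ∈ Icc a d := ⟨by linarith, by linarith⟩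
  have ic : c ∈ Icc a d := ⟨by linarith, by linarith⟩
  have id : d ∈ Icc a d := ⟨by linarith, le_rfl⟩
  rcases hm a d (by linarith) hda with ⟨h1, h2⟩ | ⟨h1, h2⟩
  · exact exists_crossing α β hα hβ nα nβ (h1 ia ib hab) (h1 ib ic hbc) (h1 ic id hcd) h2
      ea ec eb ed
  · obtain ⟨s, t, h⟩ := exists_crossing (fun t => β (unitInterval.symm t))
      (fun t => α (unitInterval.symm t)) (by fun_prop) (by fun_prop) (fun t => nβ _) (fun t => nα _)
      (h1 ic id hcd) (h1 ib ic hbc) (h1 ia ib hab) h2 (by simpa using ed) (by simpa using eb)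
      (by simpa using ec) (by simpa using ea)
    exact ⟨_, _, h.symm⟩

end ImmersedDisk

end

/-! ### Round caps and circles on the sphere -/

noncomputable section

open Set Filter Topology
open scoped RealInnerProductSpace

namespace ImmersedDisk

theorem exists_unit_orthogonal (a b : E3) : ∃ e : E3, ‖e‖ = 1 ∧ ⟪e, a⟫ = 0 ∧ ⟪e, b⟫ = 0 := by
  have h1 : Module.finrank ℝ (Submodule.span ℝ ({a, b} : Set E3)) ≤ 2 := by
    have := finrank_span_finset_le_card (R := ℝ) ({a, b} : Finset E3)
    have h2 := Finset.card_le_two (a := a) (b := b)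
    simp only [Finset.coe_insert, Finset.coe_singleton] at this
    exact this.trans h2
  have h2 := Submodule.finrank_add_finrank_orthogonal (Submodule.span ℝ ({a, b} : Set E3))
  have h3 : Module.finrank ℝ E3 = 3 := by simp
  have h4 : (Submodule.span ℝ ({a, b} : Set E3))ᗮ ≠ ⊥ := by
    intro h
    rw [h, finrank_bot] at h2
    omega
  obtain ⟨v, hv, hv0⟩ := Submodule.exists_mem_ne_zero_of_ne_bot h4
  rw [Submodule.mem_orthogonal'] at hv
  refine ⟨‖v‖⁻¹ • v, norm_smul_inv_norm hv0, ?_, ?_⟩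
  · rw [real_inner_smul_left, hv a (Submodule.subset_span (by simp)), mul_zero]
  · rw [real_inner_smul_left, hv b (Submodule.subset_span (by simp)), mul_zero]

/-- The segment from x to y lies in the ball. Pushing it along e onto the hemisphere where the
e-coordinate is nonnegative fixes the end points and stays in Q, which is invariant under
translation along e. -/
theorem joinedIn_of_hemisphere {Q : Set E3} (hQ : Convex ℝ Q) {e : E3} (he : ‖e‖ = 1)
    (hQe : ∀ x ∈ Q, ∀ τ : ℝ, x + τ • e ∈ Q) {x y : S2} (hx : (x : E3) ∈ Q) (hy : (y : E3) ∈ Q)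
    (ex : 0 ≤ ⟪e, (x : E3)⟫) (ey : 0 ≤ ⟪e, (y : E3)⟫) :
    JoinedIn {z : S2 | (z : E3) ∈ Q} x y := by
  have nx : ‖(x : E3)‖ = 1 := norm_eq_of_mem_sphere x
  have ny : ‖(y : E3)‖ = 1 := norm_eq_of_mem_sphere y
  let z : unitInterval → E3 := fun t => (1 - (t : ℝ)) • (x : E3) + (t : ℝ) • (y : E3)
  let s : unitInterval → ℝ := fun t => √(1 - (‖z t‖ ^ 2 - ⟪e, z t⟫ ^ 2))
  have hz : ∀ t, ‖z t‖ ≤ 1 := fun t => by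
    have := convex_closedBall (0 : E3) 1 (x := x) (by simp [nx]) (y := y) (by simp [ny])
      (sub_nonneg.2 t.2.2) t.2.1 (by ring)
    simpa using this
  have hzc : Continuous z := by fun_prop
  have hsc : Continuous s := by fun_prop
  have hs2 : ∀ t, s t ^ 2 = 1 - (‖z t‖ ^ 2 - ⟪e, z t⟫ ^ 2) := fun t => by
    refine Real.sq_sqrt ?_
    have := pow_le_one₀ (n := 2) (norm_nonneg _) (hz t)
    nlinarith [sq_nonneg ⟪e, z t⟫]
  let X : unitInterval → E3 := fun t => z t + (s t - ⟪e, z t⟫) • e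
  have hX : ∀ t, X t ∈ Metric.sphere (0 : E3) 1 := fun t => by
    rw [mem_sphere_zero_iff_norm, ← sq_eq_sq₀ (norm_nonneg _) zero_le_one]
    simp only [X]
    rw [norm_add_sq_real, norm_smul, he, mul_one, Real.norm_eq_abs, sq_abs, real_inner_smul_right,
      real_inner_comm e]
    linear_combination hs2 t
  have hXc : Continuous X := by fun_prop
  have end_eq : ∀ (t : unitInterval) (w : S2), z t = w → 0 ≤ ⟪e, (w : E3)⟫ → X t = w := by
    intro t w h1 h2
    have nw : ‖(w : E3)‖ = 1 := norm_eq_of_mem_sphere w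
    have : s t = ⟪e, (w : E3)⟫ := by
      simp only [s, h1, nw]
      rw [← Real.sqrt_sq h2]; congr 1; ring_nf; rw [Real.sqrt_sq h2]
    simp only [X, this, h1]; simp
  refine ⟨⟨⟨fun t => ⟨X t, hX t⟩, by fun_prop⟩, ?_, ?_⟩, fun t => ?_⟩
  · exact Subtype.ext (end_eq 0 x (by simp [z]) ex)
  · exact Subtype.ext (end_eq 1 y (by simp [z]) ey)
  · exact hQe _ (hQ hx hy (sub_nonneg.2 t.2.2) t.2.1 (by ring)) _

/-- A point on the equator orthogonal to e belongs to both hemispheres, so every point of Q can be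
joined to it. It is obtained by projecting x along e and then moving in the direction w until the
sphere is reached. -/
theorem joinedIn_of_convex {Q : Set E3} (hQ : Convex ℝ Q) {e w : E3} (he : ‖e‖ = 1)
    (hw : ‖w‖ = 1) (hwe : ⟪w, e⟫ = 0) (hQe : ∀ x ∈ Q, ∀ τ : ℝ, x + τ • e ∈ Q)
    (hQw : ∀ x ∈ Q, ∀ τ : ℝ, 0 ≤ τ → x + τ • w ∈ Q) {x y : S2} (hx : (x : E3) ∈ Q)
    (hy : (y : E3) ∈ Q) : JoinedIn {z : S2 | (z : E3) ∈ Q} x y := by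
  have nx : ‖(x : E3)‖ = 1 := norm_eq_of_mem_sphere x
  let v : E3 := (x : E3) + (-⟪e, (x : E3)⟫) • e
  have hv : ⟪e, v⟫ = 0 := by
    simp only [v, inner_add_right, real_inner_smul_right, real_inner_self_eq_norm_sq, he]; ring
  have nv : ‖v‖ ^ 2 ≤ 1 := by
    simp only [v]
    rw [norm_add_sq_real, norm_smul, he, nx, mul_one, Real.norm_eq_abs, sq_abs,
      real_inner_smul_right, real_inner_comm]
    nlinarith [sq_nonneg ⟪e, (x : E3)⟫]
  let τ : ℝ := -⟪v, w⟫ + √(⟪v, w⟫ ^ 2 + (1 - ‖v‖ ^ 2))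
  have hr : 0 ≤ ⟪v, w⟫ ^ 2 + (1 - ‖v‖ ^ 2) := by nlinarith [sq_nonneg ⟪v, w⟫]
  have hτ : 0 ≤ τ := by
    have := Real.abs_le_sqrt (x := ⟪v, w⟫) (y := ⟪v, w⟫ ^ 2 + (1 - ‖v‖ ^ 2)) (by linarith)
    have := le_abs_self ⟪v, w⟫
    simp only [τ]; linarith
  have hb : v + τ • w ∈ Metric.sphere (0 : E3) 1 := by
    rw [mem_sphere_zero_iff_norm, ← sq_eq_sq₀ (norm_nonneg _) zero_le_one, norm_add_sq_real,
      norm_smul, hw, mul_one, Real.norm_eq_abs, sq_abs, real_inner_smul_right]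
    have := Real.sq_sqrt hr
    simp only [τ]
    linear_combination this
  let b : S2 := ⟨v + τ • w, hb⟩
  have hbQ : (b : E3) ∈ Q := hQw _ (hQe _ hx _) _ hτ
  have hbe : ⟪e, (b : E3)⟫ = 0 := by
    simp only [b, inner_add_right, hv, real_inner_smul_right, real_inner_comm w e, hwe]
    ring
  have key : ∀ z : S2, (z : E3) ∈ Q → JoinedIn {z : S2 | (z : E3) ∈ Q} z b := by
    intro z hz
    rcases le_total 0 ⟪e, (z : E3)⟫ with h | h
    · exact joinedIn_of_hemisphere hQ he hQe hz hbQ h hbe.ge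
    · refine joinedIn_of_hemisphere hQ (e := -e) (by rw [norm_neg, he]) (fun x hx τ => ?_) hz hbQ
        (by rw [inner_neg_left]; linarith) (by rw [inner_neg_left]; linarith)
      have := hQe x hx (-τ)
      simpa using this
  exact (key x hx).trans (key y hy).symm

/-- The intersection of the sphere with two half spaces is path connected. -/
theorem joinedIn_wedge (a b : E3) {s t : Set ℝ} (hs : IsUpperSet s) (ht : IsUpperSet t) {x y : S2}
    (hx : ⟪a, (x : E3)⟫ ∈ s ∧ ⟪b, (x : E3)⟫ ∈ t) (hy : ⟪a, (y : E3)⟫ ∈ s ∧ ⟪b, (y : E3)⟫ ∈ t) :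
    JoinedIn {z : S2 | ⟪a, (z : E3)⟫ ∈ s ∧ ⟪b, (z : E3)⟫ ∈ t} x y := by
  obtain ⟨e, he, hea, heb⟩ := exists_unit_orthogonal a b
  -- Orthogonality to e and a leaves the sign of w free, which is spent on its product with b.
  obtain ⟨w, hw, hwe, hwa, hwb⟩ : ∃ w : E3, ‖w‖ = 1 ∧ ⟪w, e⟫ = 0 ∧ 0 ≤ ⟪w, a⟫ ∧ 0 ≤ ⟪w, b⟫ := by
    obtain ⟨w, hw, hwe, hwa⟩ := exists_unit_orthogonal e a
    rcases le_total 0 ⟪w, b⟫ with h | h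
    · exact ⟨w, hw, hwe, hwa.ge, h⟩
    · exact ⟨-w, by rw [norm_neg, hw], by rw [inner_neg_left, hwe, neg_zero],
        by rw [inner_neg_left, hwa, neg_zero], by rw [inner_neg_left]; linarith⟩
  refine joinedIn_of_convex (Q := {z : E3 | ⟪a, z⟫ ∈ s ∧ ⟪b, z⟫ ∈ t}) ?_ he hw hwe ?_ ?_ hx hy
  · intro x hx y hy p q hp hq hpq
    have c1 := hs.ordConnected.convex hx.1 hy.1 hp hq hpq
    have c2 := ht.ordConnected.convex hx.2 hy.2 hp hq hpq
    simp only [mem_ofPred_eq, inner_add_right, real_inner_smul_right]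
    exact ⟨by simpa using c1, by simpa using c2⟩
  · intro x hx τ
    simp only [mem_ofPred_eq, inner_add_right, real_inner_smul_right, real_inner_comm e a,
      real_inner_comm e b, hea, heb, mul_zero, add_zero]
    exact hx
  · intro x hx τ hτ
    simp only [mem_ofPred_eq, inner_add_right, real_inner_smul_right, real_inner_comm w a,
      real_inner_comm w b]
    exact ⟨hs (le_add_of_nonneg_right (mul_nonneg hτ hwa)) hx.1,
      ht (le_add_of_nonneg_right (mul_nonneg hτ hwb)) hx.2⟩

/-! ### The pencil of circles tangent to a given direction -/

/-- The signed height of `x` with respect to the circle of geodesic curvature `k` through `y` with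
normal `N`. -/
def lev (y N : E3) (k : ℝ) (x : S2) : ℝ := ⟪N, (x : E3)⟫ - k * (1 - ⟪y, (x : E3)⟫)

/-- For a unit vector N orthogonal to y on the sphere, these are the closed round cap on the side of
N, its interior, and its boundary circle, all based at y. -/
def cap (y N : E3) (k : ℝ) : Set S2 := {x | 0 ≤ lev y N k x}

def ocap (y N : E3) (k : ℝ) : Set S2 := {x | 0 < lev y N k x}

def cir (y N : E3) (k : ℝ) : Set S2 := {x | lev y N k x = 0}

theorem mem_cap {y N : E3} {k : ℝ} {x : S2} : x ∈ cap y N k ↔ 0 ≤ lev y N k x := Iff.rfl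

theorem mem_ocap {y N : E3} {k : ℝ} {x : S2} : x ∈ ocap y N k ↔ 0 < lev y N k x := Iff.rfl

theorem mem_cir {y N : E3} {k : ℝ} {x : S2} : x ∈ cir y N k ↔ lev y N k x = 0 := Iff.rfl

@[fun_prop]
theorem continuous_lev (y N : E3) (k : ℝ) : Continuous (lev y N k) := by
  unfold lev; fun_prop

theorem lev_eq (y N : E3) (k : ℝ) (x : S2) : lev y N k x = ⟪N + k • y, (x : E3)⟫ - k := by
  rw [lev, inner_add_left, real_inner_smul_left]; ring

theorem isClosed_cap (y N : E3) (k : ℝ) : IsClosed (cap y N k) :=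
  isClosed_le continuous_const (by fun_prop)

theorem isOpen_ocap (y N : E3) (k : ℝ) : IsOpen (ocap y N k) :=
  isOpen_lt continuous_const (by fun_prop)

theorem isClosed_cir (y N : E3) (k : ℝ) : IsClosed (cir y N k) :=
  isClosed_eq (by fun_prop) continuous_const

theorem ocap_subset_cap (y N : E3) (k : ℝ) : ocap y N k ⊆ cap y N k := fun _ h => mem_cap.2 (mem_ocap.1 h).le

theorem cir_subset_cap (y N : E3) (k : ℝ) : cir y N k ⊆ cap y N k := fun _ h => mem_cap.2 (mem_cir.1 h).ge

theorem cap_eq_ocap_union_cir (y N : E3) (k : ℝ) : cap y N k = ocap y N k ∪ cir y N k := by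
  ext x
  simp only [cap, ocap, cir, mem_union, mem_ofPred_eq, le_iff_lt_or_eq, eq_comm]

theorem inner_le_one (y x : S2) : ⟪(y : E3), (x : E3)⟫ ≤ 1 := by
  have := real_inner_le_norm (y : E3) (x : E3)
  rwa [norm_eq_of_mem_sphere, norm_eq_of_mem_sphere, mul_one] at this

theorem inner_lt_one {y x : S2} (h : x ≠ y) : ⟪(y : E3), (x : E3)⟫ < 1 := by
  refine lt_of_le_of_ne (inner_le_one y x) fun e => h ?_
  rw [inner_eq_one_iff_of_norm_eq_one (norm_eq_of_mem_sphere _) (norm_eq_of_mem_sphere _)] at e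
  exact Subtype.ext e.symm

theorem lev_anti (y : S2) (N : E3) {k k' : ℝ} (h : k ≤ k') (x : S2) :
    lev y N k' x ≤ lev y N k x := by
  have := inner_le_one y x
  unfold lev; nlinarith

theorem lev_lt {y : S2} (N : E3) {k k' : ℝ} (h : k < k') {x : S2} (hx : x ≠ y) :
    lev y N k' x < lev y N k x := by
  have := inner_lt_one hx
  unfold lev; nlinarith

theorem lev_self (y : S2) {N : E3} (h : ⟪N, (y : E3)⟫ = 0) (k : ℝ) : lev y N k y = 0 := by
  rw [lev, h, real_inner_self_eq_norm_sq, norm_eq_of_mem_sphere]; ring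

theorem cap_anti (y : S2) (N : E3) {k k' : ℝ} (h : k ≤ k') : cap y N k' ⊆ cap y N k :=
  fun x hx => (mem_cap.1 hx).trans (lev_anti y N h x)

theorem cap_diff_subset_ocap {y : S2} (N : E3) {k k' : ℝ} (h : k < k') {x : S2}
    (hx : x ∈ cap y N k') (hxy : x ≠ y) : x ∈ ocap y N k :=
  (mem_cap.1 hx).trans_lt (lev_lt N h hxy)

theorem joinedIn_cap_inter {y N y' N' : E3} {k k' : ℝ} {a b : S2}
    (ha : a ∈ cap y N k ∩ cap y' N' k') (hb : b ∈ cap y N k ∩ cap y' N' k') :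
    JoinedIn (cap y N k ∩ cap y' N' k') a b := by
  have e : cap y N k ∩ cap y' N' k' = {z : S2 | ⟪N + k • y, (z : E3)⟫ ∈ Ici k ∧
      ⟪N' + k' • y', (z : E3)⟫ ∈ Ici k'} := by
    ext z; simp [cap, lev_eq]
  rw [e] at ha hb ⊢
  exact joinedIn_wedge _ _ (isUpperSet_Ici _) (isUpperSet_Ici _) ha hb

theorem joinedIn_cap_diff {y N y' N' : E3} {k k' : ℝ} {a b : S2}
    (ha : a ∈ cap y N k \ cap y' N' k') (hb : b ∈ cap y N k \ cap y' N' k') :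
    JoinedIn (cap y N k \ cap y' N' k') a b := by
  have e : cap y N k \ cap y' N' k' = {z : S2 | ⟪N + k • y, (z : E3)⟫ ∈ Ici k ∧
      ⟪-(N' + k' • y'), (z : E3)⟫ ∈ Ioi (-k')} := by
    ext z; simp only [mem_cap, lev_eq, Set.mem_sdiff, mem_ofPred_eq, inner_neg_left, mem_Ici, mem_Ioi]
    constructor
    · rintro ⟨h1, h2⟩; exact ⟨by linarith, by linarith⟩
    · rintro ⟨h1, h2⟩; exact ⟨by linarith, by linarith⟩
  rw [e] at ha hb ⊢
  exact joinedIn_wedge _ _ (isUpperSet_Ici _) (isUpperSet_Ioi _) ha hb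

theorem joinedIn_cap {y N : E3} {k : ℝ} {a b : S2} (ha : a ∈ cap y N k) (hb : b ∈ cap y N k) :
    JoinedIn (cap y N k) a b := by
  have := joinedIn_cap_inter (y := y) (N := N) (k := k) (y' := y) (N' := N) (k' := k) ⟨ha, ha⟩ ⟨hb, hb⟩
  rwa [inter_self] at this

theorem isPreconnected_of_joinedIn {X : Type*} [TopologicalSpace X] {s : Set X}
    (h : ∀ x ∈ s, ∀ y ∈ s, JoinedIn s x y) : IsPreconnected s := by
  rcases s.eq_empty_or_nonempty with rfl | ⟨x, hx⟩
  · exact isPreconnected_empty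
  · exact IsPathConnected.isConnected ⟨x, hx, fun {y} hy => h x hx y hy⟩ |>.isPreconnected

theorem isPreconnected_cap (y N : E3) (k : ℝ) : IsPreconnected (cap y N k) :=
  isPreconnected_of_joinedIn fun _ hx _ hy => joinedIn_cap hx hy

theorem ball_eq (c : S2) (δ : ℝ) (hδ : 0 < δ) :
    Metric.ball c δ = {z : S2 | ⟪(c : E3), (z : E3)⟫ ∈ Ioi (1 - δ ^ 2 / 2)} := by
  ext z
  rw [Metric.mem_ball, Subtype.dist_eq, dist_eq_norm, ← sq_lt_sq₀ (norm_nonneg _) hδ.le,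
    norm_sub_sq_real, norm_eq_of_mem_sphere, norm_eq_of_mem_sphere, real_inner_comm]
  simp only [mem_ofPred_eq, mem_Ioi]
  constructor <;> intro h <;> linarith

/-- A ball of the sphere is itself a cap, so this is a wedge. Together with its open version it
provides the connected pieces to which `exists_control` is applied. -/
theorem isPreconnected_cap_inter_ball (y N : E3) (k : ℝ) (c : S2) {δ : ℝ} (hδ : 0 < δ) :
    IsPreconnected (cap y N k ∩ Metric.ball c δ) := by
  have e : cap y N k ∩ Metric.ball c δ = {z : S2 | ⟪N + k • y, (z : E3)⟫ ∈ Ici k ∧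
      ⟪(c : E3), (z : E3)⟫ ∈ Ioi (1 - δ ^ 2 / 2)} := by
    rw [ball_eq c δ hδ]
    ext z; simp [cap, lev_eq]
  rw [e]
  exact isPreconnected_of_joinedIn fun _ hx _ hy =>
    joinedIn_wedge _ _ (isUpperSet_Ici _) (isUpperSet_Ioi _) hx hy

theorem isPreconnected_ocap_inter_ball (y N : E3) (k : ℝ) (c : S2) {δ : ℝ} (hδ : 0 < δ) :
    IsPreconnected (ocap y N k ∩ Metric.ball c δ) := by
  have e : ocap y N k ∩ Metric.ball c δ = {z : S2 | ⟪N + k • y, (z : E3)⟫ ∈ Ioi k ∧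
      ⟪(c : E3), (z : E3)⟫ ∈ Ioi (1 - δ ^ 2 / 2)} := by
    rw [ball_eq c δ hδ]
    ext z; simp [ocap, lev_eq]
  rw [e]
  exact isPreconnected_of_joinedIn fun _ hx _ hy =>
    joinedIn_wedge _ _ (isUpperSet_Ioi _) (isUpperSet_Ioi _) hx hy

/-- A circle minus the base point is path connected. -/
theorem joinedIn_cir_diff {y : S2} {N : E3} (hN : ⟪N, (y : E3)⟫ = 0) {k : ℝ} {a b : S2}
    (ha : a ∈ cir y N k \ {y}) (hb : b ∈ cir y N k \ {y}) : JoinedIn (cir y N k \ {y}) a b := by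
  -- Inversion centred at y. It sends the sphere without y to a plane and the punctured circle to a
  -- line in it, so that the segment between two images can be carried back to the circle.
  let u : S2 → E3 := fun x => (1 - ⟪(y : E3), (x : E3)⟫)⁻¹ • ((x : E3) - (y : E3))
  have ny : ‖(y : E3)‖ = 1 := norm_eq_of_mem_sphere y
  have yy : ⟪(y : E3), (y : E3)⟫ = 1 := by rw [real_inner_self_eq_norm_sq, ny]; norm_num
  have pos : ∀ x ∈ cir (y : E3) N k \ {y}, 0 < 1 - ⟪(y : E3), (x : E3)⟫ := fun x hx => by
    linarith [inner_lt_one hx.2]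
  have uy : ∀ x ∈ cir (y : E3) N k \ {y}, ⟪(y : E3), u x⟫ = -1 := fun x hx => by
    have := pos x hx
    simp only [u, real_inner_smul_right, inner_sub_right, yy]
    field_simp; ring
  have uN : ∀ x ∈ cir (y : E3) N k \ {y}, ⟪N, u x⟫ = k := fun x hx => by
    have := pos x hx
    have h2 := mem_cir.1 hx.1
    unfold lev at h2
    simp only [u, real_inner_smul_right, inner_sub_right, hN]
    field_simp; linarith
  have un : ∀ x ∈ cir (y : E3) N k \ {y}, 2 / ‖u x‖ ^ 2 = 1 - ⟪(y : E3), (x : E3)⟫ := fun x hx => by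
    have := pos x hx
    simp only [u]
    rw [norm_smul, mul_pow, norm_sub_sq_real, norm_eq_of_mem_sphere, norm_eq_of_mem_sphere,
      norm_inv, Real.norm_of_nonneg this.le, real_inner_comm (y : E3) (x : E3)]
    have e : (1 : ℝ) ^ 2 - 2 * ⟪(y : E3), (x : E3)⟫ + 1 ^ 2 = 2 * (1 - ⟪(y : E3), (x : E3)⟫) := by
      ring
    rw [e]; field_simp
  let v : unitInterval → E3 := fun t => (1 - (t : ℝ)) • u a + (t : ℝ) • u b
  have vc : Continuous v := by fun_prop
  have vy : ∀ t, ⟪(y : E3), v t⟫ = -1 := fun t => by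
    simp only [v, inner_add_right, real_inner_smul_right, uy a ha, uy b hb]; ring
  have vN : ∀ t, ⟪N, v t⟫ = k := fun t => by
    simp only [v, inner_add_right, real_inner_smul_right, uN a ha, uN b hb]; ring
  have v0 : ∀ t, ‖v t‖ ≠ 0 := fun t h => by
    have := vy t
    rw [norm_eq_zero.1 h, inner_zero_right] at this
    norm_num at this
  let X : unitInterval → E3 := fun t => (y : E3) + (2 / ‖v t‖ ^ 2) • v t
  have Xc : Continuous X := by
    refine continuous_const.add (Continuous.smul (Continuous.div continuous_const (by fun_prop)
      fun t => pow_ne_zero _ (v0 t)) vc)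
  have hX : ∀ t, X t ∈ Metric.sphere (0 : E3) 1 := fun t => by
    rw [mem_sphere_zero_iff_norm, ← sq_eq_sq₀ (norm_nonneg _) zero_le_one, norm_add_sq_real,
      norm_smul, ny, real_inner_smul_right, vy, norm_div, norm_pow, norm_norm]
    have := v0 t
    norm_num
    field_simp; ring
  have ends : ∀ t, ∀ x ∈ cir (y : E3) N k \ {y}, v t = u x → X t = x := fun t x hx h => by
    have := pos x hx
    simp only [X, h, un x hx, u]
    rw [smul_inv_smul₀ this.ne']; abel
  refine ⟨⟨⟨fun t => ⟨X t, hX t⟩, by fun_prop⟩, ?_, ?_⟩, fun t => ⟨?_, ?_⟩⟩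
  · exact Subtype.ext (ends 0 a ha (by simp [v]))
  · exact Subtype.ext (ends 1 b hb (by simp [v]))
  · change lev y N k ⟨X t, hX t⟩ = 0
    simp only [lev, X, inner_add_right, real_inner_smul_right, vy, vN, hN, yy]
    ring
  · intro h
    have h2 := congrArg Subtype.val (mem_singleton_iff.1 h)
    have h3 : (2 / ‖v t‖ ^ 2) • v t = 0 := by
      have : (y : E3) + (2 / ‖v t‖ ^ 2) • v t = y := h2
      simpa using this
    have := v0 t
    rcases smul_eq_zero.1 h3 with h4 | h4
    · have h5 : 2 / ‖v t‖ ^ 2 ≠ 0 := by positivity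
      exact h5 h4
    · simp [h4] at this

/-- Along the great circle that leaves a point of the boundary circle perpendicularly, the height is
`sin τ - k (1 - cos τ)`. Its derivative at 0 is 1, so the path enters the open cap at once. -/
theorem cap_subset_closure_ocap {y : S2} {N : E3} (hN : ‖N‖ = 1) (hNy : ⟪N, (y : E3)⟫ = 0) (k : ℝ) :
    cap y N k ⊆ closure (ocap y N k) := by
  intro x hx
  rw [cap_eq_ocap_union_cir] at hx
  rcases hx with hx | hx
  · exact subset_closure hx
  have nx : ‖(x : E3)‖ = 1 := norm_eq_of_mem_sphere x
  have ny : ‖(y : E3)‖ = 1 := norm_eq_of_mem_sphere y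
  let W : E3 := N + k • (y : E3)
  have hW : ‖W‖ ^ 2 = 1 + k ^ 2 := by
    simp only [W]
    rw [norm_add_sq_real, norm_smul, hN, ny, real_inner_smul_right, hNy, Real.norm_eq_abs, mul_one,
      sq_abs]; ring
  have hWx : ⟪W, (x : E3)⟫ = k := by
    have := mem_cir.1 hx
    rw [lev_eq] at this
    linarith
  have hxx : ⟪(x : E3), (x : E3)⟫ = 1 := by rw [real_inner_self_eq_norm_sq, nx]; norm_num
  let X : ℝ → E3 := fun τ => Real.cos τ • (x : E3) + Real.sin τ • (W - k • (x : E3))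
  have hX : ∀ τ, X τ ∈ Metric.sphere (0 : E3) 1 := fun τ => by
    rw [mem_sphere_zero_iff_norm, ← sq_eq_sq₀ (norm_nonneg _) zero_le_one]
    simp only [X]
    rw [norm_add_sq_real, norm_smul, norm_smul, real_inner_smul_left, real_inner_smul_right,
      inner_sub_right, real_inner_smul_right, hxx, real_inner_comm W, hWx, nx, mul_pow, mul_pow,
      norm_sub_sq_real, hW, norm_smul, real_inner_smul_right, hWx, nx, mul_pow,
      Real.norm_eq_abs, Real.norm_eq_abs, Real.norm_eq_abs, sq_abs, sq_abs, sq_abs]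
    linear_combination Real.sin_sq_add_cos_sq τ
  have hl : ∀ τ, lev y N k ⟨X τ, hX τ⟩ = Real.sin τ - k * (1 - Real.cos τ) := fun τ => by
    rw [lev_eq]
    change ⟪W, X τ⟫ - k = _
    simp only [X, inner_add_right, inner_sub_right, real_inner_smul_right, hWx,
      real_inner_self_eq_norm_sq, hW]
    ring
  have hd : HasDerivAt (fun τ => Real.sin τ - k * (1 - Real.cos τ)) 1 0 := by
    have := (Real.hasDerivAt_sin 0).fun_sub (((hasDerivAt_const (0 : ℝ) (1 : ℝ)).fun_sub
      (Real.hasDerivAt_cos 0)).const_mul k)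
    simpa using this
  have hpos : ∀ᶠ τ in 𝓝[>] (0 : ℝ), (⟨X τ, hX τ⟩ : S2) ∈ ocap y N k := by
    have := hasDerivAt_iff_tendsto_slope.1 hd
    have h2 := (this.mono_left (nhdsWithin_mono 0 (fun x (hx : x ∈ Ioi (0 : ℝ)) =>
      (ne_of_gt hx : x ≠ 0)))).eventually (lt_mem_nhds zero_lt_one)
    filter_upwards [h2, self_mem_nhdsWithin] with τ h3 h4
    rw [mem_ocap, hl]
    have h5 : (0 : ℝ) < τ := h4
    rw [slope_def_field] at h3
    simp only [Real.sin_zero, Real.cos_zero, sub_self, mul_zero, sub_zero] at h3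
    exact (div_pos_iff_of_pos_right h5).1 h3
  have hc : Tendsto (fun τ => (⟨X τ, hX τ⟩ : S2)) (𝓝[>] 0) (𝓝 x) := by
    have h1 : Continuous fun τ => (⟨X τ, hX τ⟩ : S2) := by fun_prop
    have h2 := h1.tendsto 0
    have h3 : (⟨X 0, hX 0⟩ : S2) = x := Subtype.ext (by simp [X])
    rw [h3] at h2
    exact h2.mono_left nhdsWithin_le_nhds
  exact mem_closure_of_tendsto hc hpos

theorem isRoundCircle_cir {y : S2} {N : E3} (hN : ‖N‖ = 1) (hNy : ⟪N, (y : E3)⟫ = 0) (k : ℝ) :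
    IsRoundCircle (cir y N k) := by
  have ny : ‖(y : E3)‖ = 1 := norm_eq_of_mem_sphere y
  have hW : ‖N + k • (y : E3)‖ ^ 2 = 1 + k ^ 2 := by
    rw [norm_add_sq_real, norm_smul, hN, ny, real_inner_smul_right, hNy, Real.norm_eq_abs, mul_one,
      sq_abs]; ring
  have hW0 : 0 < ‖N + k • (y : E3)‖ := by
    by_contra! h
    have := le_antisymm h (norm_nonneg _)
    rw [this] at hW
    nlinarith [sq_nonneg k]
  refine ⟨‖N + k • (y : E3)‖⁻¹ • (N + k • (y : E3)), k / ‖N + k • (y : E3)‖,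
    norm_smul_inv_norm (norm_pos_iff.1 hW0), ?_, ?_⟩
  · rw [abs_div, abs_of_pos hW0, div_lt_one hW0]
    refine abs_lt_of_sq_lt_sq ?_ hW0.le
    linarith
  · ext x
    rw [mem_cir, lev_eq, mem_ofPred_eq, real_inner_smul_left, div_eq_inv_mul]
    rw [mul_right_inj' (inv_ne_zero hW0.ne'), sub_eq_zero]

theorem eq_sum_inner {p N T : E3} (hp : ‖p‖ = 1) (hN : ‖N‖ = 1) (hT : ‖T‖ = 1) (hpN : ⟪N, p⟫ = 0)
    (hpT : ⟪T, p⟫ = 0) (hNT : ⟪N, T⟫ = 0) (x : E3) :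
    x = ⟪p, x⟫ • p + ⟪N, x⟫ • N + ⟪T, x⟫ • T := by
  have ho : Orthonormal ℝ ![p, N, T] := by
    rw [orthonormal_iff_ite]
    intro i j
    fin_cases i <;> fin_cases j <;>
      simp [hp, hN, hT, hpN, hpT, hNT, real_inner_comm N p, real_inner_comm T p, real_inner_comm N T]
  let B := OrthonormalBasis.mk ho (ho.linearIndependent.span_eq_top_of_card_eq_finrank'
    (by simp)).ge
  have := B.sum_repr' x
  simp only [B, OrthonormalBasis.coe_mk, Fin.sum_univ_three] at this
  exact this.symm

/-- A round circle through `p` tangent to `T` belongs to the pencil of tangent circles. -/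
theorem exists_eq_cir {p : S2} {N T : E3} (hN : ‖N‖ = 1) (hT : ‖T‖ = 1) (hpN : ⟪N, (p : E3)⟫ = 0)
    (hpT : ⟪T, (p : E3)⟫ = 0) (hNT : ⟪N, T⟫ = 0) {n : E3} {t : ℝ} (hn : ‖n‖ = 1) (ht : |t| < 1)
    (hnp : ⟪n, (p : E3)⟫ = t) (hnT : ⟪n, T⟫ = 0) :
    ∃ k, {x : S2 | ⟪n, (x : E3)⟫ = t} = cir p N k := by
  have np : ‖(p : E3)‖ = 1 := norm_eq_of_mem_sphere p
  have e := eq_sum_inner np hN hT hpN hpT hNT n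
  rw [real_inner_comm n T, hnT, zero_smul, add_zero, real_inner_comm n, hnp] at e
  set c := ⟪N, n⟫
  have h1 : t ^ 2 + c ^ 2 = 1 := by
    have h2 : ‖n‖ ^ 2 = 1 := by rw [hn]; norm_num
    rw [e, norm_add_sq_real, norm_smul, norm_smul, np, hN, real_inner_smul_left,
      real_inner_smul_right, real_inner_comm, hpN, mul_one, mul_one, Real.norm_eq_abs,
      Real.norm_eq_abs, sq_abs, sq_abs] at h2
    linarith
  have hc : c ≠ 0 := by
    intro h
    rw [h] at h1
    have := (sq_lt_one_iff_abs_lt_one t).2 ht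
    linarith
  refine ⟨t / c, ?_⟩
  ext x
  rw [mem_ofPred_eq, mem_cir, e, inner_add_left, real_inner_smul_left, real_inner_smul_left, lev]
  field_simp
  constructor <;> intro h <;> linarith

end ImmersedDisk

end

/-! ### Normal frame of a spherical curve and parallel coordinates -/

noncomputable section

open Set Filter Topology
open scoped RealInnerProductSpace

namespace ImmersedDisk

/-- A regular spherical curve together with a unit normal field and its geodesic curvature. -/
structure Frame (γ : ℝ → S2) (γ' N : ℝ → E3) (κ : ℝ → ℝ) : Prop where
  hasDerivAt_curve : ∀ θ, HasDerivAt (fun t => (γ t : E3)) (γ' θ) θ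
  continuous_deriv : Continuous γ'
  deriv_ne_zero : ∀ θ, γ' θ ≠ 0
  norm_normal : ∀ θ, ‖N θ‖ = 1
  inner_normal_curve : ∀ θ, ⟪N θ, (γ θ : E3)⟫ = 0
  inner_normal_deriv : ∀ θ, ⟪N θ, γ' θ⟫ = 0
  hasDerivAt_normal : ∀ θ, HasDerivAt N (-κ θ • γ' θ) θ
  continuous_curvature : Continuous κ

namespace Frame

variable {γ : ℝ → S2} {γ' N : ℝ → E3} {κ : ℝ → ℝ}

theorem neg (F : Frame γ γ' N κ) : Frame γ γ' (-N) (-κ) where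
  hasDerivAt_curve := F.hasDerivAt_curve
  continuous_deriv := F.continuous_deriv
  deriv_ne_zero := F.deriv_ne_zero
  norm_normal θ := by rw [Pi.neg_apply, norm_neg, F.norm_normal]
  inner_normal_curve θ := by rw [Pi.neg_apply, inner_neg_left, F.inner_normal_curve, neg_zero]
  inner_normal_deriv θ := by rw [Pi.neg_apply, inner_neg_left, F.inner_normal_deriv, neg_zero]
  hasDerivAt_normal θ := by
    have := (F.hasDerivAt_normal θ).neg
    rw [← neg_smul] at this
    exact this
  continuous_curvature := F.continuous_curvature.neg

theorem continuous_curve (F : Frame γ γ' N κ) : Continuous γ :=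
  Continuous.subtype_mk (f := fun t => (γ t : E3))
    (continuous_iff_continuousAt.2 fun θ => (F.hasDerivAt_curve θ).continuousAt) _

theorem continuous_normal (F : Frame γ γ' N κ) : Continuous N :=
  continuous_iff_continuousAt.2 fun θ => (F.hasDerivAt_normal θ).continuousAt

theorem inner_deriv_curve (F : Frame γ γ' N κ) (θ : ℝ) : ⟪γ' θ, (γ θ : E3)⟫ = 0 := by
  have h := (F.hasDerivAt_curve θ).inner ℝ (F.hasDerivAt_curve θ)
  have h2 : (fun t => ⟪(γ t : E3), (γ t : E3)⟫) = fun _ => (1 : ℝ) := by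
    ext t; rw [real_inner_self_eq_norm_sq, norm_eq_of_mem_sphere]; norm_num
  rw [h2] at h
  have := h.unique (hasDerivAt_const θ (1 : ℝ))
  rw [real_inner_comm (γ' θ)] at this
  linarith

theorem inner_self (_ : Frame γ γ' N κ) (θ : ℝ) : ⟪(γ θ : E3), (γ θ : E3)⟫ = 1 := by
  rw [real_inner_self_eq_norm_sq, norm_eq_of_mem_sphere]; norm_num

theorem inner_normal_self (F : Frame γ γ' N κ) (θ : ℝ) : ⟪N θ, N θ⟫ = 1 := by
  rw [real_inner_self_eq_norm_sq, F.norm_normal]; norm_num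

/-- The parallel coordinates around the curve. -/
def fermi (F : Frame γ γ' N κ) (z : ℝ × ℝ) : S2 :=
  ⟨Real.cos z.2 • (γ z.1 : E3) + Real.sin z.2 • N z.1, by
    rw [mem_sphere_zero_iff_norm, ← sq_eq_sq₀ (norm_nonneg _) zero_le_one, norm_add_sq_real,
      norm_smul, norm_smul, F.norm_normal, norm_eq_of_mem_sphere, real_inner_smul_left,
      real_inner_smul_right, real_inner_comm, F.inner_normal_curve, mul_one, mul_one,
      Real.norm_eq_abs, Real.norm_eq_abs, sq_abs, sq_abs]
    linear_combination Real.cos_sq_add_sin_sq z.2⟩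

theorem coe_fermi (F : Frame γ γ' N κ) (z : ℝ × ℝ) :
    (F.fermi z : E3) = Real.cos z.2 • (γ z.1 : E3) + Real.sin z.2 • N z.1 := rfl

@[simp]
theorem fermi_zero (F : Frame γ γ' N κ) (θ : ℝ) : F.fermi (θ, 0) = γ θ :=
  Subtype.ext (by simp [coe_fermi])

theorem continuous_fermi (F : Frame γ γ' N κ) : Continuous F.fermi := by
  have h1 := F.continuous_curve
  have h2 := F.continuous_normal
  exact Continuous.subtype_mk (by fun_prop) _

theorem contDiff_curve (F : Frame γ γ' N κ) : ContDiff ℝ 1 fun t => (γ t : E3) := by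
  rw [contDiff_one_iff_deriv]
  refine ⟨fun θ => (F.hasDerivAt_curve θ).differentiableAt, ?_⟩
  rw [show deriv (fun t => (γ t : E3)) = γ' from funext fun θ => (F.hasDerivAt_curve θ).deriv]
  exact F.continuous_deriv

theorem contDiff_normal (F : Frame γ γ' N κ) : ContDiff ℝ 1 N := by
  rw [contDiff_one_iff_deriv]
  refine ⟨fun θ => (F.hasDerivAt_normal θ).differentiableAt, ?_⟩
  rw [show deriv N = fun θ => -κ θ • γ' θ from funext fun θ => (F.hasDerivAt_normal θ).deriv]
  exact F.continuous_curvature.neg.smul F.continuous_deriv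

theorem hasFDerivAt_inner_fermi (F : Frame γ γ' N κ) (v : E3) (θ : ℝ) :
    HasFDerivAt (fun z => ⟪v, (F.fermi z : E3)⟫)
      (⟪v, γ' θ⟫ • ContinuousLinearMap.fst ℝ ℝ ℝ + ⟪v, N θ⟫ • ContinuousLinearMap.snd ℝ ℝ ℝ)
      (θ, 0) := by
  have ha : HasDerivAt (fun t => ⟪v, (γ t : E3)⟫) ⟪v, γ' θ⟫ θ := by
    simpa using (hasDerivAt_const θ v).inner ℝ (F.hasDerivAt_curve θ)
  have hb : HasDerivAt (fun t => ⟪v, N t⟫) ⟪v, -κ θ • γ' θ⟫ θ := by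
    simpa using (hasDerivAt_const θ v).inner ℝ (F.hasDerivAt_normal θ)
  have h1 := ha.comp_hasFDerivAt ((θ, 0) : ℝ × ℝ) (hasFDerivAt_fst (𝕜 := ℝ))
  have h2 := hb.comp_hasFDerivAt ((θ, 0) : ℝ × ℝ) (hasFDerivAt_fst (𝕜 := ℝ))
  have h3 := (Real.hasDerivAt_cos 0).comp_hasFDerivAt ((θ, 0) : ℝ × ℝ) (hasFDerivAt_snd (𝕜 := ℝ))
  have h4 := (Real.hasDerivAt_sin 0).comp_hasFDerivAt ((θ, 0) : ℝ × ℝ) (hasFDerivAt_snd (𝕜 := ℝ))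
  have h5 := (h3.mul h1).add (h4.mul h2)
  refine (h5.congr_fderiv ?_).congr_of_eventuallyEq (Eventually.of_forall fun z => ?_)
  · ext <;> simp
  · simp [coe_fermi, inner_add_right, real_inner_smul_right]

/-- The orthogonal projection Q to the tangent plane at the base is injective on the open hemisphere
around it. Followed by Q, the parallel coordinates become a C¹ map of the plane with invertible
derivative at `(θ, 0)`; the inverse function theorem applies to that map and is pulled back through
Q. -/
theorem exists_openPartialHomeomorph (F : Frame γ γ' N κ) (θ : ℝ) :
    ∃ e : OpenPartialHomeomorph (ℝ × ℝ) S2, (θ, 0) ∈ e.source ∧ ∀ z, e z = F.fermi z := by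
  let q : ℝ × ℝ → ℝ × ℝ := fun z => (⟪γ' θ, (F.fermi z : E3)⟫, ⟪N θ, (F.fermi z : E3)⟫)
  have hv : ⟪γ' θ, γ' θ⟫ ≠ 0 := inner_self_ne_zero.2 (F.deriv_ne_zero θ)
  have hq : ContDiff ℝ 1 q := by
    have h1 := F.contDiff_curve
    have h2 := F.contDiff_normal
    have h3 : ContDiff ℝ 1 fun z : ℝ × ℝ => (F.fermi z : E3) := by
      simp only [coe_fermi]
      exact ((Real.contDiff_cos.comp contDiff_snd).smul (h1.comp contDiff_fst)).add
        ((Real.contDiff_sin.comp contDiff_snd).smul (h2.comp contDiff_fst))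
    exact (contDiff_const.inner ℝ h3).prodMk (contDiff_const.inner ℝ h3)
  let D : (ℝ × ℝ) ≃L[ℝ] (ℝ × ℝ) :=
    (ContinuousLinearEquiv.unitsEquivAut ℝ (Units.mk0 _ hv)).prodCongr (.refl ℝ ℝ)
  have hD : HasFDerivAt q (D : (ℝ × ℝ) →L[ℝ] (ℝ × ℝ)) (θ, 0) := by
    refine ((F.hasFDerivAt_inner_fermi (γ' θ) θ).prodMk
      (F.hasFDerivAt_inner_fermi (N θ) θ)).congr_fderiv ?_
    ext <;> simp [D, F.inner_normal_deriv, real_inner_comm (N θ) (γ' θ), F.norm_normal]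
  let e₀ := hq.contDiffAt.toOpenPartialHomeomorph q hD (by norm_num)
  have he₀ : ∀ z, e₀ z = q z := fun z => rfl
  have hmem : (θ, 0) ∈ e₀.source := hq.contDiffAt.mem_toOpenPartialHomeomorph_source hD (by norm_num)
  let Q : S2 → ℝ × ℝ := fun x => (⟪γ' θ, (x : E3)⟫, ⟪N θ, (x : E3)⟫)
  have hQc : Continuous Q := by fun_prop
  have hinj : ∀ x y : S2, 0 < ⟪(γ θ : E3), (x : E3)⟫ → 0 < ⟪(γ θ : E3), (y : E3)⟫ → Q x = Q y →
      x = y := by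
    intro x y hx hy hxy
    have h1 := congrArg Prod.fst hxy
    have h2 := congrArg Prod.snd hxy
    simp only [Q] at h1 h2
    have nT : ‖γ' θ‖ ≠ 0 := norm_ne_zero_iff.2 (F.deriv_ne_zero θ)
    have hs := fun z => eq_sum_inner (p := (γ θ : E3)) (N := N θ) (T := ‖γ' θ‖⁻¹ • γ' θ)
      (norm_eq_of_mem_sphere _) (F.norm_normal θ) (norm_smul_inv_norm (F.deriv_ne_zero θ))
      (F.inner_normal_curve θ) (by rw [real_inner_smul_left, F.inner_deriv_curve, mul_zero])
      (by rw [real_inner_smul_right, F.inner_normal_deriv, mul_zero]) z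
    have h3 : (x : E3) - y = (⟪(γ θ : E3), (x : E3)⟫ - ⟪(γ θ : E3), (y : E3)⟫) • (γ θ : E3) := by
      have hx' := hs x
      have hy' := hs y
      simp only [real_inner_smul_left] at hx' hy'
      rw [h1, h2] at hx'
      refine (congrArg₂ (· - ·) hx' hy').trans ?_
      module
    have h4 : ⟪(x : E3) - y, (x : E3) + y⟫ = 0 := by
      rw [inner_sub_left, inner_add_right, inner_add_right, real_inner_self_eq_norm_sq,
        real_inner_self_eq_norm_sq, norm_eq_of_mem_sphere, norm_eq_of_mem_sphere,
        real_inner_comm]; ring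
    rw [h3, real_inner_smul_left, inner_add_right] at h4
    rcases mul_eq_zero.1 h4 with h5 | h5
    · rw [h5, zero_smul, sub_eq_zero] at h3
      exact Subtype.ext h3
    · linarith
  let H : Set S2 := {x | 0 < ⟪(γ θ : E3), (x : E3)⟫}
  have hH : IsOpen H := isOpen_lt continuous_const (by fun_prop)
  let e : OpenPartialHomeomorph (ℝ × ℝ) S2 :=
    { toFun := F.fermi
      invFun := fun x => e₀.symm (Q x)
      source := e₀.source ∩ F.fermi ⁻¹' H
      target := H ∩ (Q ⁻¹' e₀.target ∩ (fun x => F.fermi (e₀.symm (Q x))) ⁻¹' H)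
      map_source' := by
        rintro z ⟨h1, h2⟩
        have h3 : Q (F.fermi z) = e₀ z := rfl
        refine ⟨h2, ?_, ?_⟩
        · rw [mem_preimage, h3]; exact e₀.map_source h1
        · rw [mem_preimage, h3, e₀.left_inv h1]; exact h2
      map_target' := by
        rintro x ⟨_, h2, h3⟩
        exact ⟨e₀.map_target h2, h3⟩
      left_inv' := by
        rintro z ⟨h1, _⟩
        exact e₀.left_inv h1
      right_inv' := by
        rintro x ⟨h1, h2, h3⟩
        exact hinj _ _ h3 h1 (e₀.right_inv h2)
      open_source := e₀.open_source.inter (hH.preimage F.continuous_fermi)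
      open_target := by
        refine hH.inter ?_
        have hc : ContinuousOn (fun x => F.fermi (e₀.symm (Q x))) (Q ⁻¹' e₀.target) :=
          F.continuous_fermi.comp_continuousOn
            (e₀.continuousOn_symm.comp hQc.continuousOn fun _ h => h)
        exact hc.isOpen_inter_preimage (e₀.open_target.preimage hQc) hH
      continuousOn_toFun := F.continuous_fermi.continuousOn
      continuousOn_invFun := e₀.continuousOn_symm.comp hQc.continuousOn fun _ h => h.2.1 }
  refine ⟨e, ⟨hmem, ?_⟩, fun z => rfl⟩
  change F.fermi (θ, 0) ∈ H
  rw [fermi_zero]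
  change 0 < ⟪(γ θ : E3), (γ θ : E3)⟫
  rw [F.inner_self]; norm_num

theorem map_fermi_nhds (F : Frame γ γ' N κ) (θ : ℝ) :
    map F.fermi (𝓝 (θ, 0)) = 𝓝 (γ θ) := by
  obtain ⟨e, he, h⟩ := F.exists_openPartialHomeomorph θ
  have := e.map_nhds_eq he
  rw [h, fermi_zero] at this
  rw [← this]
  congr 1
  exact (funext h).symm

theorem exists_injOn_fermi (F : Frame γ γ' N κ) (θ : ℝ) :
    ∃ V ∈ 𝓝 ((θ, 0) : ℝ × ℝ), InjOn F.fermi V := by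
  obtain ⟨e, he, h⟩ := F.exists_openPartialHomeomorph θ
  refine ⟨e.source, e.open_source.mem_nhds he, ?_⟩
  rw [← funext h]
  exact e.injOn

end Frame

/-! ### The frame of a curve of class `C²` -/

/-- The vector product in Euclidean three-space. -/
def cross (a b : E3) : E3 := WithLp.toLp 2 (crossProduct a.ofLp b.ofLp)

theorem inner_cross (a b c : E3) :
    ⟪cross a b, c⟫ = Matrix.det (Matrix.of ![a.ofLp, b.ofLp, c.ofLp]) := by
  simp [cross, cross_apply, PiLp.inner_apply, Fin.sum_univ_three, Matrix.det_fin_three]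
  ring

theorem inner_cross_left (a b : E3) : ⟪cross a b, a⟫ = 0 := by
  simp [cross, cross_apply, PiLp.inner_apply, Fin.sum_univ_three]; ring

theorem inner_cross_right (a b : E3) : ⟪cross a b, b⟫ = 0 := by
  simp [cross, cross_apply, PiLp.inner_apply, Fin.sum_univ_three]; ring

theorem norm_cross_sq (a b : E3) : ‖cross a b‖ ^ 2 = ‖a‖ ^ 2 * ‖b‖ ^ 2 - ⟪a, b⟫ ^ 2 := by
  simp [cross, cross_apply, PiLp.inner_apply, Fin.sum_univ_three, EuclideanSpace.norm_sq_eq]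
  ring

theorem contDiff_cross {n : WithTop ℕ∞} {a b : ℝ → E3} (ha : ContDiff ℝ n a) (hb : ContDiff ℝ n b) :
    ContDiff ℝ n fun t => cross (a t) (b t) := by
  rw [contDiff_euclidean] at *
  intro i
  fin_cases i <;> simp [cross, cross_apply]
  · exact ((ha 1).mul (hb 2)).sub ((ha 2).mul (hb 1))
  · exact ((ha 2).mul (hb 0)).sub ((ha 0).mul (hb 2))
  · exact ((ha 0).mul (hb 1)).sub ((ha 1).mul (hb 0))

/-- The normal `γ × γ' / |γ'|` is of class C¹. Differentiating its norm and its products with γ and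
γ' shows that N' has no component along N or γ, and that `⟪γ', N'⟫ = -⟪N, γ''⟫`, which is the
curvature up to sign and scale. -/
theorem exists_frame {γ : ℝ → S2} (h2 : ContDiff ℝ 2 fun t => (γ t : E3))
    (h0 : ∀ θ, deriv (fun t => (γ t : E3)) θ ≠ 0) :
    ∃ N, Frame γ (deriv fun t => (γ t : E3)) N (geodesicCurvature fun t => (γ t : E3)) := by
  set c : ℝ → E3 := fun t => (γ t : E3)
  have hd : ContDiff ℝ 1 (deriv c) := by
    have h3 : ContDiff ℝ (1 + 1) c := by rwa [one_add_one_eq_two]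
    exact (contDiff_succ_iff_deriv.1 h3).2.2
  have hdd : Continuous (deriv (deriv c)) := (contDiff_one_iff_deriv.1 hd).2
  have nc : ∀ θ, ‖c θ‖ = 1 := fun θ => norm_eq_of_mem_sphere _
  have hc : ∀ θ, HasDerivAt c (deriv c θ) θ := fun θ =>
    (h2.differentiable (by norm_num) θ).hasDerivAt
  have horth : ∀ θ, ⟪c θ, deriv c θ⟫ = 0 := fun θ => by
    have h := (hc θ).inner ℝ (hc θ)
    have h2 : (fun t => ⟪c t, c t⟫) = fun _ => (1 : ℝ) := by
      ext t; rw [real_inner_self_eq_norm_sq, nc]; norm_num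
    rw [h2] at h
    have := h.unique (hasDerivAt_const θ (1 : ℝ))
    rw [real_inner_comm (c θ) (deriv c θ)] at this
    linarith
  let N : ℝ → E3 := fun θ => ‖deriv c θ‖⁻¹ • cross (c θ) (deriv c θ)
  have hv : ∀ θ, ‖deriv c θ‖ ≠ 0 := fun θ => norm_ne_zero_iff.2 (h0 θ)
  have hN1 : ContDiff ℝ 1 N := by
    refine ContDiff.smul (ContDiff.inv (hd.norm ℝ h0) hv) (contDiff_cross (h2.of_le (by norm_num)) hd)
  have nN : ∀ θ, ‖N θ‖ = 1 := fun θ => by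
    have h := norm_cross_sq (c θ) (deriv c θ)
    rw [nc, horth, one_pow, one_mul, zero_pow two_ne_zero, sub_zero,
      sq_eq_sq₀ (norm_nonneg _) (norm_nonneg _)] at h
    simp only [N]
    rw [norm_smul, h, norm_inv, norm_norm, inv_mul_cancel₀ (hv θ)]
  have hNc : ∀ θ, ⟪N θ, c θ⟫ = 0 := fun θ => by
    simp only [N]; rw [real_inner_smul_left, inner_cross_left, mul_zero]
  have hNd : ∀ θ, ⟪N θ, deriv c θ⟫ = 0 := fun θ => by
    simp only [N]; rw [real_inner_smul_left, inner_cross_right, mul_zero]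
  have hκ : ∀ θ, ⟪N θ, deriv (deriv c) θ⟫ = geodesicCurvature c θ * ‖deriv c θ‖ ^ 2 := fun θ => by
    have := hv θ
    simp only [N, geodesicCurvature]
    rw [real_inner_smul_left, inner_cross]
    field_simp
  refine ⟨N, hc, hd.continuous, h0, nN, hNc, hNd, fun θ => ?_, ?_⟩
  · have hN := (hN1.differentiable (by norm_num) θ).hasDerivAt
    have e1 : ⟪N θ, deriv N θ⟫ = 0 := by
      have h := hN.inner ℝ hN
      have h2 : (fun t => ⟪N t, N t⟫) = fun _ => (1 : ℝ) := by
        ext t; rw [real_inner_self_eq_norm_sq, nN]; norm_num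
      rw [h2] at h
      have := h.unique (hasDerivAt_const θ (1 : ℝ))
      rw [real_inner_comm (N θ) (deriv N θ)] at this
      linarith
    have e2 : ⟪c θ, deriv N θ⟫ = 0 := by
      have h := hN.inner ℝ (hc θ)
      rw [funext hNc] at h
      have := h.unique (hasDerivAt_const θ (0 : ℝ))
      rw [hNd, real_inner_comm (c θ), zero_add] at this
      exact this
    have e3 : ⟪deriv c θ, deriv N θ⟫ = -geodesicCurvature c θ * ‖deriv c θ‖ ^ 2 := by
      have h := hN.inner ℝ ((hd.differentiable (by norm_num) θ).hasDerivAt)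
      rw [funext hNd] at h
      have := h.unique (hasDerivAt_const θ (0 : ℝ))
      rw [hκ, real_inner_comm (deriv c θ)] at this
      linarith
    have hs := eq_sum_inner (p := c θ) (N := N θ) (T := ‖deriv c θ‖⁻¹ • deriv c θ)
      (nc θ) (nN θ) (norm_smul_inv_norm (h0 θ)) (hNc θ)
      (by rw [real_inner_smul_left, real_inner_comm, horth, mul_zero])
      (by rw [real_inner_smul_right, hNd, mul_zero]) (deriv N θ)
    rw [e1, e2, real_inner_smul_left, e3, zero_smul, zero_smul, zero_add, zero_add, smul_smul] at hs
    have e4 : ‖deriv c θ‖⁻¹ * (-geodesicCurvature c θ * ‖deriv c θ‖ ^ 2) * ‖deriv c θ‖⁻¹ =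
        -geodesicCurvature c θ := by
      have := hv θ
      field_simp
    rw [e4] at hs
    rw [← hs]
    exact hN
  · have h : geodesicCurvature c = fun θ => ⟪N θ, deriv (deriv c) θ⟫ / ‖deriv c θ‖ ^ 2 := by
      ext θ
      rw [hκ, mul_div_cancel_right₀]
      exact pow_ne_zero _ (hv θ)
    rw [h]
    exact Continuous.div (hN1.continuous.inner hdd) (by have := hd.continuous; fun_prop)
      fun θ => pow_ne_zero _ (hv θ)

end ImmersedDisk

end

/-! ### The disk near a boundary point -/

noncomputable section

open Set Filter Topology
open scoped RealInnerProductSpace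

namespace ImmersedDisk

/-- Invariance of domain for maps from the plane to a surface. -/
theorem image_mem_nhds_of_chart {Y : Type*} [TopologicalSpace Y] (ch : OpenPartialHomeomorph Y ℂ)
    {g : ℂ → Y} {V : Set ℂ} {z : ℂ} (hV : V ∈ 𝓝 z) (hg : ContinuousOn g V) (hi : InjOn g V)
    (hz : g z ∈ ch.source) : g '' V ∈ 𝓝 (g z) := by
  have hgz : ContinuousAt g z := hg.continuousAt hV
  have hs : ∀ᶠ w in 𝓝 z, g w ∈ ch.source := hgz.eventually (ch.open_source.mem_nhds hz)
  let V' := V ∩ {w | g w ∈ ch.source}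
  have hV' : V' ∈ 𝓝 z := inter_mem hV hs
  have h1 := image_mem_nhds_of_injOn (F := fun w => ch (g w)) hV'
    (ch.continuousOn.comp (hg.mono inter_subset_left) fun w hw => hw.2)
    (fun a ha b hb e => hi ha.1 hb.1 (ch.injOn ha.2 hb.2 e))
  have h2 := (ch.continuousAt hz).preimage_mem_nhds h1
  filter_upwards [h2, ch.open_source.mem_nhds hz] with y hy hy'
  obtain ⟨w, hw, e⟩ := hy
  exact ⟨w, hw.1, ch.injOn hw.2 hy' e⟩

section Disk

variable {M : Type*} [TopologicalSpace M]

/-- The boundary curve of the disk. -/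
def bd {h : M ≃ₜ UnitDisk} (φ : Circle ≃ₜ bdry h) (θ : ℝ) : M := (φ (Circle.exp θ) : M)

/-- The point of the disk with a given complex coordinate. -/
def diskPt (h : M ≃ₜ UnitDisk) (z : ℂ) : M :=
  h.symm ⟨((max 1 ‖z‖)⁻¹ : ℝ) • z, by
    have h1 : (0 : ℝ) < max 1 ‖z‖ := lt_max_of_lt_left one_pos
    rw [mem_closedBall_zero_iff, norm_smul, norm_inv, Real.norm_of_nonneg h1.le,
      inv_mul_le_iff₀ h1, mul_one]
    exact le_max_right _ _⟩

theorem continuous_diskPt (h : M ≃ₜ UnitDisk) : Continuous (diskPt h) := by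
  have h1 : Continuous fun z : ℂ => ((max 1 ‖z‖)⁻¹ : ℝ) :=
    Continuous.inv₀ (by fun_prop) fun z => (lt_max_of_lt_left one_pos).ne'
  exact h.symm.continuous.comp (Continuous.subtype_mk (h1.smul continuous_id) _)

theorem coe_diskPt (h : M ≃ₜ UnitDisk) {z : ℂ} (hz : ‖z‖ ≤ 1) : (h (diskPt h z) : ℂ) = z := by
  simp [diskPt, max_eq_left hz]

theorem diskPt_coe (h : M ≃ₜ UnitDisk) (x : M) : diskPt h (h x : ℂ) = x := by
  have hx : ‖(h x : ℂ)‖ ≤ 1 := mem_closedBall_zero_iff.1 (h x).2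
  refine h.injective (Subtype.ext ?_)
  rw [coe_diskPt h hx]

variable {h : M ≃ₜ UnitDisk} (φ : Circle ≃ₜ bdry h)

theorem continuous_bd : Continuous (bd φ) := by
  unfold bd; fun_prop

theorem bd_mem (θ : ℝ) : bd φ θ ∈ bdry h := (φ (Circle.exp θ)).2

theorem norm_bd (θ : ℝ) : ‖(h (bd φ θ) : ℂ)‖ = 1 := bd_mem φ θ

theorem bd_periodic (θ : ℝ) : bd φ (θ + 2 * Real.pi) = bd φ θ := by
  simp [bd, Circle.exp_add]

theorem eq_of_bd_eq {x y : ℝ} (e : bd φ x = bd φ y) (hxy : |x - y| < 2 * Real.pi) : x = y :=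
  eq_of_circleExp_eq (φ.injective (Subtype.ext e)) hxy

theorem exists_bd_eq {p : M} (hp : p ∈ bdry h) (a : ℝ) : ∃ θ ∈ Ico a (a + 2 * Real.pi), bd φ θ = p := by
  obtain ⟨z, hz⟩ := φ.surjective ⟨p, hp⟩
  obtain ⟨x, hx⟩ : ∃ x, Circle.exp x = z := by
    obtain ⟨x, hx⟩ := Circle.argEquiv.symm.surjective z
    exact ⟨x, hx⟩
  refine ⟨toIcoMod Real.two_pi_pos a x, toIcoMod_mem_Ico _ _ _, ?_⟩
  have : bd φ (toIcoMod Real.two_pi_pos a x) = bd φ x := by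
    have hper : Function.Periodic (bd φ) (2 * Real.pi) := bd_periodic φ
    rw [← self_sub_toIcoDiv_zsmul, zsmul_eq_mul]
    exact hper.sub_int_mul_eq _
  rw [this, bd, hx, hz]

theorem exists_nhds_bd {θ₀ : ℝ} {J : Set ℝ} (hJ : J ∈ 𝓝 θ₀) :
    ∃ U ∈ 𝓝 (bd φ θ₀), ∀ x ∈ U, x ∈ bdry h → ∃ θ ∈ J, bd φ θ = x := by
  have h1 : Circle.exp '' J ∈ 𝓝 (Circle.exp θ₀) :=
    Circle.isCoveringMap_exp.isLocalHomeomorph.isOpenMap.image_mem_nhds hJ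
  have h2 := φ.isOpenMap.image_mem_nhds h1
  obtain ⟨U, hU, hs⟩ := mem_nhds_subtype _ _ _ |>.1 h2
  refine ⟨U, hU, fun x hx hb => ?_⟩
  obtain ⟨_, ⟨θ, hθ, rfl⟩, e⟩ := hs (show (⟨x, hb⟩ : bdry h) ∈ Subtype.val ⁻¹' U from hx)
  exact ⟨θ, hθ, congrArg Subtype.val e⟩

/-- A topological immersion of a disk is open at interior points. -/
theorem image_mem_nhds_of_interior {f : M → S2} (hf : IsTopImmersion f) {x : M} (hx : x ∉ bdry h)
    {U : Set M} (hU : U ∈ 𝓝 x) : f '' U ∈ 𝓝 (f x) := by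
  have : Fact (Module.finrank ℝ E3 = 2 + 1) := ⟨by simp⟩
  obtain ⟨U₀, hU₀, hi⟩ := hf.2 x
  let ψ : EuclideanSpace ℝ (Fin 2) ≃ₜ ℂ := Complex.orthonormalBasisOneI.repr.symm.toHomeomorph
  let ch : OpenPartialHomeomorph S2 ℂ := (chartAt (EuclideanSpace ℝ (Fin 2)) (f x)).transHomeomorph ψ
  have hlt : ‖(h x : ℂ)‖ < 1 := lt_of_le_of_ne (mem_closedBall_zero_iff.1 (h x).2) hx
  have hV : {z : ℂ | ‖z‖ < 1} ∩ diskPt h ⁻¹' (U ∩ U₀) ∈ 𝓝 (h x : ℂ) := by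
    refine inter_mem ((isOpen_lt continuous_norm continuous_const).mem_nhds hlt) ?_
    refine (continuous_diskPt h).continuousAt.preimage_mem_nhds ?_
    rw [diskPt_coe]
    exact inter_mem hU hU₀
  have := image_mem_nhds_of_chart ch (g := fun z => f (diskPt h z)) hV
    (hf.1.comp (continuous_diskPt h)).continuousOn (fun a ha b hb e => by
      have e1 := hi ha.2.2 hb.2.2 e
      rw [← coe_diskPt h (le_of_lt ha.1), e1, coe_diskPt h (le_of_lt hb.1)]) (by
      rw [diskPt_coe]
      exact mem_chart_source (EuclideanSpace ℝ (Fin 2)) (f x))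
  rw [diskPt_coe] at this
  refine Filter.mem_of_superset this ?_
  rintro _ ⟨z, hz, rfl⟩
  exact ⟨_, hz.2.1, rfl⟩

/-- The image of a neighbourhood of a boundary point lies on one side of the boundary curve and
fills a one-sided neighbourhood. -/
theorem exists_side {f : M → S2} (hf : IsTopImmersion f) {γ' N : ℝ → E3} {κ : ℝ → ℝ}
    (F : Frame (fun θ => f (bd φ θ)) γ' N κ) (θ₀ : ℝ) :
    ∃ ε : ℝ, (ε = 1 ∨ ε = -1) ∧
      (∀ U ∈ 𝓝 (bd φ θ₀), ∀ᶠ z in 𝓝 (θ₀, (0 : ℝ)), 0 ≤ ε * z.2 → F.fermi z ∈ f '' U) ∧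
      (∃ U ∈ 𝓝 (bd φ θ₀), ∀ᶠ z in 𝓝 (θ₀, (0 : ℝ)), F.fermi z ∈ f '' U → 0 ≤ ε * z.2) := by
  obtain ⟨e, he, hef⟩ := F.exists_openPartialHomeomorph θ₀
  obtain ⟨U₀, hU₀, hi⟩ := hf.2 (bd φ θ₀)
  let z₀ : ℂ := (h (bd φ θ₀) : ℂ)
  have hz₀ : ‖z₀‖ = 1 := norm_bd φ θ₀
  have hg₀ : diskPt h z₀ = bd φ θ₀ := diskPt_coe h _
  have hmk : Continuous fun θ : ℝ => (θ, (0 : ℝ)) := by fun_prop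
  let J : Set ℝ := {θ | bd φ θ ∈ U₀} ∩ {θ | (θ, (0 : ℝ)) ∈ e.source}
  have hJ : J ∈ 𝓝 θ₀ := inter_mem ((continuous_bd φ).continuousAt.preimage_mem_nhds hU₀)
    ((e.open_source.preimage hmk).mem_nhds he)
  obtain ⟨U₁, hU₁, hU₁J⟩ := exists_nhds_bd φ hJ
  let G : ℂ → ℝ × ℝ := fun z => e.symm (f (diskPt h z))
  have efz₀ : f (diskPt h z₀) = e (θ₀, 0) := by rw [hg₀, hef, F.fermi_zero]
  have hG₀ : G z₀ = (θ₀, 0) := by simp only [G, efz₀]; exact e.left_inv he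
  have hfg : Continuous fun z => f (diskPt h z) := hf.1.comp (continuous_diskPt h)
  have htgt : f (diskPt h z₀) ∈ e.target := by rw [efz₀]; exact e.map_source he
  have hGc : ContinuousOn G {z | f (diskPt h z) ∈ e.target} :=
    e.continuousOn_symm.comp hfg.continuousOn fun _ hz => hz
  have hT : {z | f (diskPt h z) ∈ e.target} ∈ 𝓝 z₀ := (e.open_target.preimage hfg).mem_nhds htgt
  have hO : ∀ᶠ z in 𝓝 z₀, diskPt h z ∈ U₀ ∧ diskPt h z ∈ U₁ ∧ f (diskPt h z) ∈ e.target ∧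
      (G z).1 ∈ J := by
    have c1 : ∀ W ∈ 𝓝 (bd φ θ₀), ∀ᶠ z in 𝓝 z₀, diskPt h z ∈ W := fun W hW =>
      (continuous_diskPt h).continuousAt.preimage_mem_nhds (by rw [hg₀]; exact hW)
    have c2 : ∀ᶠ z in 𝓝 z₀, (G z).1 ∈ J :=
      (continuous_fst.continuousAt.comp (hGc.continuousAt hT)).preimage_mem_nhds
        (by simp only [Function.comp, hG₀]; exact hJ)
    filter_upwards [c1 _ hU₀, c1 _ hU₁, hT, c2] with z a b c d
    exact ⟨a, b, c, d⟩
  obtain ⟨η', hη', hb'⟩ := Metric.eventually_nhds_iff_ball.1 hO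
  have heG : ∀ z ∈ Metric.ball z₀ η', e (G z) = f (diskPt h z) := fun z hz =>
    e.right_inv (hb' z hz).2.2.1
  have hGball : ContinuousOn G (Metric.ball z₀ η') := hGc.mono fun z hz => (hb' z hz).2.2.1
  have hon : ∀ z ∈ Metric.ball z₀ η', ‖z‖ = 1 → (G z).2 = 0 := by
    intro z hz hz1
    obtain ⟨θ, hθ, e1⟩ := hU₁J _ (hb' z hz).2.1 (by
      change ‖(h (diskPt h z) : ℂ)‖ = 1
      rw [coe_diskPt h hz1.le, hz1])
    have : G z = (θ, 0) := by
      simp only [G, ← e1]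
      rw [← e.left_inv hθ.2, hef, F.fermi_zero]
    rw [this]
  have hin : ∀ z ∈ Metric.ball z₀ η', ‖z‖ < 1 → (G z).2 ≠ 0 := by
    intro z hz hz1 h0
    obtain ⟨c1, c2, c3, c4⟩ := hb' z hz
    have e1 : G z = ((G z).1, 0) := Prod.ext rfl h0
    have e2 : f (bd φ (G z).1) = f (diskPt h z) := by
      rw [← heG z hz, e1, hef, F.fermi_zero]
    have e3 := hi c4.1 c1 e2
    have e4 := norm_bd φ (G z).1
    rw [e3, coe_diskPt h hz1.le] at e4
    exact hz1.ne e4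
  -- `(G z).2` is the signed distance of the image from the boundary curve. By local injectivity it
  -- has no zero in the interior of the disk near `z₀`, and that part of the disk is convex, so its
  -- sign there is constant.
  have hsign : ∃ ε : ℝ, (ε = 1 ∨ ε = -1) ∧ ∀ z ∈ Metric.ball z₀ η', ‖z‖ < 1 → 0 < ε * (G z).2 := by
    have hpc : IsPreconnected (Metric.ball z₀ η' ∩ Metric.ball 0 1) :=
      ((convex_ball z₀ η').inter (convex_ball 0 1)).isPreconnected
    have hc : ContinuousOn (fun z => (G z).2) (Metric.ball z₀ η' ∩ Metric.ball 0 1) :=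
      continuous_snd.comp_continuousOn (hGball.mono inter_subset_left)
    by_cases hex : ∃ a ∈ Metric.ball z₀ η' ∩ Metric.ball (0 : ℂ) 1, 0 < (G a).2
    · obtain ⟨a, ha, ha0⟩ := hex
      refine ⟨1, Or.inl rfl, fun z hz hz1 => ?_⟩
      rw [one_mul]
      by_contra! hneg
      obtain ⟨c, hc1, hc2⟩ := hpc.intermediate_value ⟨hz, mem_ball_zero_iff.2 hz1⟩ ha hc
        ⟨hneg, ha0.le⟩
      exact hin c hc1.1 (mem_ball_zero_iff.1 hc1.2) hc2
    · push Not at hex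
      refine ⟨-1, Or.inr rfl, fun z hz hz1 => ?_⟩
      have h1 := hex z ⟨hz, mem_ball_zero_iff.2 hz1⟩
      have h2 := hin z hz hz1
      have := lt_of_le_of_ne h1 h2
      linarith
  obtain ⟨ε, hε, hpos⟩ := hsign
  have hnonneg : ∀ z ∈ Metric.ball z₀ η', ‖z‖ ≤ 1 → 0 ≤ ε * (G z).2 := by
    intro z hz hz1
    rcases hz1.lt_or_eq with h1 | h1
    · exact (hpos z hz h1).le
    · rw [hon z hz h1, mul_zero]
  refine ⟨ε, hε, fun U hU => ?_, ?_⟩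
  -- Doubling: `ι` reflects the exterior of the unit disk into the interior, and `D` extends G by
  -- reflecting its second coordinate accordingly. The extension is continuous and injective on a
  -- full neighbourhood of `z₀`, so invariance of domain applies; the values with `0 ≤ ε * r` come
  -- from the disk itself.
  · let ι : ℂ → ℂ := fun z => (((max 1 ‖z‖) ^ 2)⁻¹ : ℝ) • z
    have mpos : ∀ z : ℂ, (0 : ℝ) < max 1 ‖z‖ := fun z => lt_max_of_lt_left one_pos
    have hιc : Continuous ι :=
      Continuous.smul (Continuous.inv₀ (by fun_prop) fun z => pow_ne_zero _ (mpos z).ne') continuous_id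
    have ι_in : ∀ z, ‖z‖ ≤ 1 → ι z = z := fun z hz => by simp [ι, max_eq_left hz]
    have ι_norm : ∀ z, 1 < ‖z‖ → ‖ι z‖ = ‖z‖⁻¹ := fun z hz => by
      simp only [ι, max_eq_right hz.le]
      rw [norm_smul, norm_inv, norm_pow, norm_norm]
      have : ‖z‖ ≠ 0 := by linarith
      field_simp
    have ι_lt : ∀ z, 1 < ‖z‖ → ‖ι z‖ < 1 := fun z hz => by
      rw [ι_norm z hz]; exact inv_lt_one_of_one_lt₀ hz
    have ι_le : ∀ z, ‖ι z‖ ≤ 1 := fun z => by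
      rcases le_or_gt ‖z‖ 1 with h1 | h1
      · rw [ι_in z h1]; exact h1
      · exact (ι_lt z h1).le
    have ι_inj : ∀ z w, 1 < ‖z‖ → 1 < ‖w‖ → ι z = ι w → z = w := fun z w hz hw e => by
      have h1 : ‖z‖ = ‖w‖ := by
        have := congrArg norm e
        rwa [ι_norm z hz, ι_norm w hw, inv_inj] at this
      simp only [ι, max_eq_right hw.le, h1] at e
      have : ((‖w‖ ^ 2)⁻¹ : ℝ) ≠ 0 := by positivity
      exact smul_right_injective ℂ this e
    have hιball : ∀ᶠ z in 𝓝 z₀, ι z ∈ Metric.ball z₀ η' := by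
      refine hιc.continuousAt.preimage_mem_nhds ?_
      rw [ι_in z₀ hz₀.le]
      exact Metric.ball_mem_nhds _ hη'
    have hgU : ∀ᶠ z in 𝓝 z₀, diskPt h z ∈ U :=
      (continuous_diskPt h).continuousAt.preimage_mem_nhds (by rw [hg₀]; exact hU)
    let u : ℂ → ℝ := fun z => (G (ι z)).2
    let D : ℂ → ℝ × ℝ := fun z => ((G (ι z)).1, if ‖z‖ ≤ 1 then u z else -u z)
    let V : Set ℂ := {z | ι z ∈ Metric.ball z₀ η' ∧ diskPt h z ∈ U}
    have hV : V ∈ 𝓝 z₀ := hιball.and hgU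
    have hGι : ContinuousOn (fun z => G (ι z)) V :=
      hGball.comp hιc.continuousOn fun z hz => hz.1
    have huc : ContinuousOn u V := continuous_snd.comp_continuousOn hGι
    have hDc : ContinuousOn D V := by
      refine (continuous_fst.comp_continuousOn hGι).prodMk (ContinuousOn.if ?_ ?_ ?_)
      · intro a ha
        have h1 : ‖a‖ = 1 := frontier_le_subset_eq continuous_norm continuous_const ha.2
        have h2 : u a = 0 := by
          have := ha.1.1
          simp only [u]
          rw [ι_in a h1.le] at this ⊢
          exact hon a this h1
        rw [h2, neg_zero]
      · exact huc.mono inter_subset_left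
      · exact huc.neg.mono inter_subset_left
    have D_in : ∀ z ∈ V, ‖z‖ ≤ 1 → D z = G z := fun z hz hz1 => by
      simp only [D, u, if_pos hz1, ι_in z hz1]
    have D_out : ∀ z ∈ V, 1 < ‖z‖ → D z = ((G (ι z)).1, -(G (ι z)).2) := fun z hz hz1 => by
      simp only [D, u, if_neg hz1.not_ge]
    have D_nonneg : ∀ z ∈ V, ‖z‖ ≤ 1 → 0 ≤ ε * (D z).2 := fun z hz hz1 => by
      rw [D_in z hz hz1]
      have := hz.1
      rw [ι_in z hz1] at this
      exact hnonneg z this hz1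
    have D_neg : ∀ z ∈ V, 1 < ‖z‖ → ε * (D z).2 < 0 := fun z hz hz1 => by
      rw [D_out z hz hz1]
      have := hpos _ hz.1 (ι_lt z hz1)
      simp only [mul_neg]
      linarith
    have G_inj : ∀ a ∈ Metric.ball z₀ η', ∀ b ∈ Metric.ball z₀ η', ‖a‖ ≤ 1 → ‖b‖ ≤ 1 →
        G a = G b → a = b := by
      intro a ha b hb ha1 hb1 e1
      have e2 : f (diskPt h a) = f (diskPt h b) := by rw [← heG a ha, ← heG b hb, e1]
      have e3 := hi (hb' a ha).1 (hb' b hb).1 e2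
      rw [← coe_diskPt h ha1, e3, coe_diskPt h hb1]
    have hDi : InjOn D V := by
      intro a ha b hb hab
      rcases le_or_gt ‖a‖ 1 with h1 | h1 <;> rcases le_or_gt ‖b‖ 1 with h2 | h2
      · rw [D_in a ha h1, D_in b hb h2] at hab
        have ha' := ha.1
        have hb' := hb.1
        rw [ι_in _ h1] at ha'
        rw [ι_in _ h2] at hb'
        exact G_inj a ha' b hb' h1 h2 hab
      · have := D_nonneg a ha h1
        rw [hab] at this
        exact absurd (D_neg b hb h2) this.not_gt
      · have := D_nonneg b hb h2
        rw [← hab] at this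
        exact absurd (D_neg a ha h1) this.not_gt
      · rw [D_out a ha h1, D_out b hb h2, Prod.mk.injEq, neg_inj] at hab
        exact ι_inj a b h1 h2 (G_inj _ ha.1 _ hb.1 (ι_le _) (ι_le _) (Prod.ext hab.1 hab.2))
    have himg := image_mem_nhds_of_chart
      (Complex.equivRealProdCLM.symm.toHomeomorph.toOpenPartialHomeomorph) hV hDc hDi (mem_univ _)
    rw [D_in z₀ (mem_of_mem_nhds hV) hz₀.le, hG₀] at himg
    filter_upwards [himg] with w hw hw0
    obtain ⟨z, hz, rfl⟩ := hw
    have h1 : ‖z‖ ≤ 1 := by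
      by_contra! h1
      exact absurd (D_neg z hz h1) hw0.not_gt
    refine ⟨diskPt h z, hz.2, ?_⟩
    have hz' := hz.1
    rw [ι_in _ h1] at hz'
    rw [D_in z hz h1, ← heG z hz', hef]
  · refine ⟨{x | (h x : ℂ) ∈ Metric.ball z₀ η'}, ?_, ?_⟩
    · exact (Metric.isOpen_ball.preimage (continuous_subtype_val.comp h.continuous)).mem_nhds
        (Metric.mem_ball_self hη')
    · filter_upwards [e.open_source.mem_nhds he] with w hw hw2
      obtain ⟨x, hx, hx2⟩ := hw2
      have h1 : ‖(h x : ℂ)‖ ≤ 1 := mem_closedBall_zero_iff.1 (h x).2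
      have := hnonneg _ hx h1
      simp only [G, diskPt_coe] at this
      rw [hx2, ← hef, e.left_inv hw] at this
      exact this

end Disk

end ImmersedDisk

end

/-! ### The inward normal, and sections of the immersion -/

noncomputable section

open Set Filter Topology
open scoped RealInnerProductSpace

namespace ImmersedDisk

variable {M : Type*} [TopologicalSpace M] {h : M ≃ₜ UnitDisk}

/-- A frame along the boundary of an immersed disk whose normal points into the disk. -/
structure InwardFrame (f : M → S2) (φ : Circle ≃ₜ bdry h) (γ' N : ℝ → E3) (κ : ℝ → ℝ) : Prop
    extends Frame (fun θ => f (bd φ θ)) γ' N κ where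
  isTopImmersion : IsTopImmersion f
  fill : ∀ θ, ∀ U ∈ 𝓝 (bd φ θ), ∀ᶠ z in 𝓝 (θ, (0 : ℝ)), 0 ≤ z.2 → toFrame.fermi z ∈ f '' U
  side : ∀ θ, ∃ U ∈ 𝓝 (bd φ θ), ∀ᶠ z in 𝓝 (θ, (0 : ℝ)), toFrame.fermi z ∈ f '' U → 0 ≤ z.2

/-- The side on which the disk lies is locally constant in θ, hence constant on the connected line.
If it is the negative side, the normal is reversed. -/
theorem exists_inwardFrame {f : M → S2} (hf : IsTopImmersion f) {φ : Circle ≃ₜ bdry h}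
    {γ' N : ℝ → E3} {κ : ℝ → ℝ} (F : Frame (fun θ => f (bd φ θ)) γ' N κ) :
    InwardFrame f φ γ' N κ ∨ InwardFrame f φ γ' (-N) (-κ) := by
  let P : ℝ → ℝ → Prop := fun ε θ =>
    (∀ U ∈ 𝓝 (bd φ θ), ∀ᶠ z in 𝓝 (θ, (0 : ℝ)), 0 ≤ ε * z.2 → F.fermi z ∈ f '' U) ∧
      (∃ U ∈ 𝓝 (bd φ θ), ∀ᶠ z in 𝓝 (θ, (0 : ℝ)), F.fermi z ∈ f '' U → 0 ≤ ε * z.2)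
  have hP : ∀ θ, P 1 θ ∨ P (-1) θ := fun θ => by
    obtain ⟨ε, hε | hε, h1⟩ := exists_side φ hf F θ
    · left; rw [← hε]; exact h1
    · right; rw [← hε]; exact h1
  -- If the image filled one side and stayed on the other, points with `ε * r < 0` would be
  -- contradictory. The alternative `ε = 0` only secures `0 < ε ^ 2`; the values used are 1 and -1.
  have hloc : ∀ ε θ, P ε θ → ∀ᶠ θ' in 𝓝 θ, ¬ P (-ε) θ' ∨ ε = 0 := by
    intro ε θ ⟨_, U, hU, hs⟩
    have hs' := hs.eventually_nhds
    have hmk : Tendsto (fun t : ℝ => (t, (0 : ℝ))) (𝓝 θ) (𝓝 (θ, 0)) :=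
      Continuous.tendsto' (by fun_prop) _ _ rfl
    obtain ⟨O, hO, hOo, hOm⟩ := mem_nhds_iff.1 hU
    have hb : ∀ᶠ θ' in 𝓝 θ, bd φ θ' ∈ O :=
      (continuous_bd φ).continuousAt.preimage_mem_nhds (hOo.mem_nhds hOm)
    filter_upwards [hmk.eventually hs', hb] with θ' h1 h2
    by_contra! hc
    have h3 := hc.1.1 U (mem_of_superset (hOo.mem_nhds h2) hO)
    have h4 : ∀ᶠ z in 𝓝 (θ', (0 : ℝ)), 0 ≤ -ε * z.2 → 0 ≤ ε * z.2 := by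
      filter_upwards [h1, h3] with z a b c using a (b c)
    have hmk' : Tendsto (fun t : ℝ => (θ', -ε * t)) (𝓝[>] 0) (𝓝 (θ', 0)) :=
      (Continuous.tendsto' (by fun_prop) _ _ (by simp)).mono_left nhdsWithin_le_nhds
    obtain ⟨t, ht, ht0⟩ := ((hmk'.eventually h4).and self_mem_nhdsWithin).exists
    have ht0' : (0 : ℝ) < t := ht0
    have hε2 : 0 < ε ^ 2 := by have := hc.2; positivity
    have := ht (by simp only; nlinarith)
    simp only at this
    nlinarith
  have hopen : ∀ ε, (ε = 1 ∨ ε = -1) → IsOpen {θ | P ε θ} := by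
    intro ε hε
    rw [isOpen_iff_mem_nhds]
    intro θ hθ
    filter_upwards [hloc ε θ hθ] with θ' h1
    rcases hε with rfl | rfl
    · exact (hP θ').resolve_right (h1.resolve_right (by norm_num))
    · refine (hP θ').resolve_left ?_
      have := h1.resolve_right (by norm_num)
      rwa [neg_neg] at this
  have hcl : IsClopen {θ | P 1 θ} := by
    refine ⟨⟨?_⟩, hopen 1 (Or.inl rfl)⟩
    convert hopen (-1) (Or.inr rfl) using 1
    ext θ
    constructor
    · intro h1; exact (hP θ).resolve_left h1
    · intro h1 h2
      exact ((hloc 1 θ h2).self_of_nhds.resolve_right (by norm_num)) h1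
  have hneg : ∀ z : ℝ × ℝ, F.neg.fermi z = F.fermi (z.1, -z.2) := fun z =>
    Subtype.ext (by simp [Frame.coe_fermi])
  rcases isClopen_iff.1 hcl with h1 | h1
  · right
    have h2 : ∀ θ, P (-1) θ := fun θ => (hP θ).resolve_left fun h3 => by
      have : θ ∈ {θ | P 1 θ} := h3
      rw [h1] at this; exact this
    have hmk : ∀ θ, Tendsto (fun z : ℝ × ℝ => (z.1, -z.2)) (𝓝 (θ, 0)) (𝓝 (θ, 0)) := fun θ =>
      Continuous.tendsto' (by fun_prop) _ _ (by simp)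
    refine ⟨F.neg, hf, fun θ U hU => ?_, fun θ => ?_⟩
    · filter_upwards [(hmk θ).eventually ((h2 θ).1 U hU)] with z hz hz0
      rw [hneg]
      exact hz (by simpa using hz0)
    · obtain ⟨U, hU, hs⟩ := (h2 θ).2
      refine ⟨U, hU, ?_⟩
      filter_upwards [(hmk θ).eventually hs] with z hz hz0
      rw [hneg] at hz0
      simpa using hz hz0
  · left
    have h2 : ∀ θ, P 1 θ := fun θ => by
      have : θ ∈ {θ | P 1 θ} := by rw [h1]; trivial
      exact this
    refine ⟨F, hf, fun θ U hU => ?_, fun θ => ?_⟩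
    · simpa using (h2 θ).1 U hU
    · simpa using (h2 θ).2

/-! ### Lifts -/

/-- A continuous section of `f` over a subset of the sphere. -/
def IsLift (f : M → S2) (B : Set S2) (s : S2 → M) : Prop :=
  ContinuousOn s B ∧ ∀ y ∈ B, f (s y) = y

theorem IsLift.mono {f : M → S2} {B B' : Set S2} {s : S2 → M} (hs : IsLift f B s) (hB : B' ⊆ B) :
    IsLift f B' s := ⟨hs.1.mono hB, fun y hy => hs.2 y (hB hy)⟩

theorem IsLift.injOn {f : M → S2} {B : Set S2} {s : S2 → M} (hs : IsLift f B s) : InjOn s B :=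
  fun a ha b hb e => by rw [← hs.2 a ha, e, hs.2 b hb]

theorem t2Space_of_homeo (h : M ≃ₜ UnitDisk) : T2Space M := h.symm.t2Space

theorem compactSpace_of_homeo (h : M ≃ₜ UnitDisk) : CompactSpace M :=
  have : CompactSpace UnitDisk := isCompact_iff_compactSpace.1 (isCompact_closedBall 0 1)
  h.symm.compactSpace

theorem isClosed_bdry (h : M ≃ₜ UnitDisk) : IsClosed (bdry h) :=
  isClosed_eq (continuous_norm.comp (continuous_subtype_val.comp h.continuous)) continuous_const

theorem IsLift.eqOn {f : M → S2} [T2Space M] (hf : IsTopImmersion f) {B : Set S2} {s s' : S2 → M}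
    (hs : IsLift f B s) (hs' : IsLift f B s') (hB : IsPreconnected B) {y : S2} (hy : y ∈ B)
    (e : s y = s' y) : EqOn s s' B := by
  have hli : IsLocallyInjective f := by
    intro x
    obtain ⟨U, hU, hi⟩ := hf.2 x
    obtain ⟨O, hOU, hO, hx⟩ := mem_nhds_iff.1 hU
    exact ⟨O, hO, hx, hi.mono hOU⟩
  exact IsSeparatedMap.eqOn_of_comp_eqOn (T2Space.isSeparatedMap f) hli hB hs.1 hs'.1
    (fun z hz => by simp only [Function.comp, hs.2 z hz, hs'.2 z hz]) hy e

/-- A lift over an open set is an open map into the disk. -/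
theorem IsLift.isOpen_image {f : M → S2} (hf : IsTopImmersion f) {B : Set S2} {s : S2 → M}
    (hs : IsLift f B s) (hB : IsOpen B) : IsOpen (s '' B) := by
  rw [isOpen_iff_mem_nhds]
  rintro _ ⟨y, hy, rfl⟩
  obtain ⟨U, hU, hi⟩ := hf.2 (s y)
  have h1 : s ⁻¹' U ∩ B ∈ 𝓝 y := inter_mem
    ((hs.1.continuousAt (hB.mem_nhds hy)).preimage_mem_nhds hU) (hB.mem_nhds hy)
  have h2 : f ⁻¹' (s ⁻¹' U ∩ B) ∈ 𝓝 (s y) :=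
    hf.1.continuousAt.preimage_mem_nhds (by rw [hs.2 y hy]; exact h1)
  filter_upwards [h2, hU] with x hx hxU
  exact ⟨f x, hx.2, hi hx.1 hxU (hs.2 _ hx.2)⟩

/-- Lifts are equicontinuous. -/
theorem exists_control [T2Space M] [CompactSpace M] {f : M → S2} (hf : IsTopImmersion f) (x : M)
    {U : Set M} (hU : U ∈ 𝓝 x) : ∃ δ > 0, ∃ W ∈ 𝓝 x, ∀ (A : Set S2) (s : S2 → M),
      A ⊆ Metric.ball (f x) δ → IsPreconnected A → IsLift f A s → (∃ y ∈ A, s y ∈ W) →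
        ∀ y ∈ A, s y ∈ U := by
  obtain ⟨U₀, hU₀, hi⟩ := hf.2 x
  obtain ⟨W, hW, hWU, hWc⟩ := local_compact_nhds (inter_mem hU hU₀)
  have hfr : IsCompact (frontier W) := hWc.of_isClosed_subset isClosed_frontier
    (hWc.isClosed.frontier_subset)
  -- Inside the neighbourhood where f is injective, the frontier of W misses the fibre of `f x`. Its
  -- compact image thus stays away from a ball around `f x`, and a connected lift over that ball
  -- that starts in W cannot cross the frontier.
  have hn : f x ∉ f '' frontier W := by
    rintro ⟨z, hz, e⟩
    have hzW := hWc.isClosed.frontier_subset hz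
    have := hi (hWU hzW).2 (mem_of_mem_nhds hU₀) e
    subst this
    exact hz.2 (mem_interior_iff_mem_nhds.2 hW)
  obtain ⟨δ, hδ, hb⟩ := Metric.isOpen_iff.1 (hfr.image hf.1).isClosed.isOpen_compl _ hn
  refine ⟨δ, hδ, W, hW, fun A s hA hAc hs ⟨y₀, hy₀, hs₀⟩ y hy => ?_⟩
  have him : IsPreconnected (s '' A) := hAc.image s hs.1
  have havoid : ∀ y ∈ A, s y ∉ frontier W := fun y hy hfr =>
    hb (hA hy) ⟨s y, hfr, hs.2 y hy⟩
  by_contra hcon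
  have hnW : s y ∉ W := fun hw => hcon (hWU hw).1
  obtain ⟨_, ⟨y', hy', rfl⟩, h1, h2⟩ := him (interior W) Wᶜ isOpen_interior
    hWc.isClosed.isOpen_compl (by
      rintro _ ⟨y', hy', rfl⟩
      by_contra h3
      rw [mem_union, not_or, notMem_compl_iff] at h3
      exact havoid y' hy' ⟨subset_closure h3.2, h3.1⟩)
    ⟨s y₀, ⟨y₀, hy₀, rfl⟩, by
      by_contra h3
      exact havoid y₀ hy₀ ⟨subset_closure hs₀, h3⟩⟩ ⟨s y, ⟨y, hy, rfl⟩, hnW⟩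
  exact h2 (interior_subset h1)

end ImmersedDisk

end

/-! ### Local position of tangent circles relative to the boundary -/

noncomputable section

open Set Filter Topology
open scoped RealInnerProductSpace

namespace ImmersedDisk

variable {M : Type*} [TopologicalSpace M] {h : M ≃ₜ UnitDisk}

theorem exists_inverse_of_isCompact [T2Space M] {f : M → S2} (hf : Continuous f) {U : Set M}
    (hU : IsCompact U) (hne : U.Nonempty) (hi : InjOn f U) :
    ∃ g : S2 → M, IsLift f (f '' U) g ∧ (∀ x ∈ U, g (f x) = x) := by
  have : Nonempty M := ⟨hne.some⟩
  have hg : ∀ x ∈ U, Function.invFunOn f U (f x) = x := fun x hx =>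
    hi.leftInvOn_invFunOn hx
  refine ⟨Function.invFunOn f U, ⟨?_, ?_⟩, hg⟩
  · rw [continuousOn_iff_isClosed]
    intro Z hZ
    refine ⟨f '' (U ∩ Z), ((hU.inter_right hZ).image hf).isClosed, ?_⟩
    ext y
    constructor
    · rintro ⟨h1, x, hx, rfl⟩
      rw [mem_preimage, hg x hx] at h1
      exact ⟨⟨x, ⟨hx, h1⟩, rfl⟩, ⟨x, hx, rfl⟩⟩
    · rintro ⟨⟨x, ⟨hx, hz⟩, rfl⟩, h2⟩
      exact ⟨by rw [mem_preimage, hg x hx]; exact hz, h2⟩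
  · rintro _ ⟨x, hx, rfl⟩
    rw [hg x hx]

theorem exists_box {P : ℝ × ℝ → Prop} {θ : ℝ} (hP : ∀ᶠ z in 𝓝 (θ, (0 : ℝ)), P z) :
    ∃ δ > 0, ∀ t r, |t - θ| < δ → |r| < δ → P (t, r) := by
  obtain ⟨δ, hδ, hb⟩ := Metric.eventually_nhds_iff.1 hP
  refine ⟨δ, hδ, fun t r ht hr => hb ?_⟩
  rw [Prod.dist_eq, max_lt_iff, Real.dist_eq, Real.dist_eq, sub_zero]
  exact ⟨ht, hr⟩

theorem eventually_abs_sub_lt (a : ℝ) {δ : ℝ} (hδ : 0 < δ) : ∀ᶠ t in 𝓝 a, |t - a| < δ := by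
  filter_upwards [Metric.ball_mem_nhds a hδ] with t ht
  rwa [Metric.mem_ball, Real.dist_eq] at ht

namespace InwardFrame

variable {f : M → S2} {φ : Circle ≃ₜ bdry h} {γ' N : ℝ → E3} {κ : ℝ → ℝ}

abbrev lev (_ : InwardFrame f φ γ' N κ) (θ k : ℝ) (x : S2) : ℝ :=
  ImmersedDisk.lev (f (bd φ θ)) (N θ) k x

abbrev cap (_ : InwardFrame f φ γ' N κ) (θ k : ℝ) : Set S2 :=
  ImmersedDisk.cap (f (bd φ θ)) (N θ) k

abbrev ocap (_ : InwardFrame f φ γ' N κ) (θ k : ℝ) : Set S2 :=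
  ImmersedDisk.ocap (f (bd φ θ)) (N θ) k

abbrev cir (_ : InwardFrame f φ γ' N κ) (θ k : ℝ) : Set S2 :=
  ImmersedDisk.cir (f (bd φ θ)) (N θ) k

theorem lev_base (F : InwardFrame f φ γ' N κ) (θ k : ℝ) : F.lev θ k (f (bd φ θ)) = 0 :=
  lev_self _ (F.inner_normal_curve θ) k

theorem base_mem_cir (F : InwardFrame f φ γ' N κ) (θ k : ℝ) : f (bd φ θ) ∈ F.cir θ k :=
  F.lev_base θ k

theorem base_mem_cap (F : InwardFrame f φ γ' N κ) (θ k : ℝ) : f (bd φ θ) ∈ F.cap θ k :=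
  cir_subset_cap _ _ _ (F.base_mem_cir θ k)

theorem lev_fermi (F : InwardFrame f φ γ' N κ) (θ₀ k θ r : ℝ) :
    F.lev θ₀ k (F.fermi (θ, r)) = Real.cos r * ⟪N θ₀ + k • (f (bd φ θ₀) : E3), (f (bd φ θ) : E3)⟫ +
      Real.sin r * ⟪N θ₀ + k • (f (bd φ θ₀) : E3), N θ⟫ - k := by
  rw [lev, lev_eq, Frame.coe_fermi, inner_add_right, real_inner_smul_right, real_inner_smul_right]

/-- The height over a tangent circle increases in the normal direction. -/
theorem exists_strictMonoOn (F : InwardFrame f φ γ' N κ) (θ₀ k : ℝ) :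
    ∃ δ > 0, ∀ θ, |θ - θ₀| < δ → StrictMonoOn (fun r => F.lev θ₀ k (F.fermi (θ, r)))
      (Ioo (-δ) δ) := by
  have c1 : Continuous fun z : ℝ × ℝ => (f (bd φ z.1) : E3) :=
    continuous_subtype_val.comp (F.continuous_curve.comp continuous_fst)
  have c2 : Continuous fun z : ℝ × ℝ => N z.1 := F.continuous_normal.comp continuous_fst
  let W : E3 := N θ₀ + k • (f (bd φ θ₀) : E3)
  have hc : Continuous fun z : ℝ × ℝ => -Real.sin z.2 * ⟪W, (f (bd φ z.1) : E3)⟫ +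
      Real.cos z.2 * ⟪W, N z.1⟫ :=
    ((Real.continuous_sin.comp continuous_snd).neg.mul (continuous_const.inner c1)).add
      ((Real.continuous_cos.comp continuous_snd).mul (continuous_const.inner c2))
  have hev : ∀ᶠ z in 𝓝 (θ₀, (0 : ℝ)), 0 < -Real.sin z.2 * ⟪W, (f (bd φ z.1) : E3)⟫ +
      Real.cos z.2 * ⟪W, N z.1⟫ := by
    refine hc.continuousAt.eventually (lt_mem_nhds ?_)
    simp only [W, inner_add_left, real_inner_smul_left, F.inner_normal_self,
      real_inner_comm (N θ₀) (f (bd φ θ₀) : E3), F.inner_normal_curve]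
    norm_num
  obtain ⟨δ, hδ, hb⟩ := exists_box hev
  refine ⟨δ, hδ, fun θ hθ => ?_⟩
  have hd : ∀ r, HasDerivAt (fun r => F.lev θ₀ k (F.fermi (θ, r)))
      (-Real.sin r * ⟪W, (f (bd φ θ) : E3)⟫ + Real.cos r * ⟪W, N θ⟫) r := fun r => by
    simp only [F.lev_fermi]
    exact (((Real.hasDerivAt_cos r).mul_const _).fun_add
      ((Real.hasDerivAt_sin r).mul_const _)).sub_const _
  refine strictMonoOn_of_deriv_pos (convex_Ioo _ _)
    (fun r _ => (hd r).continuousAt.continuousWithinAt) fun r hr => ?_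
  rw [(hd r).deriv]
  rw [interior_Ioo] at hr
  exact hb θ r hθ (abs_lt.2 hr)

/-- A set that lifts through a boundary point lies on the inner side of the boundary curve. -/
theorem side_of_lift (F : InwardFrame f φ γ' N κ) {θ₀ : ℝ} {K : Set S2} {σ : S2 → M}
    (hσ : IsLift f K σ) (hK : f (bd φ θ₀) ∈ K) (h0 : σ (f (bd φ θ₀)) = bd φ θ₀) {U : Set M}
    (hU : U ∈ 𝓝 (bd φ θ₀)) : ∀ᶠ z in 𝓝 (θ₀, (0 : ℝ)), F.fermi z ∈ K → σ (F.fermi z) ∈ U ∧ 0 ≤ z.2 := by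
  obtain ⟨U', hU', hs⟩ := F.side θ₀
  have h1 : ∀ᶠ x in 𝓝[K] (f (bd φ θ₀)), σ x ∈ U ∩ U' :=
    (hσ.1 _ hK).preimage_mem_nhdsWithin (by rw [h0]; exact inter_mem hU hU')
  rw [eventually_nhdsWithin_iff, ← F.map_fermi_nhds θ₀, eventually_map] at h1
  filter_upwards [h1, hs] with z hz hz2 hzK
  exact ⟨(hz hzK).1, hz2 ⟨_, (hz hzK).2, hσ.2 _ hzK⟩⟩

/-- Suppose a nearby boundary point had positive height. Going outwards along its normal the height
becomes negative, so the circle would be met strictly outside the disk, where no lifted point can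
be. -/
theorem eventually_lev_nonpos (F : InwardFrame f φ γ' N κ) {θ₀ k : ℝ} {σ : S2 → M}
    (hσ : IsLift f (F.cir θ₀ k) σ) (h0 : σ (f (bd φ θ₀)) = bd φ θ₀) :
    ∀ᶠ θ in 𝓝 θ₀, F.lev θ₀ k (f (bd φ θ)) ≤ 0 := by
  obtain ⟨δ₁, hδ₁, hb⟩ := exists_box (F.side_of_lift hσ (F.base_mem_cir θ₀ k) h0 univ_mem)
  obtain ⟨δ₂, hδ₂, hm⟩ := F.exists_strictMonoOn θ₀ k
  obtain ⟨r, hr0, hr⟩ := exists_between (lt_min hδ₁ hδ₂)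
  have hr1 := hr.trans_le (min_le_left _ _)
  have hr2 := hr.trans_le (min_le_right _ _)
  have h1 : F.lev θ₀ k (F.fermi (θ₀, -r)) < 0 := by
    have := hm θ₀ (by simpa using hδ₂) (a := -r) (b := 0) ⟨by linarith, by linarith⟩
      ⟨by linarith, by linarith⟩ (by linarith)
    simpa [F.lev_base] using this
  have hc : Continuous fun θ => F.lev θ₀ k (F.fermi (θ, -r)) :=
    (continuous_lev _ _ _).comp (F.continuous_fermi.comp (by fun_prop))
  have h2 : ∀ᶠ θ in 𝓝 θ₀, F.lev θ₀ k (F.fermi (θ, -r)) < 0 :=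
    hc.continuousAt.eventually (gt_mem_nhds h1)
  have h3 : ∀ᶠ θ in 𝓝 θ₀, |θ - θ₀| < δ₁ := eventually_abs_sub_lt θ₀ hδ₁
  filter_upwards [h2, h3] with θ h4 h5
  by_contra! hpos
  have hc2 : Continuous fun ρ => F.lev θ₀ k (F.fermi (θ, ρ)) :=
    (continuous_lev _ _ _).comp (F.continuous_fermi.comp (by fun_prop))
  have hpos' : 0 < F.lev θ₀ k (F.fermi (θ, 0)) := by rwa [Frame.fermi_zero]
  obtain ⟨ρ, hρ, e⟩ := intermediate_value_Icc (by linarith : -r ≤ 0) hc2.continuousOn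
    ⟨h4.le, hpos'.le⟩
  have h6 := (hb θ ρ h5 (abs_lt.2 ⟨by linarith [hρ.1], by linarith [hρ.2]⟩) e).2
  have h7 : ρ = 0 := le_antisymm hρ.2 h6
  rw [h7] at e
  exact hpos'.ne' e

/-- Circles in the disk through a boundary point are tangent to the boundary. -/
theorem inner_deriv_eq_zero (F : InwardFrame f φ γ' N κ) {θ₀ : ℝ} {n : E3} {t : ℝ} {σ : S2 → M}
    (hσ : IsLift f {x : S2 | ⟪n, (x : E3)⟫ = t} σ) (ht : ⟪n, (f (bd φ θ₀) : E3)⟫ = t)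
    (h0 : σ (f (bd φ θ₀)) = bd φ θ₀) : ⟪n, γ' θ₀⟫ = 0 := by
  by_contra hc
  set c := ⟪n, γ' θ₀⟫
  obtain ⟨δ, hδ, hb⟩ := exists_box (F.side_of_lift hσ ht h0 univ_mem)
  have hd : HasDerivAt (fun θ => c * (⟪n, (f (bd φ θ) : E3)⟫ - t)) (c * c) θ₀ := by
    have : HasDerivAt (fun θ => ⟪n, (f (bd φ θ) : E3)⟫) c θ₀ := by
      simpa using (hasDerivAt_const θ₀ n).inner ℝ (F.hasDerivAt_curve θ₀)
    exact (this.sub_const t).const_mul c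
  have hs := (hasDerivAt_iff_tendsto_slope.1 hd).eventually
    (lt_mem_nhds (show (0 : ℝ) < c * c from mul_self_pos.2 hc))
  rw [eventually_nhdsWithin_iff, Metric.eventually_nhds_iff] at hs
  obtain ⟨η, hη, hs⟩ := hs
  obtain ⟨d, hd0, hd1⟩ := exists_between (lt_min hδ hη)
  have hdδ := hd1.trans_le (min_le_left _ _)
  have hdη := hd1.trans_le (min_le_right _ _)
  have hval : ∀ u, u ≠ 0 → |u| < η → 0 < (c * (⟪n, (f (bd φ (θ₀ + u)) : E3)⟫ - t)) / u := by
    intro u hu hu2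
    have := hs (y := θ₀ + u) (by rw [Real.dist_eq, add_sub_cancel_left]; exact hu2)
      (by simpa using hu)
    rw [slope_def_field, ht] at this
    simpa using this
  have hplus : 0 < c * (⟪n, (f (bd φ (θ₀ + d)) : E3)⟫ - t) := by
    have := hval d hd0.ne' (by rwa [abs_of_pos hd0])
    exact (div_pos_iff_of_pos_right hd0).1 this
  have hminus : c * (⟪n, (f (bd φ (θ₀ - d)) : E3)⟫ - t) < 0 := by
    have := hval (-d) (neg_ne_zero.2 hd0.ne') (by rwa [abs_neg, abs_of_pos hd0])
    rw [div_neg, Left.neg_pos_iff, div_neg_iff] at this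
    rcases this with h1 | h1
    · linarith [h1.2]
    · exact h1.1
  -- A transversal circle separates `θ₀ - d` from `θ₀ + d` on the boundary curve. It still separates
  -- the corresponding points of a parallel curve slightly outside the disk, so the circle has a
  -- point there.
  let g : ℝ × ℝ → ℝ := fun z => c * (⟪n, (F.fermi z : E3)⟫ - t)
  have hg : Continuous g := by
    have : Continuous fun z => (F.fermi z : E3) := continuous_subtype_val.comp F.continuous_fermi
    fun_prop
  have hmk : ∀ θ : ℝ, Tendsto (fun r : ℝ => (θ, r)) (𝓝 0) (𝓝 (θ, 0)) := fun θ =>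
    Continuous.tendsto' (by fun_prop) _ _ rfl
  have e1 : ∀ᶠ r in 𝓝 (0 : ℝ), 0 < g (θ₀ + d, r) := by
    refine (hmk _).eventually (hg.continuousAt.eventually (lt_mem_nhds ?_))
    simp only [g, Frame.fermi_zero]; exact hplus
  have e2 : ∀ᶠ r in 𝓝 (0 : ℝ), g (θ₀ - d, r) < 0 := by
    refine (hmk _).eventually (hg.continuousAt.eventually (gt_mem_nhds ?_))
    simp only [g, Frame.fermi_zero]; exact hminus
  have e3 : ∀ᶠ r in 𝓝 (0 : ℝ), |r| < δ := by
    simpa using eventually_abs_sub_lt 0 hδ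
  obtain ⟨r, ⟨⟨r1, r2⟩, r3⟩, hr0⟩ :=
    ((((e1.and e2).and e3).filter_mono nhdsWithin_le_nhds).and
      (self_mem_nhdsWithin : Iio (0 : ℝ) ∈ 𝓝[<] 0)).exists
  obtain ⟨θ, hθ, e⟩ := intermediate_value_Icc (by linarith : θ₀ - d ≤ θ₀ + d)
    (f := fun θ => g (θ, r)) (by fun_prop) (show (0 : ℝ) ∈ Icc _ _ from ⟨r2.le, r1.le⟩)
  have h1 : ⟪n, (F.fermi (θ, r) : E3)⟫ = t := by
    simp only [g] at e
    linarith [(mul_eq_zero.1 e).resolve_left hc]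
  have h2 := (hb θ r (abs_lt.2 ⟨by linarith [hθ.1], by linarith [hθ.2]⟩) r3 h1).2
  exact absurd hr0 (not_lt.2 h2)

/-- A tangent cap that does not contain nearby boundary points in its interior lies locally
inside the disk. -/
theorem eventually_mem_image (F : InwardFrame f φ γ' N κ) {θ₀ k : ℝ}
    (hk : ∀ᶠ θ in 𝓝 θ₀, F.lev θ₀ k (f (bd φ θ)) ≤ 0) {U : Set M} (hU : U ∈ 𝓝 (bd φ θ₀)) :
    ∀ᶠ x in 𝓝 (f (bd φ θ₀)), x ∈ F.cap θ₀ k → x ∈ f '' U := by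
  rw [← F.map_fermi_nhds θ₀, eventually_map]
  obtain ⟨δ, hδ, hm⟩ := F.exists_strictMonoOn θ₀ k
  have h1 : ∀ᶠ z in 𝓝 (θ₀, (0 : ℝ)), |z.1 - θ₀| < δ ∧ |z.2| < δ := by
    filter_upwards [Metric.ball_mem_nhds (θ₀, (0 : ℝ)) hδ] with z hz
    rw [Metric.mem_ball, Prod.dist_eq, max_lt_iff, Real.dist_eq, Real.dist_eq, sub_zero] at hz
    exact hz
  have h2 : ∀ᶠ z in 𝓝 (θ₀, (0 : ℝ)), F.lev θ₀ k (f (bd φ z.1)) ≤ 0 :=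
    (continuous_fst.tendsto (θ₀, (0 : ℝ))).eventually hk
  filter_upwards [h1, h2, F.fill θ₀ U hU] with z hz1 hz2 hz3 hz4
  refine hz3 ?_
  by_contra! hneg
  have := hm z.1 hz1.1 (a := z.2) (b := 0) (abs_lt.1 hz1.2) ⟨by linarith, by linarith⟩ hneg
  simp only [Frame.fermi_zero] at this
  have h5 := mem_cap.1 hz4
  linarith

/-- Boundary points near a tangent circle can be joined to the circle outside of the cap. -/
theorem eventually_joinedIn [T2Space M] [CompactSpace M] (F : InwardFrame f φ γ' N κ) {θ₀ k : ℝ}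
    {σ : S2 → M} (hσ : IsLift f (F.cir θ₀ k) σ) (h0 : σ (f (bd φ θ₀)) = bd φ θ₀) :
    ∀ᶠ θ in 𝓝[≠] θ₀, ∃ x ∈ F.cir θ₀ k \ {f (bd φ θ₀)},
      JoinedIn {m | F.lev θ₀ k (f m) ≤ 0 ∧ f m ≠ f (bd φ θ₀)} (bd φ θ) (σ x) := by
  obtain ⟨U₀, hU₀, hi₀⟩ := F.isTopImmersion.2 (bd φ θ₀)
  obtain ⟨U, hU, hUU, hUc⟩ := local_compact_nhds hU₀
  obtain ⟨g, hg, hgf⟩ := exists_inverse_of_isCompact F.isTopImmersion.1 hUc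
    ⟨_, mem_of_mem_nhds hU⟩ (hi₀.mono hUU)
  obtain ⟨V, hV, hVi⟩ := F.exists_injOn_fermi θ₀
  obtain ⟨δ₁, hδ₁, hb⟩ := exists_box ((F.side_of_lift hσ (F.base_mem_cir θ₀ k) h0 hU).and
    ((F.fill θ₀ U hU).and hV))
  obtain ⟨δ₂, hδ₂, hm⟩ := F.exists_strictMonoOn θ₀ k
  obtain ⟨r, hr0, hr⟩ := exists_between (lt_min hδ₁ hδ₂)
  have hr1 := hr.trans_le (min_le_left _ _)
  have hr2 := hr.trans_le (min_le_right _ _)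
  have h1 : 0 < F.lev θ₀ k (F.fermi (θ₀, r)) := by
    have := hm θ₀ (by simpa using hδ₂) (a := 0) (b := r) ⟨by linarith, by linarith⟩
      ⟨by linarith, by linarith⟩ hr0
    simpa [F.lev_base] using this
  have hc : Continuous fun θ => F.lev θ₀ k (F.fermi (θ, r)) :=
    (continuous_lev _ _ _).comp (F.continuous_fermi.comp (by fun_prop))
  have h2 : ∀ᶠ θ in 𝓝 θ₀, 0 < F.lev θ₀ k (F.fermi (θ, r)) :=
    hc.continuousAt.eventually (lt_mem_nhds h1)
  have h3 : ∀ᶠ θ in 𝓝 θ₀, |θ - θ₀| < min δ₁ δ₂ := eventually_abs_sub_lt θ₀ (lt_min hδ₁ hδ₂)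
  have h4 : ∀ᶠ θ in 𝓝 θ₀, bd φ θ ∈ U := (continuous_bd φ).continuousAt.preimage_mem_nhds hU
  filter_upwards [nhdsWithin_le_nhds h2, nhdsWithin_le_nhds h3, nhdsWithin_le_nhds h4,
    nhdsWithin_le_nhds (F.eventually_lev_nonpos hσ h0), self_mem_nhdsWithin] with θ a1 a2 a3 a4 a5
  have a21 := a2.trans_le (min_le_left _ _)
  have a22 := a2.trans_le (min_le_right _ _)
  have hc2 : Continuous fun ρ => F.lev θ₀ k (F.fermi (θ, ρ)) :=
    (continuous_lev _ _ _).comp (F.continuous_fermi.comp (by fun_prop))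
  have a4' : F.lev θ₀ k (F.fermi (θ, 0)) ≤ 0 := by rwa [Frame.fermi_zero]
  -- The inward normal from the boundary point is followed until it first reaches the circle, at
  -- parameter ρ. The height increases along the way and so stays nonpositive; injectivity of the
  -- parallel coordinates keeps the path away from the base.
  obtain ⟨ρ, hρ, e⟩ := intermediate_value_Icc hr0.le hc2.continuousOn
    (show (0 : ℝ) ∈ Icc _ _ from ⟨a4', a1.le⟩)
  have hne : ∀ s ∈ Icc 0 ρ, F.fermi (θ, s) ≠ f (bd φ θ₀) := by
    intro s hs he
    rw [← F.fermi_zero θ₀] at he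
    have hs' : |s| < δ₁ := abs_lt.2 ⟨by linarith [hs.1], by linarith [hs.2, hρ.2]⟩
    have := hVi (hb θ s a21 hs').2.2 (hb θ₀ 0 (by simpa using hδ₁) (by simpa using hδ₁)).2.2 he
    exact a5 (congrArg Prod.fst this)
  have him : ∀ s ∈ Icc 0 ρ, F.fermi (θ, s) ∈ f '' U := fun s hs =>
    (hb θ s a21 (abs_lt.2 ⟨by linarith [hs.1], by linarith [hs.2, hρ.2]⟩)).2.1 hs.1
  have hlev : ∀ s ∈ Icc 0 ρ, F.lev θ₀ k (F.fermi (θ, s)) ≤ 0 := fun s hs => by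
    rw [← e]
    exact (hm θ a22).monotoneOn ⟨by linarith [hs.1], by linarith [hs.2, hρ.2]⟩
      ⟨by linarith [hρ.1], by linarith [hρ.2]⟩ hs.2
  have hρI : ρ ∈ Icc 0 ρ := ⟨hρ.1, le_rfl⟩
  refine ⟨F.fermi (θ, ρ), ⟨e, hne ρ hρI⟩, ?_⟩
  have hmaps : MapsTo (fun t : ℝ => t * ρ) (Icc 0 1) (Icc 0 ρ) := fun t ht =>
    ⟨mul_nonneg ht.1 hρ.1, mul_le_of_le_one_left hρ.1 ht.2⟩
  refine JoinedIn.ofLine (f := fun t => g (F.fermi (θ, t * ρ))) ?_ ?_ ?_ ?_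
  · exact hg.1.comp (F.continuous_fermi.comp (by fun_prop)).continuousOn
      fun t ht => him _ (hmaps ht)
  · simp only [zero_mul, Frame.fermi_zero]
    exact hgf _ a3
  · simp only [one_mul]
    have h6 := (hb θ ρ a21 (abs_lt.2 ⟨by linarith [hρ.1], by linarith [hρ.2]⟩)).1 e
    rw [← hσ.2 _ e, hgf _ h6.1, hσ.2 _ e]
  · rintro _ ⟨t, ht, rfl⟩
    have := hg.2 _ (him _ (hmaps ht))
    simp only [mem_ofPred_eq, this]
    exact ⟨hlev _ (hmaps ht), hne _ (hmaps ht)⟩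

/-- Comparison of the boundary curve with its tangent circles. -/
theorem exists_comparison (F : InwardFrame f φ γ' N κ) (θ₀ : ℝ) : ∃ δ > 0, ∀ (k c s : ℝ),
    |s - θ₀| < δ → s ≠ θ₀ → (∀ u, (θ₀ < u ∧ u < s) ∨ (s < u ∧ u < θ₀) → 0 < c * (κ u - k)) →
      0 < c * F.lev θ₀ k (f (bd φ s)) := by
  have hev : ∀ᶠ p in 𝓝 (θ₀, θ₀), 0 < ⟪γ' p.1, γ' p.2⟫ := by
    have hc : Continuous fun p : ℝ × ℝ => ⟪γ' p.1, γ' p.2⟫ := by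
      have := F.continuous_deriv; fun_prop
    exact hc.continuousAt.eventually (lt_mem_nhds
      (show 0 < ⟪γ' θ₀, γ' θ₀⟫ from real_inner_self_pos.2 (F.deriv_ne_zero θ₀)))
  obtain ⟨δ, hδ, hb⟩ := Metric.eventually_nhds_iff.1 hev
  have hb' : ∀ u w, |u - θ₀| < δ → |w - θ₀| < δ → 0 < ⟪γ' u, γ' w⟫ := fun u w hu hw =>
    hb (y := (u, w)) (by
      rw [Prod.dist_eq, max_lt_iff, Real.dist_eq, Real.dist_eq]; exact ⟨hu, hw⟩)
  have hmono : ∀ u, |u - θ₀| < δ →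
      StrictMonoOn (fun w => ⟪γ' u, (f (bd φ w) : E3)⟫) (Ioo (θ₀ - δ) (θ₀ + δ)) := by
    intro u hu
    have hd : ∀ w, HasDerivAt (fun w => ⟪γ' u, (f (bd φ w) : E3)⟫) ⟪γ' u, γ' w⟫ w := fun w => by
      simpa using (hasDerivAt_const w (γ' u)).inner ℝ (F.hasDerivAt_curve w)
    refine strictMonoOn_of_deriv_pos (convex_Ioo _ _)
      (fun r _ => (hd r).continuousAt.continuousWithinAt) fun r hr => ?_
    rw [(hd r).deriv]
    rw [interior_Ioo] at hr
    exact hb' u r hu (abs_lt.2 ⟨by linarith [hr.1], by linarith [hr.2]⟩)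
  refine ⟨δ, hδ, fun k c s hs hne hκ => ?_⟩
  have hs' := abs_lt.1 hs
  -- Up to the factor c, this evaluates at γ(s) the circle of curvature k tangent at γ(u), as u
  -- moves from θ₀ to s. Its derivative contains the factor k - κ(u) and the product of γ'(u) with
  -- γ(s), which has the sign of s - u. The number c serves to treat both directions of the
  -- inequality at once.
  let g : ℝ → ℝ := fun u => c * (k * ⟪(f (bd φ u) : E3), (f (bd φ s) : E3)⟫ +
    ⟪N u, (f (bd φ s) : E3)⟫)
  have hd : ∀ u, HasDerivAt g (c * ((k - κ u) * ⟪γ' u, (f (bd φ s) : E3)⟫)) u := by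
    intro u
    have h1 : HasDerivAt (fun u => ⟪(f (bd φ u) : E3), (f (bd φ s) : E3)⟫)
        ⟪γ' u, (f (bd φ s) : E3)⟫ u := by
      simpa using (F.hasDerivAt_curve u).inner ℝ (hasDerivAt_const u (f (bd φ s) : E3))
    have h2 : HasDerivAt (fun u => ⟪N u, (f (bd φ s) : E3)⟫)
        ⟪-κ u • γ' u, (f (bd φ s) : E3)⟫ u := by
      simpa using (F.hasDerivAt_normal u).inner ℝ (hasDerivAt_const u (f (bd φ s) : E3))
    have h3 := ((h1.const_mul k).fun_add h2).const_mul c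
    rw [real_inner_smul_left] at h3
    exact h3.congr_deriv (by ring)
  have hgc : Continuous g := continuous_iff_continuousAt.2 fun u => (hd u).continuousAt
  have e1 : g s = c * k := by
    simp only [g]
    rw [F.inner_normal_curve s, F.inner_self s]; ring
  have e2 : c * F.lev θ₀ k (f (bd φ s)) = g θ₀ - g s := by
    rw [e1]
    simp only [g, lev, ImmersedDisk.lev]; ring
  have hzero : ∀ u, ⟪γ' u, (f (bd φ u) : E3)⟫ = 0 := F.inner_deriv_curve
  rw [e2, sub_pos]
  rcases lt_or_gt_of_ne hne with hlt | hgt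
  · refine strictMonoOn_of_deriv_pos (convex_Icc s θ₀) hgc.continuousOn (fun u hu => ?_)
      (left_mem_Icc.2 hlt.le) (right_mem_Icc.2 hlt.le) hlt
    rw [interior_Icc] at hu
    rw [(hd u).deriv]
    have h1 := hmono u (abs_lt.2 ⟨by linarith [hu.1], by linarith [hu.2]⟩) (a := s) (b := u)
      ⟨by linarith, by linarith⟩ ⟨by linarith [hu.1], by linarith [hu.2]⟩ hu.1
    simp only [hzero] at h1
    have h2 := hκ u (Or.inr hu)
    nlinarith
  · refine strictAntiOn_of_deriv_neg (convex_Icc θ₀ s) hgc.continuousOn (fun u hu => ?_)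
      (left_mem_Icc.2 hgt.le) (right_mem_Icc.2 hgt.le) hgt
    rw [interior_Icc] at hu
    rw [(hd u).deriv]
    have h1 := hmono u (abs_lt.2 ⟨by linarith [hu.1], by linarith [hu.2]⟩) (a := u) (b := s)
      ⟨by linarith [hu.1], by linarith [hu.2]⟩ ⟨by linarith, by linarith⟩ hu.2
    simp only [hzero] at h1
    have h2 := hκ u (Or.inl hu)
    nlinarith

end InwardFrame

end ImmersedDisk

end

/-! ### Lifting tangent caps and the largest one -/

noncomputable section

open Set Filter Topology
open scoped RealInnerProductSpace

namespace ImmersedDisk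

variable {M : Type*} [TopologicalSpace M] {h : M ≃ₜ UnitDisk}

/-- The circle without its base is connected, and an explicit rational parametrization X, with `X 0
= y`, shows that the base lies in its closure. -/
theorem isPreconnected_cir {y : S2} {N : E3} (hN : ‖N‖ = 1) (hNy : ⟪N, (y : E3)⟫ = 0) (k : ℝ) :
    IsPreconnected (cir y N k) := by
  obtain ⟨T, hT, hTN, hTy⟩ := exists_unit_orthogonal N (y : E3)
  have ny : ‖(y : E3)‖ = 1 := norm_eq_of_mem_sphere y
  have yy : ⟪(y : E3), (y : E3)⟫ = 1 := by rw [real_inner_self_eq_norm_sq, ny]; norm_num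
  have NN : ⟪N, N⟫ = 1 := by rw [real_inner_self_eq_norm_sq, hN]; norm_num
  have TT : ⟪T, T⟫ = 1 := by rw [real_inner_self_eq_norm_sq, hT]; norm_num
  have hNT : ⟪N, T⟫ = 0 := by rw [real_inner_comm]; exact hTN
  have hyT : ⟪(y : E3), T⟫ = 0 := by rw [real_inner_comm]; exact hTy
  have hyN : ⟪(y : E3), N⟫ = 0 := by rw [real_inner_comm]; exact hNy
  let D : ℝ → ℝ := fun σ => 1 + (1 + k ^ 2) * σ ^ 2
  have hD : ∀ σ, 0 < D σ := fun σ => by simp only [D]; positivity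
  let a : ℝ → ℝ := fun σ => 2 * σ ^ 2 / D σ
  let b : ℝ → ℝ := fun σ => 2 * σ / D σ
  have hDc : Continuous D := by fun_prop
  have hac : Continuous a := Continuous.div (by fun_prop) hDc fun σ => (hD σ).ne'
  have hbc : Continuous b := Continuous.div (by fun_prop) hDc fun σ => (hD σ).ne'
  let X : ℝ → E3 := fun σ => (y : E3) + a σ • (k • N - (y : E3)) + b σ • T
  have hab : ∀ σ, a σ ^ 2 * (1 + k ^ 2) + b σ ^ 2 = 2 * a σ := fun σ => by
    have := (hD σ).ne'
    simp only [a, b]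
    field_simp
    simp only [D]; ring
  have hX : ∀ σ, X σ ∈ Metric.sphere (0 : E3) 1 := fun σ => by
    rw [mem_sphere_zero_iff_norm, ← sq_eq_sq₀ (norm_nonneg _) zero_le_one,
      ← real_inner_self_eq_norm_sq]
    simp only [X, inner_add_left, inner_add_right, inner_sub_left, inner_sub_right,
      real_inner_smul_left, real_inner_smul_right, yy, NN, TT, hNT, hyT, hyN, hTN, hTy, hNy]
    linear_combination hab σ
  have hmem : ∀ σ, (⟨X σ, hX σ⟩ : S2) ∈ cir (y : E3) N k := fun σ => by
    rw [mem_cir]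
    simp only [lev, X, inner_add_right, inner_sub_right, real_inner_smul_right, yy, NN, hNT, hyT,
      hyN, hNy]
    ring
  have hne : ∀ σ ≠ 0, (⟨X σ, hX σ⟩ : S2) ≠ y := fun σ hσ e => by
    have h1 := congrArg (fun x : S2 => ⟪T, (x : E3)⟫) e
    simp only [X, inner_add_right, inner_sub_right, real_inner_smul_right, hTy, hTN, TT, b] at h1
    have := (hD σ).ne'
    field_simp at h1
    simp [hσ] at h1
  have hc : Continuous fun σ => (⟨X σ, hX σ⟩ : S2) := by fun_prop
  have hlim : Tendsto (fun σ => (⟨X σ, hX σ⟩ : S2)) (𝓝[≠] 0) (𝓝 y) := by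
    have h2 := hc.tendsto 0
    have h3 : (⟨X 0, hX 0⟩ : S2) = y := Subtype.ext (by simp [X, a, b])
    rw [h3] at h2
    exact h2.mono_left nhdsWithin_le_nhds
  have hcl : y ∈ closure (cir (y : E3) N k \ {y}) := by
    refine mem_closure_of_tendsto hlim ?_
    filter_upwards [self_mem_nhdsWithin] with σ hσ
    exact ⟨hmem σ, hne σ hσ⟩
  refine IsPreconnected.subset_closure (s := cir (y : E3) N k \ {y})
    (isPreconnected_of_joinedIn fun _ hx _ hx' => joinedIn_cir_diff hNy hx hx') sdiff_subset ?_
  intro x hx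
  by_cases hxy : x = y
  · rw [hxy]; exact hcl
  · exact subset_closure ⟨hx, hxy⟩

theorem exists_gt_mem_ocap {y : S2} {N : E3} {k : ℝ} {x : S2} (hx : x ∈ ocap y N k) :
    ∃ k' > k, x ∈ ocap y N k' := by
  have h1 := mem_ocap.1 hx
  have h2 : -1 ≤ ⟪(y : E3), (x : E3)⟫ := by
    have := abs_real_inner_le_norm (y : E3) (x : E3)
    rw [norm_eq_of_mem_sphere, norm_eq_of_mem_sphere, mul_one] at this
    exact (abs_le.1 this).1
  have h3 := inner_le_one y x
  -- Raising k by δ lowers the height by at most 2δ, so a quarter of the height leaves at least half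
  -- of it.
  refine ⟨k + lev y N k x / 4, by linarith, ?_⟩
  rw [mem_ocap]
  have : lev y N (k + lev y N k x / 4) x =
      lev y N k x - lev y N k x / 4 * (1 - ⟪(y : E3), (x : E3)⟫) := by
    simp only [lev]; ring
  rw [this]
  nlinarith

/-- Paths in the disk with interlaced end points on the boundary meet. -/
theorem inter_nonempty_of_interlaced (φ : Circle ≃ₜ bdry h) {a b c d : ℝ} (hab : a < b)
    (hbc : b < c) (hcd : c < d) (hda : d < a + 2 * Real.pi) {A B : Set M}
    (hA : JoinedIn A (bd φ a) (bd φ c)) (hB : JoinedIn B (bd φ b) (bd φ d)) :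
    (A ∩ B).Nonempty := by
  let k : Circle ≃ₜ Circle :=
    { toFun := fun z => ⟨(h (φ z : M) : ℂ), mem_sphere_zero_iff_norm.2 (φ z).2⟩
      invFun := fun w => φ.symm ⟨h.symm ⟨(w : ℂ), by simp [Circle.norm_coe]⟩, by
        change ‖(h (h.symm _) : ℂ)‖ = 1
        rw [h.apply_symm_apply]
        exact Circle.norm_coe w⟩
      left_inv := fun z => by simp
      right_inv := fun w => by
        apply Subtype.ext
        simp
      continuous_toFun := by fun_prop
      continuous_invFun := by fun_prop }
  obtain ⟨α, hα⟩ := hA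
  obtain ⟨β, hβ⟩ := hB
  have hk : ∀ x, ((k (Circle.exp x) : Circle) : ℂ) = (h (bd φ x) : ℂ) := fun x => rfl
  obtain ⟨s, t, e⟩ := exists_crossing_of_homeo k (fun t => (h (α t) : ℂ)) (fun t => (h (β t) : ℂ))
    (by fun_prop) (by fun_prop) (fun t => mem_closedBall_zero_iff.1 (h (α t)).2)
    (fun t => mem_closedBall_zero_iff.1 (h (β t)).2) hab hbc hcd hda (by simp [hk]) (by simp [hk])
    (by simp [hk]) (by simp [hk])
  have e2 : α s = β t := h.injective (Subtype.ext e)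
  exact ⟨α s, hα s, by rw [e2]; exact hβ t⟩

theorem IsLift.joinedIn {f : M → S2} {B : Set S2} {s : S2 → M} (hs : IsLift f B s) {x y : S2}
    (hxy : JoinedIn B x y) : JoinedIn (s '' B) (s x) (s y) := by
  obtain ⟨α, hα⟩ := hxy
  refine ⟨⟨⟨fun t => s (α t), hs.1.comp_continuous α.continuous hα⟩, by simp, by simp⟩,
    fun t => ⟨_, hα t, rfl⟩⟩

namespace InwardFrame

variable {f : M → S2} {φ : Circle ≃ₜ bdry h} {γ' N : ℝ → E3} {κ : ℝ → ℝ}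

/-- A lift of a cap tangent to the boundary. -/
def CapLift (F : InwardFrame f φ γ' N κ) (θ k : ℝ) (s : S2 → M) : Prop :=
  IsLift f (F.cap θ k) s ∧ s (f (bd φ θ)) = bd φ θ

theorem CapLift.mono {F : InwardFrame f φ γ' N κ} {θ k k' : ℝ} {s : S2 → M} (hs : F.CapLift θ k s)
    (hk : k ≤ k') : F.CapLift θ k' s := ⟨hs.1.mono (cap_anti _ _ hk), hs.2⟩

theorem CapLift.eqOn [T2Space M] {F : InwardFrame f φ γ' N κ} {θ k k' : ℝ} {s s' : S2 → M}
    (hs : F.CapLift θ k s) (hs' : F.CapLift θ k' s') (hk : k ≤ k') : EqOn s s' (F.cap θ k') :=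
  (hs.mono hk).1.eqOn F.isTopImmersion hs'.1 (isPreconnected_cap _ _ _) (F.base_mem_cap θ k')
    (hs.2.trans hs'.2.symm)

theorem tendsto_mk_nhdsLT (θ : ℝ) :
    Tendsto (fun r : ℝ => (θ, r)) (𝓝[<] 0) (𝓝 (θ, 0)) :=
  (Continuous.tendsto' (by fun_prop) _ _ rfl).mono_left nhdsWithin_le_nhds

/-- The interior of a lifted region does not meet the boundary. -/
theorem notMem_bdry_of_isOpen (F : InwardFrame f φ γ' N κ) {B : Set S2} {s : S2 → M}
    (hs : IsLift f B s) (hB : IsOpen B) {y : S2} (hy : y ∈ B) : s y ∉ bdry h := by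
  intro hb
  obtain ⟨θ, -, hθ⟩ := exists_bd_eq φ hb 0
  have hyθ : f (bd φ θ) = y := by rw [hθ, hs.2 y hy]
  obtain ⟨U, hU, hside⟩ := F.side θ
  have h1 : ∀ᶠ x in 𝓝 y, x ∈ B ∧ s x ∈ U := by
    filter_upwards [hB.mem_nhds hy, (hs.1.continuousAt (hB.mem_nhds hy)).preimage_mem_nhds
      (by rw [← hθ]; exact hU)] with x h1 h2 using ⟨h1, h2⟩
  rw [← hyθ, ← F.map_fermi_nhds θ, eventually_map] at h1
  obtain ⟨r, ⟨hr1, hr2⟩, hr0⟩ := (((tendsto_mk_nhdsLT θ).eventually (h1.and hside)).and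
    self_mem_nhdsWithin).exists
  have := hr2 ⟨_, hr1.2, hs.2 _ hr1.1⟩
  exact absurd hr0 (not_lt.2 this)

theorem CapLift.mem_cir {F : InwardFrame f φ γ' N κ} {θ k : ℝ} {s : S2 → M} (hs : F.CapLift θ k s)
    {y : S2} (hy : y ∈ F.cap θ k) (hb : s y ∈ bdry h) : y ∈ F.cir θ k := by
  rw [cap, cap_eq_ocap_union_cir] at hy
  refine hy.resolve_left fun ho => ?_
  exact F.notMem_bdry_of_isOpen (hs.1.mono (ocap_subset_cap _ _ _)) (isOpen_ocap _ _ _) ho hb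

theorem exists_capLift_of_subset [T2Space M] (F : InwardFrame f φ γ' N κ) {θ k : ℝ} {U : Set M}
    (hU : IsCompact U) (hi : InjOn f U) (hθ : bd φ θ ∈ U) (hk : F.cap θ k ⊆ f '' U) :
    ∃ s, F.CapLift θ k s := by
  obtain ⟨g, hg, hgf⟩ := exists_inverse_of_isCompact F.isTopImmersion.1 hU ⟨_, hθ⟩ hi
  exact ⟨g, hg.mono hk, hgf _ hθ⟩

theorem eventually_lev_nonpos_of_lt (F : InwardFrame f φ γ' N κ) {θ₀ k : ℝ} (hk : κ θ₀ < k) :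
    ∀ᶠ θ in 𝓝 θ₀, F.lev θ₀ k (f (bd φ θ)) ≤ 0 := by
  obtain ⟨δ, hδ, hc⟩ := F.exists_comparison θ₀
  obtain ⟨η, hη, hb⟩ := Metric.eventually_nhds_iff.1
    (F.continuous_curvature.continuousAt.eventually (gt_mem_nhds hk))
  filter_upwards [eventually_abs_sub_lt θ₀ hδ, eventually_abs_sub_lt θ₀ hη] with θ h1 h2
  by_cases hne : θ = θ₀
  · rw [hne]; exact (F.lev_base θ₀ k).le
  · have := hc k (-1) θ h1 hne (fun u hu => by
      have h3 : |u - θ₀| < η := by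
        rcases hu with hu | hu
        · rw [abs_of_pos (by linarith)]; linarith [le_abs_self (θ - θ₀)]
        · rw [abs_of_neg (by linarith)]; linarith [neg_abs_le (θ - θ₀)]
      have := hb (y := u) (by rwa [Real.dist_eq])
      linarith)
    linarith

section Compact

variable [T2Space M] [CompactSpace M]

theorem exists_capLift (F : InwardFrame f φ γ' N κ) (θ₀ : ℝ) : ∃ k s, F.CapLift θ₀ k s := by
  obtain ⟨U₀, hU₀, hi₀⟩ := F.isTopImmersion.2 (bd φ θ₀)
  obtain ⟨U, hU, hUU, hUc⟩ := local_compact_nhds hU₀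
  obtain ⟨ε, hε, hb⟩ := Metric.eventually_nhds_iff_ball.1
    (F.eventually_mem_image (F.eventually_lev_nonpos_of_lt (lt_add_one (κ θ₀))) hU)
  -- The first bound keeps the boundary locally outside the cap. A point of the cap satisfies `1 -
  -- ⟪y, x⟫ ≤ 1 / k` for the base y, so the bound `4 / ε ^ 2` puts the cap into the ball of radius
  -- ε.
  let k := max (κ θ₀ + 1) (max 1 (4 / ε ^ 2))
  have k1 : (1 : ℝ) ≤ k := (le_max_left _ _).trans (le_max_right _ _)
  have k2 : 4 / ε ^ 2 ≤ k := (le_max_right _ _).trans (le_max_right _ _)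
  refine ⟨k, F.exists_capLift_of_subset hUc (hi₀.mono hUU) (mem_of_mem_nhds hU) fun x hx => ?_⟩
  refine hb x ?_ (cap_anti _ _ (le_max_left _ _) hx)
  rw [ball_eq _ _ hε]
  change 1 - ε ^ 2 / 2 < _
  have h1 := mem_cap.1 hx
  unfold ImmersedDisk.lev at h1
  have h2 : ⟪N θ₀, (x : E3)⟫ ≤ 1 := by
    have := real_inner_le_norm (N θ₀) (x : E3)
    rwa [F.norm_normal, norm_eq_of_mem_sphere, mul_one] at this
  rw [div_le_iff₀ (by positivity)] at k2
  by_contra! h3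
  nlinarith [sq_nonneg ε]

/-- Let y be a point slightly outside the disk on the normal line. A lifted cap containing y would,
by equicontinuity, have its lift over y close to the base point, where the image does not reach y.
The bound is the curvature of the tangent circle through y. -/
theorem exists_bound_capLift (F : InwardFrame f φ γ' N κ) (θ₀ : ℝ) :
    ∃ b, ∀ k s, F.CapLift θ₀ k s → b ≤ k := by
  obtain ⟨U, hU, hside⟩ := F.side θ₀
  obtain ⟨δ, hδ, W, hW, hctrl⟩ := exists_control F.isTopImmersion (bd φ θ₀) hU
  have h1 : ∀ᶠ x in 𝓝 (f (bd φ θ₀)), x ∈ Metric.ball (f (bd φ θ₀)) δ := Metric.ball_mem_nhds _ hδ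
  rw [← F.map_fermi_nhds θ₀, eventually_map] at h1
  obtain ⟨r, ⟨hr1, hr2⟩, hr0⟩ := (((tendsto_mk_nhdsLT θ₀).eventually (h1.and hside)).and
    self_mem_nhdsWithin).exists
  have hy : F.fermi (θ₀, r) ∉ f '' U := fun hc => absurd hr0 (not_lt.2 (hr2 hc))
  have hyne : F.fermi (θ₀, r) ≠ f (bd φ θ₀) := fun e => hy (by
    rw [e]; exact ⟨_, mem_of_mem_nhds hU, rfl⟩)
  set y := F.fermi (θ₀, r)
  have hpos := inner_lt_one hyne
  refine ⟨⟪N θ₀, (y : E3)⟫ / (1 - ⟪(f (bd φ θ₀) : E3), (y : E3)⟫), fun k s hs => ?_⟩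
  rw [div_le_iff₀ (by linarith)]
  by_contra! hlt
  have hycap : y ∈ F.cap θ₀ k := by
    rw [ImmersedDisk.mem_cap, ImmersedDisk.lev]; linarith
  have := hctrl (F.cap θ₀ k ∩ Metric.ball (f (bd φ θ₀)) δ) s inter_subset_right
    (isPreconnected_cap_inter_ball _ _ _ _ hδ) (hs.1.mono inter_subset_left)
    ⟨f (bd φ θ₀), ⟨F.base_mem_cap θ₀ k, Metric.mem_ball_self hδ⟩, by
      rw [hs.2]; exact mem_of_mem_nhds hW⟩ y ⟨hycap, hr1⟩
  exact hy ⟨s y, this, hs.1.2 y hycap⟩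

/-- The lifts over smaller caps agree where they overlap and glue to a lift of the open cap.
Compactness gives it a cluster point at each boundary point of the cap, and `exists_control` turns
the cluster point into a limit. -/
theorem capLift_of_forall_gt (F : InwardFrame f φ γ' N κ) {θ₀ k₀ : ℝ}
    (hall : ∀ k > k₀, ∃ s, F.CapLift θ₀ k s) : ∃ s, F.CapLift θ₀ k₀ s := by
  have hM : Nonempty M := ⟨bd φ θ₀⟩
  have hf := F.isTopImmersion
  choose! S hS using hall
  choose! K hK1 hK2 using fun x (hx : x ∈ F.ocap θ₀ k₀) => exists_gt_mem_ocap hx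
  let u : S2 → M := fun x => S (K x) x
  have hSS : ∀ k > k₀, ∀ k' > k₀, ∀ x, x ∈ F.cap θ₀ k → x ∈ F.cap θ₀ k' → S k x = S k' x := by
    intro k hk k' hk' x hx hx'
    rcases le_total k k' with h1 | h1
    · exact (hS k hk).eqOn (hS k' hk') h1 hx'
    · exact ((hS k' hk').eqOn (hS k hk) h1 hx).symm
  have huS : ∀ k > k₀, ∀ x ∈ F.ocap θ₀ k, u x = S k x := fun k hk x hx => by
    have hx0 : x ∈ F.ocap θ₀ k₀ := (mem_ocap.1 hx).trans_le (lev_anti _ _ (le_of_lt hk) x)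
    exact hSS _ (hK1 x hx0) k hk x (ocap_subset_cap _ _ _ (hK2 x hx0)) (ocap_subset_cap _ _ _ hx)
  have hu : IsLift f (F.ocap θ₀ k₀) u := by
    refine ⟨fun x hx => ?_, fun x hx => ?_⟩
    · have hc : ContinuousAt (S (K x)) x := ((hS _ (hK1 x hx)).1.1.mono
        (ocap_subset_cap _ _ _)).continuousAt ((isOpen_ocap _ _ _).mem_nhds (hK2 x hx))
      refine (hc.congr ?_).continuousWithinAt
      filter_upwards [(isOpen_ocap _ _ _).mem_nhds (hK2 x hx)] with z hz
      exact (huS _ (hK1 x hx) z hz).symm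
    · exact (hS _ (hK1 x hx)).1.2 x (ocap_subset_cap _ _ _ (hK2 x hx))
  have hcl : ∀ k, F.cap θ₀ k ⊆ closure (F.ocap θ₀ k) := fun k =>
    cap_subset_closure_ocap (F.norm_normal θ₀) (F.inner_normal_curve θ₀) k
  have hfu : ∀ x, Tendsto (fun y => f (u y)) (𝓝[F.ocap θ₀ k₀] x) (𝓝 x) := fun x => by
    refine (tendsto_id.mono_left nhdsWithin_le_nhds).congr' ?_
    filter_upwards [self_mem_nhdsWithin] with y hy
    exact (hu.2 y hy).symm
  have hlim : ∀ x ∈ F.cap θ₀ k₀, ∃ z, Tendsto u (𝓝[F.ocap θ₀ k₀] x) (𝓝 z) := by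
    intro x hx
    have hne : (𝓝[F.ocap θ₀ k₀] x).NeBot := mem_closure_iff_nhdsWithin_neBot.1 (hcl k₀ hx)
    obtain ⟨z, hz⟩ := exists_clusterPt_of_compactSpace (map u (𝓝[F.ocap θ₀ k₀] x))
    have hfz : f z = x := by
      have h1 : ClusterPt (f z) (map f (map u (𝓝[F.ocap θ₀ k₀] x))) :=
        hz.map hf.1.continuousAt tendsto_map
      have h2 : ClusterPt (f z) (𝓝 x) := h1.mono (by rw [Filter.map_map]; exact hfu x)
      exact eq_of_nhds_neBot h2
    refine ⟨z, fun U hU => ?_⟩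
    obtain ⟨δ, hδ, W, hW, hctrl⟩ := exists_control hf z hU
    rw [hfz] at hctrl
    have hA : F.ocap θ₀ k₀ ∩ Metric.ball x δ ∈ 𝓝[F.ocap θ₀ k₀] x :=
      inter_mem self_mem_nhdsWithin (nhdsWithin_le_nhds (Metric.ball_mem_nhds _ hδ))
    have hfreq : ∃ᶠ y in 𝓝[F.ocap θ₀ k₀] x, u y ∈ W :=
      frequently_map.1 (hz.frequently hW)
    obtain ⟨y, hyW, hyA⟩ := (hfreq.and_eventually (Filter.eventually_of_mem hA fun y hy => hy)).exists
    rw [mem_map]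
    filter_upwards [hA] with y' hy'
    exact hctrl _ u inter_subset_right (isPreconnected_ocap_inter_ball _ _ _ _ hδ)
      (hu.mono inter_subset_left) ⟨y, hyA, hyW⟩ y' hy'
  have hext : ∀ x ∈ F.cap θ₀ k₀, Tendsto u (𝓝[F.ocap θ₀ k₀] x)
      (𝓝 (extendFrom (F.ocap θ₀ k₀) u x)) := fun x hx => tendsto_extendFrom (hlim x hx)
  refine ⟨extendFrom (F.ocap θ₀ k₀) u, ⟨continuousOn_extendFrom (hcl k₀) hlim, fun x hx => ?_⟩, ?_⟩
  · have hne : (𝓝[F.ocap θ₀ k₀] x).NeBot := mem_closure_iff_nhdsWithin_neBot.1 (hcl k₀ hx)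
    exact tendsto_nhds_unique ((hf.1.tendsto _).comp (hext x hx)) (hfu x)
  -- The limit at the base is read off along a smaller open cap, on which the glued section equals a
  -- lift with known value.
  · have hk : k₀ + 1 > k₀ := lt_add_one k₀
    have hb := F.base_mem_cap θ₀ (k₀ + 1)
    have hne : (𝓝[F.ocap θ₀ (k₀ + 1)] (f (bd φ θ₀))).NeBot :=
      mem_closure_iff_nhdsWithin_neBot.1 (hcl (k₀ + 1) hb)
    have hsub : F.ocap θ₀ (k₀ + 1) ⊆ F.ocap θ₀ k₀ := fun x hx =>
      (mem_ocap.1 hx).trans_le (lev_anti _ _ (le_of_lt hk) x)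
    have h1 := (hext _ (F.base_mem_cap θ₀ k₀)).mono_left (nhdsWithin_mono _ hsub)
    have h2 : Tendsto u (𝓝[F.ocap θ₀ (k₀ + 1)] (f (bd φ θ₀))) (𝓝 (bd φ θ₀)) := by
      have h3 := ((hS _ hk).1.1 _ hb).mono_left (nhdsWithin_mono _ (ocap_subset_cap _ _ _))
      rw [(hS _ hk).2] at h3
      refine h3.congr' ?_
      filter_upwards [self_mem_nhdsWithin] with x hx
      exact (huS _ hk x hx).symm
    exact tendsto_nhds_unique h1 h2

theorem exists_least_capLift (F : InwardFrame f φ γ' N κ) (θ₀ : ℝ) :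
    ∃ k s, F.CapLift θ₀ k s ∧ ∀ k' s', F.CapLift θ₀ k' s' → k ≤ k' := by
  let L : Set ℝ := {k | ∃ s, F.CapLift θ₀ k s}
  have hL : L.Nonempty := F.exists_capLift θ₀
  obtain ⟨b, hb⟩ := F.exists_bound_capLift θ₀
  have hbdd : BddBelow L := ⟨b, fun k ⟨s, hs⟩ => hb k s hs⟩
  obtain ⟨s, hs⟩ := F.capLift_of_forall_gt (θ₀ := θ₀) (k₀ := sInf L) (fun k hk => by
    obtain ⟨k', ⟨s, hs⟩, hk'⟩ := exists_lt_of_csInf_lt hL hk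
    exact ⟨s, hs.mono hk'.le⟩)
  exact ⟨sInf L, s, hs, fun k' s' hs' => csInf_le hbdd ⟨s', hs'⟩⟩

/-- A lifted cap that touches the boundary at the base point only can be enlarged. -/
theorem CapLift.exists_lt {F : InwardFrame f φ γ' N κ} {θ₀ k k₀ : ℝ} {s : S2 → M}
    (hs : F.CapLift θ₀ k s) (hk₀ : k₀ < k) (hlev : ∀ᶠ θ in 𝓝 θ₀, F.lev θ₀ k₀ (f (bd φ θ)) ≤ 0)
    (hcon : ∀ x ∈ F.cir θ₀ k, s x ∈ bdry h → x = f (bd φ θ₀)) :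
    ∃ k₁ < k, ∃ s₁, F.CapLift θ₀ k₁ s₁ := by
  have hf := F.isTopImmersion
  have hcomp : IsCompact (s '' F.cap θ₀ k) :=
    (isClosed_cap _ _ _).isCompact.image_of_continuousOn hs.1.1
  have hinj : InjOn f (s '' F.cap θ₀ k) := by
    rintro _ ⟨a, ha, rfl⟩ _ ⟨b, hb, rfl⟩ e
    rw [hs.1.2 a ha, hs.1.2 b hb] at e
    rw [e]
  -- A locally injective map that is injective on a compact set is injective on a neighbourhood of
  -- it; the larger cap will be lifted through the inverse on that neighbourhood.
  obtain ⟨t, ht, hti⟩ := hinj.exists_mem_nhdsSet hcomp (fun x _ => hf.1.continuousAt)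
    (fun x _ => hf.2 x)
  obtain ⟨O, hO, hsO, hOt⟩ := mem_nhdsSet_iff_exists.1 ht
  obtain ⟨U, hUc, hKU, hUO⟩ := exists_compact_between hcomp hO hsO
  have hUi : InjOn f U := hti.mono (hUO.trans hOt)
  have hnhds : ∀ y ∈ F.cap θ₀ k, U ∈ 𝓝 (s y) := fun y hy =>
    mem_interior_iff_mem_nhds.1 (hKU ⟨y, hy, rfl⟩)
  have hbase : bd φ θ₀ ∈ U := by
    have := mem_of_mem_nhds (hnhds _ (F.base_mem_cap θ₀ k))
    rwa [hs.2] at this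
  -- At interior points of M the map is open. The only boundary contact is the base, where the local
  -- position of the cap of curvature `k₀` is enough.
  have hloc : ∀ y ∈ F.cap θ₀ k, ∀ᶠ x in 𝓝 y, x ∈ F.cap θ₀ k₀ → x ∈ f '' U := by
    intro y hy
    by_cases hy0 : y = f (bd φ θ₀)
    · rw [hy0]
      refine F.eventually_mem_image hlev ?_
      have := hnhds _ (F.base_mem_cap θ₀ k)
      rwa [hs.2] at this
    · have hb : s y ∉ bdry h := fun hb => hy0 (hcon y (hs.mem_cir hy hb) hb)
      have := image_mem_nhds_of_interior hf hb (hnhds y hy)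
      rw [hs.1.2 y hy] at this
      filter_upwards [this] with x hx _ using hx
  -- Otherwise slightly larger caps all contain points not covered by U. A limit of such points lies
  -- in the cap of curvature k, near which everything in the larger cap is covered.
  by_contra! hcontra
  have hstep : ∀ n : ℕ, ∃ x ∈ F.cap θ₀ (k - (k - k₀) / (n + 1)), x ∉ f '' U := by
    intro n
    by_contra! hsub
    obtain ⟨s₁, hs₁⟩ := F.exists_capLift_of_subset hUc hUi hbase hsub
    have hn : (0 : ℝ) < (k - k₀) / (n + 1) := div_pos (sub_pos.2 hk₀) (by positivity)
    exact hcontra _ (by linarith) s₁ hs₁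
  choose x hx hxU using hstep
  obtain ⟨y, ψ, hψ, hlim⟩ := CompactSpace.tendsto_subseq x
  have hk : Tendsto (fun n : ℕ => k - (k - k₀) / ((n : ℝ) + 1)) atTop (𝓝 k) := by
    have := tendsto_one_div_add_atTop_nhds_zero_nat (𝕜 := ℝ)
    have h2 := (this.const_mul (k - k₀)).const_sub k
    simpa [div_eq_mul_inv] using h2
  have hy : y ∈ F.cap θ₀ k := by
    have hc : Continuous fun p : ℝ × S2 => ImmersedDisk.lev (f (bd φ θ₀)) (N θ₀) p.1 p.2 := by
      unfold ImmersedDisk.lev; fun_prop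
    have h1 := (hc.tendsto (k, y)).comp ((hk.comp hψ.tendsto_atTop).prodMk_nhds hlim)
    exact ge_of_tendsto' h1 fun n => mem_cap.1 (hx (ψ n))
  obtain ⟨n, hn⟩ := (hlim.eventually (hloc y hy)).exists
  refine hxU _ (hn (cap_anti _ _ ?_ (hx _)))
  have h1 : (k - k₀) / ((ψ n : ℝ) + 1) ≤ k - k₀ :=
    div_le_self (sub_pos.2 hk₀).le (by linarith [Nat.cast_nonneg (α := ℝ) (ψ n)])
  linarith

end Compact

end InwardFrame

end ImmersedDisk

end

/-! ### Maximal circles: existence, uniqueness, noncrossing -/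

noncomputable section

open Set Filter Topology
open scoped RealInnerProductSpace

namespace ImmersedDisk

variable {M : Type*} [TopologicalSpace M] {h : M ≃ₜ UnitDisk}

theorem mem_of_mem_enclosed {C : Set M} {p : M} (hp : p ∈ bdry h) (hC : p ∈ enclosed h C) :
    p ∈ C := by
  rcases hC with hC | ⟨h1, h2⟩
  · exact hC
  · exact absurd hp (disjoint_left.1 h2 (mem_connectedComponentIn h1))

namespace InwardFrame

variable {f : M → S2} {φ : Circle ≃ₜ bdry h} {γ' N : ℝ → E3} {κ : ℝ → ℝ}
variable [T2Space M] [CompactSpace M]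

/-- This is the path to be crossed: from the boundary just before `θ₀` to the circle, around the
circle avoiding the base, and back to the boundary just after `θ₀`. Its end points separate `θ₀`
from `θ₁`, and it stays off the open cap. -/
theorem exists_joinedIn_horns (F : InwardFrame f φ γ' N κ) {θ₀ θ₁ k : ℝ} {σ : S2 → M}
    (hσ : IsLift f (F.cir θ₀ k) σ) (h0 : σ (f (bd φ θ₀)) = bd φ θ₀) (h1 : θ₀ < θ₁)
    (h2 : θ₁ < θ₀ + 2 * Real.pi) : ∃ a b, a < θ₀ ∧ θ₀ < b ∧ b < θ₁ ∧ θ₁ < a + 2 * Real.pi ∧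
      JoinedIn {m | F.lev θ₀ k (f m) ≤ 0 ∧ f m ≠ f (bd φ θ₀)} (bd φ a) (bd φ b) := by
  have hh := F.eventually_joinedIn hσ h0
  have hl : 𝓝[<] θ₀ ≤ 𝓝[≠] θ₀ := nhdsWithin_mono _ fun x hx => ne_of_lt hx
  have hr : 𝓝[>] θ₀ ≤ 𝓝[≠] θ₀ := nhdsWithin_mono _ fun x hx => ne_of_gt hx
  obtain ⟨a, ⟨xa, hxa, ja⟩, ha⟩ := ((hh.filter_mono hl).and
    (Ioo_mem_nhdsLT (show θ₁ - 2 * Real.pi < θ₀ by linarith))).exists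
  obtain ⟨b, ⟨xb, hxb, jb⟩, hb⟩ := ((hh.filter_mono hr).and (Ioo_mem_nhdsGT h1)).exists
  refine ⟨a, b, ha.2, hb.1, hb.2, by linarith [ha.1], ?_⟩
  have j := (hσ.mono sdiff_subset).joinedIn (joinedIn_cir_diff (F.inner_normal_curve θ₀) hxa hxb)
  have hsub : σ '' (F.cir θ₀ k \ {f (bd φ θ₀)}) ⊆
      {m | F.lev θ₀ k (f m) ≤ 0 ∧ f m ≠ f (bd φ θ₀)} := by
    rintro _ ⟨x, hx, rfl⟩
    have e := hσ.2 x hx.1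
    refine ⟨?_, ?_⟩
    · rw [e]; exact (mem_cir.1 hx.1).le
    · rw [e]; exact hx.2
  exact (ja.trans (j.mono hsub)).trans jb.symm

/-- The least curvature for which the tangent cap lifts to the disk. -/
def crit (F : InwardFrame f φ γ' N κ) (θ : ℝ) : ℝ := (F.exists_least_capLift θ).choose

/-- The lift of the largest tangent cap. -/
def sec (F : InwardFrame f φ γ' N κ) (θ : ℝ) : S2 → M :=
  (F.exists_least_capLift θ).choose_spec.choose

theorem capLift_sec (F : InwardFrame f φ γ' N κ) (θ : ℝ) : F.CapLift θ (F.crit θ) (F.sec θ) :=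
  (F.exists_least_capLift θ).choose_spec.choose_spec.1

theorem crit_le (F : InwardFrame f φ γ' N κ) {θ k : ℝ} {s : S2 → M} (hs : F.CapLift θ k s) :
    F.crit θ ≤ k :=
  (F.exists_least_capLift θ).choose_spec.choose_spec.2 k s hs

theorem isLift_sec (F : InwardFrame f φ γ' N κ) (θ : ℝ) :
    IsLift f (F.cap θ (F.crit θ)) (F.sec θ) := (F.capLift_sec θ).1

theorem sec_base (F : InwardFrame f φ γ' N κ) (θ : ℝ) : F.sec θ (f (bd φ θ)) = bd φ θ :=
  (F.capLift_sec θ).2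

/-- The maximal circle at a boundary point. -/
def circ (F : InwardFrame f φ γ' N κ) (θ : ℝ) : Set M := F.sec θ '' F.cir θ (F.crit θ)

theorem bd_mem_circ (F : InwardFrame f φ γ' N κ) (θ : ℝ) : bd φ θ ∈ F.circ θ :=
  ⟨_, F.base_mem_cir θ _, F.sec_base θ⟩

theorem isCircle_image (F : InwardFrame f φ γ' N κ) {θ k : ℝ} (hk : F.crit θ ≤ k) :
    IsCircle f (F.sec θ '' F.cir θ k) := by
  have hl : IsLift f (F.cir θ k) (F.sec θ) :=
    ((F.capLift_sec θ).mono hk).1.mono (cir_subset_cap _ _ _)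
  refine ⟨((isClosed_cir _ _ _).isCompact.image_of_continuousOn hl.1).isClosed, ?_, ?_⟩
  · rintro _ ⟨a, ha, rfl⟩ _ ⟨b, hb, rfl⟩ e
    rw [hl.2 a ha, hl.2 b hb] at e
    rw [e]
  · have : f '' (F.sec θ '' F.cir θ k) = F.cir θ k := by
      rw [image_image]
      exact (image_congr fun x hx => hl.2 x hx).trans (image_id' _)
    rw [this]
    exact isRoundCircle_cir (F.norm_normal θ) (F.inner_normal_curve θ) k

theorem isCircle_circ (F : InwardFrame f φ γ' N κ) (θ : ℝ) : IsCircle f (F.circ θ) :=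
  F.isCircle_image le_rfl

/-- The cap cannot grow past `crit`. If the base is not an obstruction, as `hlev` ensures, another
boundary contact must be. -/
theorem exists_contact (F : InwardFrame f φ γ' N κ) {θ k : ℝ} (hk : k < F.crit θ)
    (hlev : ∀ᶠ t in 𝓝 θ, F.lev θ k (f (bd φ t)) ≤ 0) :
    ∃ t, θ < t ∧ t < θ + 2 * Real.pi ∧ bd φ t ∈ F.circ θ := by
  by_contra! hc
  obtain ⟨k₁, hk₁, s₁, hs₁⟩ := (F.capLift_sec θ).exists_lt hk hlev (fun x hx hb => by
    obtain ⟨t, ht, e⟩ := exists_bd_eq φ hb θ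
    rcases ht.1.eq_or_lt with h1 | h1
    · rw [h1, e, (F.isLift_sec θ).2 x (cir_subset_cap _ _ _ hx)]
    · exact absurd (show bd φ t ∈ F.circ θ from ⟨x, hx, e.symm⟩) (hc t h1 ht.2))
  exact absurd (F.crit_le hs₁) (not_le.2 hk₁)

/-- Every circle through a boundary point is the lift of a tangent circle of large curvature. -/
theorem exists_eq_image_cir (F : InwardFrame f φ γ' N κ) {C : Set M} (hC : IsCircle f C) {θ : ℝ}
    (hθ : bd φ θ ∈ C) : ∃ k, F.crit θ ≤ k ∧ C = F.sec θ '' F.cir θ k := by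
  obtain ⟨hcl, hinj, n, t, hn, ht, hfC⟩ := hC
  obtain ⟨g, hg, hgf⟩ := exists_inverse_of_isCompact F.isTopImmersion.1 hcl.isCompact ⟨_, hθ⟩ hinj
  have hbase : ⟪n, (f (bd φ θ) : E3)⟫ = t := by
    have : f (bd φ θ) ∈ f '' C := ⟨_, hθ, rfl⟩
    rw [hfC] at this; exact this
  have hg0 := hgf _ hθ
  have htan := F.inner_deriv_eq_zero (hfC ▸ hg) hbase hg0
  have hv : ‖γ' θ‖ ≠ 0 := norm_ne_zero_iff.2 (F.deriv_ne_zero θ)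
  obtain ⟨k, hk⟩ := exists_eq_cir (p := f (bd φ θ)) (N := N θ) (T := ‖γ' θ‖⁻¹ • γ' θ)
    (F.norm_normal θ) (by rw [norm_smul, norm_inv, norm_norm, inv_mul_cancel₀ hv])
    (F.inner_normal_curve θ)
    (by rw [real_inner_smul_left, F.inner_deriv_curve, mul_zero])
    (by rw [real_inner_smul_right, F.inner_normal_deriv, mul_zero]) hn ht hbase
    (by rw [real_inner_smul_right, htan, mul_zero])
  rw [hk] at hfC
  rw [hfC] at hg
  have hCg : C = g '' F.cir θ k := by
    change C = g '' ImmersedDisk.cir _ _ _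
    rw [← hfC, image_image]
    exact ((image_congr fun x hx => hgf x hx).trans (image_id' _)).symm
  -- If k were smaller, the largest lifted cap would have a second contact t. A path in that cap
  -- from θ to t must meet the horn path of the circle of curvature k, yet apart from the base the
  -- cap lies strictly inside that circle.
  have hcrit : F.crit θ ≤ k := by
    by_contra! hlt
    obtain ⟨t, ht1, ht2, x, hx, hxt⟩ := F.exists_contact hlt (F.eventually_lev_nonpos hg hg0)
    obtain ⟨a, b, ha, hb, hbt, hta, hj⟩ := F.exists_joinedIn_horns hg hg0 ht1 ht2
    have hj2 := (F.isLift_sec θ).joinedIn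
      (joinedIn_cap (F.base_mem_cap θ _) (cir_subset_cap _ _ _ hx))
    rw [F.sec_base, hxt] at hj2
    obtain ⟨m, hm, y, hy, rfl⟩ := inter_nonempty_of_interlaced φ ha hb hbt hta hj hj2
    have e := (F.isLift_sec θ).2 y hy
    rw [mem_ofPred_eq, e] at hm
    exact absurd hm.1 (not_le.2 (mem_ocap.1 (cap_diff_subset_ocap _ hlt hy hm.2)))
  refine ⟨k, hcrit, ?_⟩
  rw [hCg]
  refine image_congr fun x hx => ?_
  exact hg.eqOn F.isTopImmersion (((F.capLift_sec θ).mono hcrit).1.mono (cir_subset_cap _ _ _))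
    (isPreconnected_cir (F.norm_normal θ) (F.inner_normal_curve θ) k) (F.base_mem_cir θ k)
    (hg0.trans (F.sec_base θ).symm) hx

/-- The lift of the open cap is open, and closing it adds only the circle. A component of the
complement of the circle that meets it therefore stays in it, away from the boundary. -/
theorem image_cap_subset_enclosed (F : InwardFrame f φ γ' N κ) {θ k : ℝ} (hk : F.crit θ ≤ k) :
    F.sec θ '' F.cap θ k ⊆ enclosed h (F.sec θ '' F.cir θ k) := by
  have hl := ((F.capLift_sec θ).mono hk).1
  rintro _ ⟨y, hy, rfl⟩
  have hy' := hy
  rw [cap, cap_eq_ocap_union_cir] at hy'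
  by_cases hyc : y ∈ F.cir θ k
  · exact Or.inl ⟨y, hyc, rfl⟩
  have hyo := hy'.resolve_right hyc
  have hlo := hl.mono (ocap_subset_cap _ _ _)
  have hn : F.sec θ y ∉ F.sec θ '' F.cir θ k := by
    rintro ⟨z, hz, e⟩
    rw [hl.injOn (cir_subset_cap _ _ _ hz) hy e] at hz
    exact hyc hz
  refine Or.inr ⟨hn, ?_⟩
  have hK : IsClosed (F.sec θ '' F.cap θ k) :=
    ((isClosed_cap _ _ _).isCompact.image_of_continuousOn hl.1).isClosed
  have hsub : connectedComponentIn (F.sec θ '' F.cir θ k)ᶜ (F.sec θ y) ⊆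
      F.sec θ '' F.ocap θ k := by
    refine isPreconnected_connectedComponentIn.subset_left_of_subset_union
      (hlo.isOpen_image F.isTopImmersion (isOpen_ocap _ _ _)) hK.isOpen_compl ?_ ?_
      ⟨_, mem_connectedComponentIn hn, y, hyo, rfl⟩
    · exact disjoint_left.2 fun m hm hm' => hm' (image_mono (ocap_subset_cap _ _ _) hm)
    · intro m hm
      have hmC := connectedComponentIn_subset _ _ hm
      by_cases hmK : m ∈ F.sec θ '' F.cap θ k
      · left
        obtain ⟨z, hz, rfl⟩ := hmK
        refine ⟨z, ?_, rfl⟩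
        rw [cap, cap_eq_ocap_union_cir] at hz
        exact hz.resolve_right fun hzc => hmC ⟨z, hzc, rfl⟩
      · exact Or.inr hmK
  refine disjoint_left.2 fun m hm hb => ?_
  obtain ⟨z, hz, rfl⟩ := hsub hm
  exact F.notMem_bdry_of_isOpen hlo (isOpen_ocap _ _ _) hz hb

/-- A competitor is a lifted tangent circle of curvature `k ≥ crit`. If the inequality is strict,
some point of `circ` can be joined to the boundary without meeting the competitor, so `circ` is not
inside it. -/
theorem isMaximalCircleAt_circ (F : InwardFrame f φ γ' N κ) (θ : ℝ) :
    IsMaximalCircleAt h f (bd φ θ) (F.circ θ) := by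
  refine ⟨F.isCircle_circ θ, F.bd_mem_circ θ, fun C' hC' hθ hsub => ?_⟩
  obtain ⟨k, hk, rfl⟩ := F.exists_eq_image_cir hC' hθ
  rcases hk.eq_or_lt with rfl | hlt
  · rfl
  exfalso
  have hl := F.isLift_sec θ
  obtain ⟨t, x, hx, hj⟩ := (F.eventually_joinedIn (hl.mono (cir_subset_cap _ _ _))
    (F.sec_base θ)).exists
  have havoid : ∀ m, F.lev θ (F.crit θ) (f m) ≤ 0 → f m ≠ f (bd φ θ) →
      m ∉ F.sec θ '' F.cir θ k := by
    rintro _ h1 h2 ⟨z, hz, rfl⟩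
    have hzc := cir_subset_cap _ _ _ hz
    rw [hl.2 z (cap_anti _ _ hk hzc)] at h1 h2
    exact absurd h1 (not_le.2 (mem_ocap.1 (cap_diff_subset_ocap _ hlt hzc h2)))
  have hxe : F.sec θ x ∈ enclosed h (F.sec θ '' F.cir θ k) := hsub ⟨x, hx.1, rfl⟩
  rcases hxe with h1 | ⟨h1, h2⟩
  · have e := hl.2 x (cir_subset_cap _ _ _ hx.1)
    exact havoid _ (by rw [e]; exact (mem_cir.1 hx.1).le) (by rw [e]; exact hx.2) h1
  · refine disjoint_left.1 h2 ?_ (bd_mem φ t)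
    have hj' : JoinedIn (F.sec θ '' F.cir θ k)ᶜ (F.sec θ x) (bd φ t) :=
      (hj.mono fun m hm => havoid m hm.1 hm.2).symm
    obtain ⟨p, hp⟩ := hj'
    have hpc : IsPreconnected (range p) := isPreconnected_range p.continuous
    exact hpc.subset_connectedComponentIn ⟨0, p.source⟩ (range_subset_iff.2 hp) ⟨1, p.target⟩

/-- Any circle through the point lies in the largest lifted cap, hence inside `circ`, so a maximal
one must equal it. -/
theorem isMaximalCircleAt_iff (F : InwardFrame f φ γ' N κ) {θ : ℝ} {C : Set M} :
    IsMaximalCircleAt h f (bd φ θ) C ↔ C = F.circ θ := by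
  refine ⟨fun ⟨h1, h2, h3⟩ => ?_, fun e => e ▸ F.isMaximalCircleAt_circ θ⟩
  refine (h3 _ (F.isCircle_circ θ) (F.bd_mem_circ θ) ?_).symm
  obtain ⟨k, hk, rfl⟩ := F.exists_eq_image_cir h1 h2
  exact (image_mono ((cir_subset_cap _ _ _).trans (cap_anti _ _ hk))).trans
    (F.image_cap_subset_enclosed le_rfl)

theorem isMaximalCircle_iff (F : InwardFrame f φ γ' N κ) {C : Set M} :
    IsMaximalCircle h f C ↔ ∃ θ, C = F.circ θ := by
  constructor
  · rintro ⟨p, hp, hC⟩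
    obtain ⟨θ, -, rfl⟩ := exists_bd_eq φ hp 0
    exact ⟨θ, F.isMaximalCircleAt_iff.1 hC⟩
  · rintro ⟨θ, rfl⟩
    exact ⟨_, bd_mem φ θ, F.isMaximalCircleAt_circ θ⟩

/-- A circle that surrounds `circ θ` contains `bd φ θ` on itself, since boundary points are never
strictly enclosed. Maximality at θ thus gives maximality at every other contact point. -/
theorem circ_eq_of_mem (F : InwardFrame f φ γ' N κ) {θ θ' : ℝ} (hθ : bd φ θ' ∈ F.circ θ) :
    F.circ θ' = F.circ θ := by
  refine (F.isMaximalCircleAt_iff.1 ⟨F.isCircle_circ θ, hθ, fun C' h1 _ h3 => ?_⟩).symm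
  exact (F.isMaximalCircleAt_circ θ).2.2 C' h1
    (mem_of_mem_enclosed (bd_mem φ θ) (h3 (F.bd_mem_circ θ))) h3

/-- Maximal circles do not cross. -/
theorem circ_eq_of_interlaced (F : InwardFrame f φ γ' N κ) {a b c d : ℝ} (hab : a < b) (hbc : b < c)
    (hcd : c < d) (hda : d < a + 2 * Real.pi) (hac : bd φ c ∈ F.circ a) (hbd : bd φ d ∈ F.circ b) :
    F.circ a = F.circ b := by
  have la := F.isLift_sec a
  have lb := F.isLift_sec b
  obtain ⟨x, hx, hxc⟩ := hac
  obtain ⟨y, hy, hyd⟩ := hbd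
  have jb := lb.joinedIn (joinedIn_cap (F.base_mem_cap b _) (cir_subset_cap _ _ _ hy))
  rw [F.sec_base, hyd] at jb
  have ja := la.joinedIn (joinedIn_cap (F.base_mem_cap a _) (cir_subset_cap _ _ _ hx))
  rw [F.sec_base, hxc] at ja
  obtain ⟨m, ⟨z, hz, rfl⟩, z', hz', e⟩ := inter_nonempty_of_interlaced φ hab hbc hcd hda ja jb
  have hzz : z' = z := by rw [← la.2 z hz, ← e, lb.2 z' hz']
  subst hzz
  -- The two lifted caps share a point by the crossing lemma, and the intersection of two caps is
  -- connected, so the lifts agree on all of it.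
  have heq : EqOn (F.sec a) (F.sec b) (F.cap a (F.crit a) ∩ F.cap b (F.crit b)) :=
    (la.mono inter_subset_left).eqOn F.isTopImmersion (lb.mono inter_subset_right)
      (isPreconnected_of_joinedIn fun _ hu _ hv => joinedIn_cap_inter hu hv) ⟨hz, hz'⟩ e.symm
  by_contra hne
  -- A contact point of the first circle lying in the second cap would be a contact point of both
  -- circles and identify them. So both contact points of the first circle lie in the connected set
  -- `cap a \ cap b`; a path there must again meet the second lifted cap, which is absurd.
  have key : ∀ t w, w ∈ F.cir a (F.crit a) → F.sec a w = bd φ t →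
      w ∈ F.cap a (F.crit a) \ F.cap b (F.crit b) := by
    intro t w hw hwt
    have hwa := cir_subset_cap _ _ _ hw
    refine ⟨hwa, fun hwb => hne ?_⟩
    have h1 : F.sec b w = bd φ t := by rw [← heq ⟨hwa, hwb⟩, hwt]
    have h2 := (F.capLift_sec b).mem_cir hwb (by rw [h1]; exact bd_mem φ t)
    rw [← F.circ_eq_of_mem (θ := a) (θ' := t) ⟨w, hw, hwt⟩,
      ← F.circ_eq_of_mem (θ := b) (θ' := t) ⟨w, h2, h1⟩]
  have ja' := (la.mono sdiff_subset).joinedIn (joinedIn_cap_diff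
    (key a _ (F.base_mem_cir a _) (F.sec_base a)) (key c x hx hxc))
  rw [F.sec_base, hxc] at ja'
  obtain ⟨m, ⟨u, hu, rfl⟩, v, hv, e⟩ := inter_nonempty_of_interlaced φ hab hbc hcd hda ja' jb
  have : v = u := by rw [← la.2 u hu.1, ← e, lb.2 v hv]
  exact hu.2 (this ▸ hv)

theorem mem_cir_of_mem_circ (F : InwardFrame f φ γ' N κ) {θ : ℝ} {m : M} (hm : m ∈ F.circ θ) :
    f m ∈ F.cir θ (F.crit θ) ∧ F.sec θ (f m) = m := by
  obtain ⟨x, hx, rfl⟩ := hm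
  rw [(F.isLift_sec θ).2 x (cir_subset_cap _ _ _ hx)]
  exact ⟨hx, rfl⟩

/-- A maximal circle does not contain the boundary unless the boundary is a circle. -/
theorem not_bdry_subset_circ (F : InwardFrame f φ γ' N κ) (hM : ¬ IsCircle f (bdry h)) (θ : ℝ) :
    ¬ bdry h ⊆ F.circ θ := by
  intro hsub
  have hlift : ∀ t, IsLift f (F.cir t (F.crit t)) (F.sec t) := fun t =>
    (F.isLift_sec t).mono (cir_subset_cap _ _ _)
  have hcirc : ∀ t, F.circ t = F.circ θ := fun t => F.circ_eq_of_mem (hsub (bd_mem φ t))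
  -- Every boundary point lies on the circle. Height is strictly monotone along normals, so near the
  -- boundary the circle has no other points; the boundary is thus open in the connected circle and
  -- equals it.
  have hloc : ∀ p ∈ bdry h, ∀ᶠ m in 𝓝 p, m ∈ F.circ θ → m ∈ bdry h := by
    intro p hp
    obtain ⟨t, -, rfl⟩ := exists_bd_eq φ hp 0
    have h1 : ∀ᶠ x in 𝓝 (f (bd φ t)), x ∈ F.cir t (F.crit t) → F.sec t x ∈ bdry h := by
      rw [← F.map_fermi_nhds t, eventually_map]
      obtain ⟨δ, hδ, hm⟩ := F.exists_strictMonoOn t (F.crit t)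
      have h2 : ∀ᶠ z in 𝓝 (t, (0 : ℝ)), |z.1 - t| < δ ∧ |z.2| < δ := by
        filter_upwards [Metric.ball_mem_nhds (t, (0 : ℝ)) hδ] with z hz
        rwa [Metric.mem_ball, Prod.dist_eq, max_lt_iff, Real.dist_eq, Real.dist_eq, sub_zero] at hz
      filter_upwards [h2] with z hz hzc
      have h3 : bd φ z.1 ∈ F.circ t := by rw [hcirc]; exact hsub (bd_mem φ _)
      have h4 := F.mem_cir_of_mem_circ h3
      have h5 : z.2 = 0 := by
        refine (hm z.1 hz.1).injOn (abs_lt.1 hz.2) ⟨by linarith, hδ⟩ ?_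
        rw [F.fermi_zero]
        exact (mem_cir.1 hzc).trans (mem_cir.1 h4.1).symm
      have h6 : F.fermi z = f (bd φ z.1) := by
        rw [← F.fermi_zero, ← h5]
      rw [h6, h4.2]
      exact bd_mem φ _
    filter_upwards [F.isTopImmersion.1.continuousAt.eventually h1] with m hm hmc
    rw [← hcirc t] at hmc
    have := F.mem_cir_of_mem_circ hmc
    rw [← this.2]
    exact hm this.1
  have hpre : IsPreconnected (F.circ θ) :=
    (isPreconnected_cir (F.norm_normal θ) (F.inner_normal_curve θ) _).image _ (hlift θ).1
  have heq : F.circ θ ⊆ bdry h := by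
    by_contra hns
    obtain ⟨q, hq, hqb⟩ := not_subset.1 hns
    obtain ⟨m, hm, hm1, hm2⟩ := hpre {m | ∀ᶠ m' in 𝓝 m, m' ∈ F.circ θ → m' ∈ bdry h}
      (bdry h)ᶜ (isOpen_setOfPred_eventually_nhds) (isClosed_bdry h).isOpen_compl
      (fun m hm => by
        by_cases hb : m ∈ bdry h
        · exact Or.inl (hloc m hb)
        · exact Or.inr hb)
      ⟨_, F.bd_mem_circ θ, hloc _ (bd_mem φ θ)⟩ ⟨q, hq, hqb⟩
    have hm1' : ∀ᶠ m' in 𝓝 m, m' ∈ F.circ θ → m' ∈ bdry h := hm1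
    exact hm2 (hm1'.self_of_nhds hm)
  exact hM (heq.antisymm hsub ▸ F.isCircle_circ θ)

end InwardFrame

end ImmersedDisk

end

/-! ### Noncrossing partitions of the circle -/

noncomputable section

open Set Filter Topology

namespace ImmersedDisk

/-- The function `q` labels the classes of a noncrossing partition of a circle of length `p` into
closed sets, with at least two classes. -/
structure IsLamination {X : Type*} (q : ℝ → X) (p : ℝ) : Prop where
  pos : 0 < p
  periodic : ∀ x, q (x + p) = q x
  isClosed : ∀ x, IsClosed {y | q y = q x}
  noncrossing : ∀ {a b c d : ℝ}, a < b → b < c → c < d → d < a + p → q c = q a → q d = q b →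
    q a = q b
  exists_ne : ∀ x, ∃ y, q y ≠ q x

/-- The class of `y` is an arc. -/
def IsArc {X : Type*} (q : ℝ → X) (p y : ℝ) : Prop :=
  ∃ c, y ∈ Ioo c (c + p) ∧ q c ≠ q y ∧ OrdConnected {z | z ∈ Ioo c (c + p) ∧ q z = q y}

namespace IsLamination

variable {X : Type*} {q : ℝ → X} {p : ℝ}

/-- Noncrossing confines the class of a point between a and b to that interval, seen within one
period. -/
theorem mem_Ioo_of_eq (L : IsLamination q p) {c a b y z : ℝ} (hca : c ≤ a) (hbc : b ≤ c + p)
    (hab : q a = q b) (hy : y ∈ Ioo a b) (hne : q y ≠ q a) (hz : z ∈ Ioo c (c + p))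
    (e : q z = q y) : z ∈ Ioo a b := by
  constructor
  · by_contra! hza
    rcases hza.eq_or_lt with rfl | hlt
    · exact hne e.symm
    · have := L.noncrossing hlt hy.1 hy.2 (by linarith [hz.1]) e.symm hab.symm
      exact hne (e.symm.trans this)
  · by_contra! hbz
    rcases hbz.eq_or_lt with rfl | hlt
    · exact hne (e.symm.trans hab.symm)
    · exact hne (L.noncrossing hy.1 hy.2 hlt (by linarith [hz.2]) hab.symm e).symm

theorem exists_gap (L : IsLamination q p) {c d x : ℝ} (hcd : q c = q d) (hx : x ∈ Ioo c d)
    (hne : q x ≠ q c) : ∃ a b, c ≤ a ∧ a < x ∧ x < b ∧ b ≤ d ∧ q a = q c ∧ q b = q c ∧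
      ∀ z ∈ Ioo a b, q z ≠ q c := by
  have hS := L.isClosed c
  have k1 : IsCompact ({y | q y = q c} ∩ Icc c x) := isCompact_Icc.inter_left hS
  have k2 : IsCompact ({y | q y = q c} ∩ Icc x d) := isCompact_Icc.inter_left hS
  have m1 := k1.sSup_mem ⟨c, rfl, le_rfl, hx.1.le⟩
  have m2 := k2.sInf_mem ⟨d, hcd.symm, hx.2.le, le_rfl⟩
  set a := sSup ({y | q y = q c} ∩ Icc c x)
  set b := sInf ({y | q y = q c} ∩ Icc x d)
  have qa : q a = q c := m1.1
  have qb : q b = q c := m2.1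
  refine ⟨a, b, m1.2.1, lt_of_le_of_ne m1.2.2 fun e => hne (e ▸ qa),
    lt_of_le_of_ne m2.2.1 fun e => hne (e ▸ qb), m2.2.2, qa, qb, fun z hz e => ?_⟩
  rcases le_total z x with h1 | h1
  · exact absurd (le_csSup k1.bddAbove ⟨e, m1.2.1.trans hz.1.le, h1⟩) (not_le.2 hz.1)
  · exact absurd (csInf_le k2.bddBelow ⟨e, h1, hz.2.le.trans m2.2.2⟩) (not_le.2 hz.2)

/-- The class of the midpoint m of a gap is not an arc, so two of its members s < u enclose a point
t of another class. According to the side of m on which t lies, the pair s, m or m, u encloses t and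
fits into half of the gap. -/
theorem exists_half (L : IsLamination q p) {c d x : ℝ} (hdc : d ≤ c + p) (hcd : q c = q d)
    (hx : x ∈ Ioo c d) (hne : q x ≠ q c) (harc : ∀ y ∈ Ioo c d, q y ≠ q c → ¬ IsArc q p y) :
    ∃ a b, c < a ∧ a < b ∧ b < d ∧ q a = q b ∧ (∃ x' ∈ Ioo a b, q x' ≠ q a) ∧
      b - a ≤ (d - c) / 2 ∧ ∀ z ∈ Icc a b, q z ≠ q c := by
  obtain ⟨a, b, hca, hax, hxb, hbd, qa, qb, hgap⟩ := L.exists_gap hcd hx hne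
  have hm : (a + b) / 2 ∈ Ioo a b := ⟨by linarith, by linarith⟩
  set m := (a + b) / 2 with hmdef
  have hqm := hgap m hm
  have hn := harc m ⟨by linarith [hm.1], by linarith [hm.2]⟩ hqm
  have hn2 : ¬ OrdConnected {z | z ∈ Ioo c (c + p) ∧ q z = q m} := fun ho =>
    hn ⟨c, ⟨by linarith [hm.1], by linarith [hm.2]⟩, hqm.symm, ho⟩
  rw [ordConnected_iff] at hn2
  push Not at hn2
  obtain ⟨s, hs, u, hu, hsu, hns⟩ := hn2
  obtain ⟨t, ht, htn⟩ := not_subset.1 hns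
  have hqt : q t ≠ q m := fun e => htn ⟨⟨hs.1.1.trans_le ht.1, ht.2.trans_lt hu.1.2⟩, e⟩
  have hs' := L.mem_Ioo_of_eq hca (hbd.trans hdc) (qa.trans qb.symm) hm (by rwa [qa]) hs.1 hs.2
  have hu' := L.mem_Ioo_of_eq hca (hbd.trans hdc) (qa.trans qb.symm) hm (by rwa [qa]) hu.1 hu.2
  have hst : s < t := lt_of_le_of_ne ht.1 fun e => hqt (e ▸ hs.2)
  have htu : t < u := lt_of_le_of_ne ht.2 fun e => hqt (e ▸ hu.2)
  rcases lt_trichotomy t m with h1 | h1 | h1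
  · refine ⟨s, m, hca.trans_lt hs'.1, hst.trans h1, hm.2.trans_le hbd, hs.2,
      ⟨t, ⟨hst, h1⟩, by rwa [hs.2]⟩, by linarith [hs'.1],
      fun z hz => hgap z ⟨hs'.1.trans_le hz.1, hz.2.trans_lt hm.2⟩⟩
  · exact absurd (congrArg q h1) hqt
  · refine ⟨m, u, hca.trans_lt hm.1, h1.trans htu, hu'.2.trans_le hbd, hu.2.symm,
      ⟨t, ⟨h1, htu⟩, hqt⟩, by linarith [hu'.2],
      fun z hz => hgap z ⟨hm.1.trans_le hz.1, hz.2.trans_lt hu'.2⟩⟩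

/-- Every gap of a class contains a class that is an arc. -/
theorem exists_isArc (L : IsLamination q p) {c d x : ℝ} (hdc : d ≤ c + p) (hcd : q c = q d)
    (hx : x ∈ Ioo c d) (hne : q x ≠ q c) : ∃ y ∈ Ioo c d, q y ≠ q c ∧ IsArc q p y := by
  by_contra! hno
  let P : ℝ × ℝ → Prop := fun r => c ≤ r.1 ∧ r.2 ≤ d ∧ q r.1 = q r.2 ∧
    (∃ x' ∈ Ioo r.1 r.2, q x' ≠ q r.1) ∧ ∀ y ∈ Ioo r.1 r.2, q y ≠ q r.1 → ¬ IsArc q p y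
  have hstep : ∀ r : {r // P r}, ∃ r' : {r // P r}, r.1.1 < r'.1.1 ∧ r'.1.2 < r.1.2 ∧
      r'.1.2 - r'.1.1 ≤ (r.1.2 - r.1.1) / 2 ∧ ∀ z ∈ Icc r'.1.1 r'.1.2, q z ≠ q r.1.1 := by
    rintro ⟨⟨a, b⟩, h1, h2, h3, ⟨x', hx', hne'⟩, h5⟩
    obtain ⟨a', b', g1, g2, g3, g4, g5, g6, g7⟩ := L.exists_half (h2.trans (by linarith)) h3 hx'
      hne' h5
    exact ⟨⟨(a', b'), h1.trans g1.le, g3.le.trans h2, g4, g5, fun y hy _ =>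
      h5 y ⟨g1.trans hy.1, hy.2.trans g3⟩ (g7 y ⟨hy.1.le, hy.2.le⟩)⟩, g1, g3, g6, g7⟩
  choose g hg1 hg2 hg3 hg4 using hstep
  -- Iterated halving gives strictly nested intervals whose lengths tend to 0. The class of the
  -- common point z is confined to all of them, so it is a single point within the period, which is
  -- an arc.
  let r : ℕ → {r // P r} := fun n => g^[n] ⟨(c, d), le_rfl, le_rfl, hcd, ⟨x, hx, hne⟩, hno⟩
  have hr : ∀ n, r (n + 1) = g (r n) := fun n => Function.iterate_succ_apply' g n _
  have hmono : StrictMono fun n => (r n).1.1 := strictMono_nat_of_lt_succ fun n => by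
    rw [hr]; exact hg1 _
  have hanti : StrictAnti fun n => (r n).1.2 := strictAnti_nat_of_succ_lt fun n => by
    rw [hr]; exact hg2 _
  have hz := mem_iInter.1 (hmono.monotone.ciSup_mem_iInter_Icc_of_antitone hanti.antitone
    fun n => by obtain ⟨x', hx', -⟩ := (r n).2.2.2.2.1; exact (hx'.1.trans hx'.2).le)
  set z := ⨆ n, (r n).1.1
  have hzI : ∀ n, z ∈ Ioo (r n).1.1 (r n).1.2 := fun n =>
    ⟨(hmono n.lt_succ_self).trans_le (hz (n + 1)).1, (hz (n + 1)).2.trans_lt (hanti n.lt_succ_self)⟩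
  have hzq : ∀ n, q z ≠ q (r n).1.1 := fun n => hg4 (r n) z (by rw [← hr]; exact hz (n + 1))
  have hlen : ∀ n, (r n).1.2 - (r n).1.1 ≤ (d - c) * (1 / 2) ^ n := by
    intro n
    induction n with
    | zero => simp [r]
    | succ n ih =>
      rw [hr, pow_succ]
      exact (hg3 _).trans (by linarith)
  have hsingle : ∀ w ∈ Ioo c (c + p), q w = q z → w = z := by
    intro w hw e
    have hwI : ∀ n, w ∈ Ioo (r n).1.1 (r n).1.2 := fun n =>
      L.mem_Ioo_of_eq (r n).2.1 ((r n).2.2.1.trans hdc) (r n).2.2.2.1 (hzI n) (hzq n) hw e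
    have hlim : Tendsto (fun n : ℕ => (d - c) * (1 / 2 : ℝ) ^ n) atTop (𝓝 0) := by
      simpa using (tendsto_pow_atTop_nhds_zero_of_lt_one (r := (1 / 2 : ℝ)) (by norm_num)
        (by norm_num)).const_mul (d - c)
    have habs : |w - z| ≤ 0 := ge_of_tendsto' hlim fun n => by
      refine le_trans ?_ (hlen n)
      rw [abs_le]
      constructor <;> linarith [(hwI n).1, (hwI n).2, (hzI n).1, (hzI n).2]
    exact sub_eq_zero.1 (abs_nonpos_iff.1 habs)
  have hz0 : z ∈ Ioo c d := hzI 0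
  have hzc : q z ≠ q c := hzq 0
  have hzp : z ∈ Ioo c (c + p) := ⟨hz0.1, hz0.2.trans_le hdc⟩
  have hset : {w | w ∈ Ioo c (c + p) ∧ q w = q z} = {z} := by
    ext w
    exact ⟨fun hw => hsingle w hw.1 hw.2, fun hw => by
      rw [mem_singleton_iff] at hw; rw [hw]; exact ⟨hzp, rfl⟩⟩
  exact hno z hz0 hzc ⟨c, hzp, hzc.symm, by rw [hset]; exact ordConnected_singleton⟩

theorem exists_isArc_pair (L : IsLamination q p) : ∃ y y', IsArc q p y ∧ IsArc q p y' ∧ q y ≠ q y' := by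
  have key : ∀ c, ∃ y, q y ≠ q c ∧ IsArc q p y := by
    intro c
    obtain ⟨x, hx⟩ := L.exists_ne c
    have hper : Function.Periodic q p := L.periodic
    obtain ⟨x', hx', e⟩ := hper.exists_mem_Ico L.pos x c
    rw [e] at hx
    have hcx : c < x' := lt_of_le_of_ne hx'.1 fun e => hx (by rw [e])
    obtain ⟨y, -, h1, h2⟩ := L.exists_isArc le_rfl (L.periodic c).symm ⟨hcx, hx'.2⟩ hx
    exact ⟨y, h1, h2⟩
  obtain ⟨y, -, hy⟩ := key 0
  obtain ⟨y', hne, hy'⟩ := key y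
  exact ⟨y, y', hy, hy', hne.symm⟩

end IsLamination

/-- Counting gaps of finitely many noncrossing finite sets. -/
theorem sum_card_sub_two_add_two_le {ι : Type*} [DecidableEq ι] (E : ι → Finset ℝ) (n : ℕ) :
    ∀ (A : Finset ι) (S : Finset ℝ), A.card = n → 2 ≤ S.card →
      (∀ i ∈ A, 2 ≤ (E i).card) →
      (∀ i ∈ A, ∀ c ∈ E i, ∀ d ∈ E i, c < d → ∃ s ∈ S, c < s ∧ s < d) →
      (∀ i ∈ A, ∃ s ∈ S, (∀ e ∈ E i, s < e) ∨ (∀ e ∈ E i, e < s)) →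
      (∀ i ∈ A, ∀ j ∈ A, i ≠ j → Disjoint (E i) (E j)) →
      (∀ i ∈ A, ∀ j ∈ A, i ≠ j → ∀ a ∈ E i, ∀ b ∈ E j, ∀ c ∈ E i, ∀ d ∈ E j,
        ¬ (a < b ∧ b < c ∧ c < d)) →
      ∑ i ∈ A, ((E i).card - 2) + 2 ≤ S.card := by
  induction n with
  | zero =>
    intro A S hA hS _ _ _ _ _
    rw [Finset.card_eq_zero.1 hA]
    simpa using hS
  | succ n ih =>
    intro A S hA hS hE hin hout hdis hnc
    have hAne : A.Nonempty := Finset.card_pos.1 (by omega)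
    have hne : ∀ i ∈ A, (E i).Nonempty := fun i hi => Finset.card_pos.1 (by have := hE i hi; omega)
    let lo : ι → ℝ := fun i => sInf (E i : Set ℝ)
    let hi : ι → ℝ := fun i => sSup (E i : Set ℝ)
    have hlo : ∀ i ∈ A, lo i ∈ E i := fun i hi => (hne i hi).csInf_mem
    have hhi : ∀ i ∈ A, hi i ∈ E i := fun i hi => (hne i hi).csSup_mem
    have lole : ∀ i, ∀ e ∈ E i, lo i ≤ e := fun i e he => csInf_le (E i).finite_toSet.bddBelow he
    have lehi : ∀ i, ∀ e ∈ E i, e ≤ hi i := fun i e he => le_csSup (E i).finite_toSet.bddAbove he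
    -- A set of shortest span is innermost: by noncrossing, a set with a point inside this span
    -- would have a shorter one.
    obtain ⟨i₀, hi₀, hmin⟩ := A.exists_min_image (fun i => hi i - lo i) hAne
    have hfree : ∀ j ∈ A, j ≠ i₀ → ∀ b ∈ E j, b < lo i₀ ∨ hi i₀ < b := by
      intro j hj hji b hb
      by_contra! hc
      have hb1 : lo i₀ < b := lt_of_le_of_ne hc.1 fun e =>
        Finset.disjoint_left.1 (hdis j hj i₀ hi₀ hji) hb (e ▸ hlo i₀ hi₀)
      have hb2 : b < hi i₀ := lt_of_le_of_ne hc.2 fun e =>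
        Finset.disjoint_left.1 (hdis j hj i₀ hi₀ hji) hb (e ▸ hhi i₀ hi₀)
      have h1 : hi j ≤ hi i₀ := by
        by_contra! h1
        exact hnc i₀ hi₀ j hj hji.symm _ (hlo i₀ hi₀) _ hb _ (hhi i₀ hi₀) _ (hhi j hj) ⟨hb1, hb2, h1⟩
      have h2 : lo i₀ ≤ lo j := by
        by_contra! h2
        exact hnc j hj i₀ hi₀ hji _ (hlo j hj) _ (hlo i₀ hi₀) _ hb _ (hhi i₀ hi₀) ⟨h2, hb1, hb2⟩
      have h3 : lo j ≠ lo i₀ := fun e =>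
        Finset.disjoint_left.1 (hdis j hj i₀ hi₀ hji) (hlo j hj) (e ▸ hlo i₀ hi₀)
      have h4 := hmin j hj
      have h5 := lt_of_le_of_ne h2 h3.symm
      linarith
    -- The innermost set is removed and the points of S in its span are merged into the single
    -- marker `lo i₀`. The merged points number at least `(E i₀).card - 1`, and the marker still
    -- separates whatever they separated in the other sets.
    let H := S.filter fun s => lo i₀ ≤ s ∧ s ≤ hi i₀
    let S' := insert (lo i₀) (S.filter fun s => ¬ (lo i₀ ≤ s ∧ s ≤ hi i₀))
    have hle : lo i₀ ≤ hi i₀ := lole _ _ (hhi i₀ hi₀)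
    have hH : (E i₀).card ≤ H.card + 1 := by
      refine Finset.card_le_of_interleaved fun x hx y hy hxy _ => ?_
      obtain ⟨s, hs, h1, h2⟩ := hin i₀ hi₀ x hx y hy hxy
      exact ⟨s, Finset.mem_filter.2 ⟨hs, (lole _ _ hx).trans h1.le, h2.le.trans (lehi _ _ hy)⟩, h1, h2⟩
    have hcard : H.card + (S.filter fun s => ¬ (lo i₀ ≤ s ∧ s ≤ hi i₀)).card = S.card :=
      Finset.card_filter_add_card_filter_not _
    have hS'card : S'.card = (S.filter fun s => ¬ (lo i₀ ≤ s ∧ s ≤ hi i₀)).card + 1 :=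
      Finset.card_insert_of_notMem fun hm => (Finset.mem_filter.1 hm).2 ⟨le_rfl, hle⟩
    have hmem : ∀ s ∈ S, (lo i₀ ≤ s ∧ s ≤ hi i₀) ∨ s ∈ S' := fun s hs => by
      by_cases hc : lo i₀ ≤ s ∧ s ≤ hi i₀
      · exact Or.inl hc
      · exact Or.inr (Finset.mem_insert_of_mem (Finset.mem_filter.2 ⟨hs, hc⟩))
    have hlo' : lo i₀ ∈ S' := Finset.mem_insert_self _ _
    have hS' : 2 ≤ S'.card := by
      obtain ⟨s, hs, h1⟩ := hout i₀ hi₀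
      have : 0 < (S.filter fun s => ¬ (lo i₀ ≤ s ∧ s ≤ hi i₀)).card := by
        refine Finset.card_pos.2 ⟨s, Finset.mem_filter.2 ⟨hs, fun hc => ?_⟩⟩
        rcases h1 with h1 | h1
        · exact absurd (h1 _ (hlo i₀ hi₀)) (not_lt.2 hc.1)
        · exact absurd (h1 _ (hhi i₀ hi₀)) (not_lt.2 hc.2)
      omega
    have hA' : ∀ i ∈ A.erase i₀, i ∈ A := fun i hi => Finset.mem_of_mem_erase hi
    have := ih (A.erase i₀) S' (by rw [Finset.card_erase_of_mem hi₀, hA]; rfl) hS'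
      (fun i hi => hE i (hA' i hi))
      (fun i hi c hc d hd hcd => by
        obtain ⟨s, hs, h1, h2⟩ := hin i (hA' i hi) c hc d hd hcd
        rcases hmem s hs with h3 | h3
        · refine ⟨_, hlo', ?_, h3.1.trans_lt h2⟩
          exact (hfree i (hA' i hi) (Finset.ne_of_mem_erase hi) c hc).resolve_right
            (not_lt.2 (h1.le.trans h3.2))
        · exact ⟨s, h3, h1, h2⟩)
      (fun i hi => by
        obtain ⟨s, hs, h1⟩ := hout i (hA' i hi)
        rcases hmem s hs with h3 | h3
        · refine ⟨_, hlo', h1.imp (fun h1 e he => h3.1.trans_lt (h1 e he)) fun h1 e he => ?_⟩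
          exact (hfree i (hA' i hi) (Finset.ne_of_mem_erase hi) e he).resolve_right
            (not_lt.2 ((h1 e he).le.trans h3.2))
        · exact ⟨s, h3, h1⟩)
      (fun i hi j hj => hdis i (hA' i hi) j (hA' j hj))
      (fun i hi j hj => hnc i (hA' i hi) j (hA' j hj))
    rw [← Finset.add_sum_erase _ _ hi₀]
    have h2 := hE i₀ hi₀
    omega

namespace IsLamination

variable {X : Type*} {q : ℝ → X} {p : ℝ}

/-- The number of gaps of finitely many classes is bounded by the number of arcs. -/
theorem sum_card_le (L : IsLamination q p) (A : Finset X) (E : X → Finset ℝ) (Y : Finset X)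
    (hY : ∀ y, IsArc q p y → q y ∈ Y) (hE : ∀ C ∈ A, 2 ≤ (E C).card)
    (hEq : ∀ C ∈ A, ∀ e ∈ E C, e ∈ Ico 0 p ∧ q e = C)
    (hsep : ∀ C ∈ A, ∀ s ∈ E C, ∀ t ∈ E C, s < t →
      (∃ x ∈ Ioo s t, q x ≠ C) ∧ ∃ x ∈ Ioo t (s + p), q x ≠ C) :
    ∑ C ∈ A, ((E C).card - 2) + 2 ≤ Y.card := by
  classical
  have hper : Function.Periodic q p := L.periodic
  -- One representative in `[0, p)` for each arc class; the value 0 for other labels is never used.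
  have hrep : ∀ C : X, ∃ s : ℝ, (∃ y, IsArc q p y ∧ q y = C) → s ∈ Ico 0 p ∧ q s = C := by
    intro C
    by_cases hC : ∃ y, IsArc q p y ∧ q y = C
    · obtain ⟨y, -, rfl⟩ := hC
      obtain ⟨s, hs, e⟩ := hper.exists_mem_Ico₀ L.pos y
      exact ⟨s, fun _ => ⟨hs, e.symm⟩⟩
    · exact ⟨0, fun hc => absurd hc hC⟩
  choose rep hrep using hrep
  let S : Finset ℝ := Y.image rep
  have hS : ∀ y, IsArc q p y → rep (q y) ∈ S ∧ rep (q y) ∈ Ico 0 p ∧ q (rep (q y)) = q y :=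
    fun y hy => ⟨Finset.mem_image_of_mem _ (hY y hy), hrep _ ⟨y, hy, rfl⟩⟩
  refine le_trans ?_ (Finset.card_image_le (s := Y) (f := rep))
  refine sum_card_sub_two_add_two_le E A.card A S rfl ?_ hE ?_ ?_ ?_ ?_
  · obtain ⟨y, y', hy, hy', hne⟩ := L.exists_isArc_pair
    refine Finset.one_lt_card.2 ⟨_, (hS y hy).1, _, (hS y' hy').1, fun e => hne ?_⟩
    rw [← (hS y hy).2.2, e, (hS y' hy').2.2]
  · intro C hC c hc d hd hcd
    have h1 := hEq C hC c hc
    have h2 := hEq C hC d hd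
    obtain ⟨x, hx, hxC⟩ := (hsep C hC c hc d hd hcd).1
    have hdc : d ≤ c + p := by linarith [h1.1.1, h2.1.2]
    obtain ⟨y, hy, hyc, harc⟩ := L.exists_isArc hdc (h1.2.trans h2.2.symm) hx (by rwa [h1.2])
    obtain ⟨g1, g2, g3⟩ := hS y harc
    refine ⟨_, g1, ?_⟩
    set s := rep (q y)
    rcases lt_trichotomy s c with h3 | h3 | h3
    -- A representative below c would recur at `s + p`, which would have to lie in the gap although
    -- `d < p ≤ s + p`.
    · have := L.mem_Ioo_of_eq le_rfl hdc (h1.2.trans h2.2.symm) hy hyc (z := s + p)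
        ⟨by linarith [g2.1, h1.1.2], by linarith⟩ (by rw [L.periodic, g3])
      linarith [this.2, g2.1, h2.1.2]
    · rw [← h3, g3] at hyc; exact absurd rfl hyc
    · exact L.mem_Ioo_of_eq le_rfl hdc (h1.2.trans h2.2.symm) hy hyc (z := s)
        ⟨h3, by linarith [g2.2, h1.1.1]⟩ g3
  · intro C hC
    have hne : (E C).Nonempty := Finset.card_pos.1 (by have := hE C hC; omega)
    have hlt : (E C).min' hne < (E C).max' hne := Finset.min'_lt_max'_of_card _ (hE C hC)
    have hm := (E C).min'_mem hne
    have hM := (E C).max'_mem hne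
    have lole := fun e he => (E C).min'_le e he
    have lehi := fun e he => (E C).le_max' e he
    set m := (E C).min' hne
    set m' := (E C).max' hne
    have h1 := hEq C hC m hm
    have h2 := hEq C hC m' hM
    obtain ⟨x, hx, hxC⟩ := (hsep C hC m hm m' hM hlt).2
    have hq : q m' = q (m + p) := by rw [L.periodic, h1.2, h2.2]
    obtain ⟨y, hy, hyc, harc⟩ := L.exists_isArc (by linarith) hq hx (by rwa [h2.2])
    obtain ⟨g1, g2, g3⟩ := hS y harc
    refine ⟨_, g1, ?_⟩
    set s := rep (q y)
    rcases lt_trichotomy s m' with h3 | h3 | h3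
    -- The outer gap wraps around the end of the period. A representative below `m'` has its
    -- translate `s + p` in that gap, so s precedes the whole set.
    · have := L.mem_Ioo_of_eq le_rfl (by linarith) hq hy hyc (z := s + p)
        ⟨by linarith [g2.1, h2.1.2], by linarith⟩ (by rw [L.periodic, g3])
      exact Or.inl fun e he => by linarith [this.2, lole e he]
    · rw [← h3, g3] at hyc; exact absurd rfl hyc
    · exact Or.inr fun e he => (lehi e he).trans_lt h3
  · intro C hC D hD hne
    refine Finset.disjoint_left.2 fun e he he' => hne ?_
    rw [← (hEq C hC e he).2, (hEq D hD e he').2]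
  · rintro C hC D hD hne a ha b hb c hc d hd ⟨hab, hbc, hcd⟩
    have a1 := hEq C hC a ha
    have b1 := hEq D hD b hb
    have c1 := hEq C hC c hc
    have d1 := hEq D hD d hd
    refine hne ?_
    rw [← a1.2, ← b1.2]
    exact L.noncrossing hab hbc hcd (by linarith [a1.1.1, d1.1.2]) (c1.2.trans a1.2.symm)
      (d1.2.trans b1.2.symm)

end IsLamination

end ImmersedDisk

end

/-! ### Counting singular circles -/

noncomputable section

open Set Filter Topology

namespace ImmersedDisk

namespace InwardFrame

variable {M : Type*} [TopologicalSpace M] {h : M ≃ₜ UnitDisk}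
variable {f : M → S2} {φ : Circle ≃ₜ bdry h} {γ' N : ℝ → E3} {κ : ℝ → ℝ}
variable [T2Space M] [CompactSpace M]

theorem bd_mem_circ_iff (F : InwardFrame f φ γ' N κ) {θ t : ℝ} :
    bd φ t ∈ F.circ θ ↔ F.circ t = F.circ θ :=
  ⟨F.circ_eq_of_mem, fun e => e ▸ F.bd_mem_circ t⟩

theorem isLamination (F : InwardFrame f φ γ' N κ) (hM : ¬ IsCircle f (bdry h)) :
    IsLamination F.circ (2 * Real.pi) where
  pos := Real.two_pi_pos
  periodic θ := F.circ_eq_of_mem (by rw [bd_periodic]; exact F.bd_mem_circ θ)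
  isClosed θ := by
    have : {t | F.circ t = F.circ θ} = bd φ ⁻¹' F.circ θ := by
      ext t; exact F.bd_mem_circ_iff.symm
    rw [this]
    exact (F.isCircle_circ θ).1.preimage (continuous_bd φ)
  noncrossing hab hbc hcd hda hca hdb := F.circ_eq_of_interlaced hab hbc hcd hda
    (F.bd_mem_circ_iff.2 hca) (F.bd_mem_circ_iff.2 hdb)
  exists_ne θ := by
    obtain ⟨m, hm, hmc⟩ := not_subset.1 (F.not_bdry_subset_circ hM θ)
    obtain ⟨t, -, rfl⟩ := exists_bd_eq φ hm 0
    exact ⟨t, fun e => hmc (F.bd_mem_circ_iff.2 e)⟩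

theorem isSingular_of_isArc (F : InwardFrame f φ γ' N κ) {θ : ℝ}
    (hθ : IsArc F.circ (2 * Real.pi) θ) : IsSingular h (F.circ θ) := by
  obtain ⟨c, hc, hne, ho⟩ := hθ
  refine ⟨⟨_, F.bd_mem_circ θ, bd_mem φ θ⟩, ?_⟩
  have : F.circ θ ∩ bdry h = bd φ '' {z | z ∈ Ioo c (c + 2 * Real.pi) ∧ F.circ z = F.circ θ} := by
    ext m
    constructor
    · rintro ⟨h1, h2⟩
      obtain ⟨t, ht, rfl⟩ := exists_bd_eq φ h2 c
      have e := F.bd_mem_circ_iff.1 h1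
      exact ⟨t, ⟨⟨lt_of_le_of_ne ht.1 fun h3 => hne (h3 ▸ e), ht.2⟩, e⟩, rfl⟩
    · rintro ⟨t, ⟨-, e⟩, rfl⟩
      exact ⟨F.bd_mem_circ_iff.2 e, bd_mem φ t⟩
  rw [this]
  exact ho.isPreconnected.image _ (continuous_bd φ).continuousOn

/-- The parameter of a point of the component lies in a gap of the class of C. The image of the gap
stays in the component, and the gap contains a class that is an arc. -/
theorem exists_singular_mem (F : InwardFrame f φ γ' N κ) (hM : ¬ IsCircle f (bdry h)) {C : Set M}
    (hC : IsMaximalCircle h f C) {I : Set M} (hI : I ∈ componentsOf (bdry h \ C)) :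
    ∃ p ∈ I, ∃ C' : Set M, IsMaximalCircleAt h f p C' ∧ IsSingular h C' := by
  obtain ⟨θ, rfl⟩ := F.isMaximalCircle_iff.1 hC
  obtain ⟨m, ⟨hm, hmC⟩, rfl⟩ := hI
  obtain ⟨x, hx, rfl⟩ := exists_bd_eq φ hm θ
  have L := F.isLamination hM
  have hxq : F.circ x ≠ F.circ θ := fun e => hmC (F.bd_mem_circ_iff.2 e)
  have hθx : θ < x := lt_of_le_of_ne hx.1 fun e => hxq (by rw [e])
  obtain ⟨a, b, h1, h2, h3, h4, qa, qb, hgap⟩ := L.exists_gap (L.periodic θ).symm ⟨hθx, hx.2⟩ hxq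
  obtain ⟨y, hy, -, harc⟩ := L.exists_isArc (by linarith) (qa.trans qb.symm) ⟨h2, h3⟩
    (by rwa [qa])
  refine ⟨bd φ y, ?_, _, F.isMaximalCircleAt_circ y, F.isSingular_of_isArc harc⟩
  have hpre : IsPreconnected (bd φ '' Ioo a b) :=
    isPreconnected_Ioo.image _ (continuous_bd φ).continuousOn
  refine hpre.subset_connectedComponentIn ⟨x, ⟨h2, h3⟩, rfl⟩ ?_ ⟨y, hy, rfl⟩
  rintro _ ⟨t, ht, rfl⟩
  exact ⟨bd_mem φ t, fun hc => hgap t ht (F.bd_mem_circ_iff.1 hc)⟩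

theorem connectedComponentIn_eq_of_forall (F : InwardFrame f φ γ' N κ) {θ s t : ℝ} (hst : s ≤ t)
    (hall : ∀ x ∈ Icc s t, F.circ x = F.circ θ) :
    connectedComponentIn (F.circ θ ∩ bdry h) (bd φ s) =
      connectedComponentIn (F.circ θ ∩ bdry h) (bd φ t) := by
  have hpre : IsPreconnected (bd φ '' Icc s t) :=
    isPreconnected_Icc.image _ (continuous_bd φ).continuousOn
  refine connectedComponentIn_eq (hpre.subset_connectedComponentIn
    ⟨s, left_mem_Icc.2 hst, rfl⟩ ?_ ⟨t, right_mem_Icc.2 hst, rfl⟩)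
  rintro _ ⟨x, hx, rfl⟩
  exact ⟨F.bd_mem_circ_iff.2 (hall x hx), bd_mem φ x⟩

/-- One parameter is chosen in each of n contact components. If an arc between two of them stayed on
the circle, the two components would coincide. -/
theorem exists_finset_of_le_rank (F : InwardFrame f φ γ' N κ) {C : Set M}
    (hC : IsMaximalCircle h f C) {n : ℕ} (hn : (n : ℕ∞) ≤ rank h C) :
    ∃ E : Finset ℝ, E.card = n ∧ (∀ e ∈ E, e ∈ Ico 0 (2 * Real.pi) ∧ F.circ e = C) ∧
      ∀ s ∈ E, ∀ t ∈ E, s < t → (∃ x ∈ Ioo s t, F.circ x ≠ C) ∧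
        ∃ x ∈ Ioo t (s + 2 * Real.pi), F.circ x ≠ C := by
  classical
  obtain ⟨θ, rfl⟩ := F.isMaximalCircle_iff.1 hC
  obtain ⟨T, hT, hTn⟩ := exists_subset_encard_eq hn
  have hTfin : T.Finite := finite_of_encard_eq_coe hTn
  have hex : ∀ K : Set M, ∃ r : ℝ, K ∈ T → r ∈ Ico 0 (2 * Real.pi) ∧ F.circ r = F.circ θ ∧
      K = connectedComponentIn (F.circ θ ∩ bdry h) (bd φ r) := by
    intro K
    by_cases hK : K ∈ T
    · obtain ⟨m, ⟨hm, hmb⟩, rfl⟩ := hT hK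
      obtain ⟨r, hr, rfl⟩ := exists_bd_eq φ hmb 0
      rw [zero_add] at hr
      exact ⟨r, fun _ => ⟨hr, F.bd_mem_circ_iff.1 hm, rfl⟩⟩
    · exact ⟨0, fun hc => absurd hc hK⟩
  choose r hr using hex
  have hinj : ∀ K ∈ T, ∀ K' ∈ T, connectedComponentIn (F.circ θ ∩ bdry h) (bd φ (r K)) =
      connectedComponentIn (F.circ θ ∩ bdry h) (bd φ (r K')) → K = K' := fun K hK K' hK' e => by
    rw [(hr K hK).2.2, e, ← (hr K' hK').2.2]
  refine ⟨hTfin.toFinset.image r, ?_, ?_, ?_⟩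
  · rw [Finset.card_image_of_injOn]
    · rw [hTfin.encard_eq_coe_toFinset_card] at hTn
      exact_mod_cast hTn
    · intro K hK K' hK' e
      exact hinj K (by simpa using hK) K' (by simpa using hK') (by rw [e])
  · intro e he
    obtain ⟨K, hK, rfl⟩ := Finset.mem_image.1 he
    have := hr K (hTfin.mem_toFinset.1 hK)
    exact ⟨this.1, this.2.1⟩
  · intro s hs t ht hst
    obtain ⟨K, hK, rfl⟩ := Finset.mem_image.1 hs
    obtain ⟨K', hK', rfl⟩ := Finset.mem_image.1 ht
    rw [hTfin.mem_toFinset] at hK hK'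
    have g := hr K hK
    have g' := hr K' hK'
    constructor
    · by_contra! hc
      refine hst.ne (congrArg r (hinj K hK K' hK'
        (F.connectedComponentIn_eq_of_forall hst.le fun x hx => ?_)))
      rcases hx.1.eq_or_lt with rfl | h1
      · exact g.2.1
      rcases hx.2.eq_or_lt with rfl | h2
      · exact g'.2.1
      exact hc x ⟨h1, h2⟩
    · by_contra! hc
      have hlt : r K' ≤ r K + 2 * Real.pi := by linarith [g.1.1, g'.1.2]
      have := F.connectedComponentIn_eq_of_forall (θ := θ) hlt fun x hx => by
        rcases hx.1.eq_or_lt with rfl | h1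
        · exact g'.2.1
        rcases hx.2.eq_or_lt with rfl | h2
        · rw [← g.2.1]
          exact F.circ_eq_of_mem (by rw [bd_periodic]; exact F.bd_mem_circ _)
        exact hc x ⟨h1, h2⟩
      rw [bd_periodic] at this
      exact hst.ne (congrArg r (hinj K' hK' K hK this)).symm

/-- Lower bounds n for the ranks are used in place of the ranks themselves, so that the estimate
also excludes infinite rank. -/
theorem sum_rank_le (F : InwardFrame f φ γ' N κ) (hM : ¬ IsCircle f (bdry h)) {S : ℕ}
    (hS : numSingular h f = S) (A : Finset (Set M)) (n : Set M → ℕ)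
    (hA : ∀ C ∈ A, IsMaximalCircle h f C ∧ 2 ≤ n C ∧ (n C : ℕ∞) ≤ rank h C) :
    ∑ C ∈ A, (n C - 2) + 2 ≤ S := by
  classical
  have hfin := finite_of_encard_eq_coe hS
  have hex : ∀ C : Set M, ∃ E : Finset ℝ, C ∈ A → E.card = n C ∧
      (∀ e ∈ E, e ∈ Ico 0 (2 * Real.pi) ∧ F.circ e = C) ∧
      ∀ s ∈ E, ∀ t ∈ E, s < t → (∃ x ∈ Ioo s t, F.circ x ≠ C) ∧
        ∃ x ∈ Ioo t (s + 2 * Real.pi), F.circ x ≠ C := by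
    intro C
    by_cases hC : C ∈ A
    · obtain ⟨E, hE⟩ := F.exists_finset_of_le_rank (hA C hC).1 (hA C hC).2.2
      exact ⟨E, fun _ => hE⟩
    · exact ⟨∅, fun hc => absurd hc hC⟩
  choose E hE using hex
  have := (F.isLamination hM).sum_card_le A E hfin.toFinset
    (fun y hy => hfin.mem_toFinset.2
      ⟨F.isMaximalCircle_iff.2 ⟨y, rfl⟩, F.isSingular_of_isArc hy⟩)
    (fun C hC => by rw [(hE C hC).1]; exact (hA C hC).2.1)
    (fun C hC => (hE C hC).2.1) (fun C hC => (hE C hC).2.2)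
  have hcard : hfin.toFinset.card = S := by
    have h2 := hfin.encard_eq_coe_toFinset_card
    have h3 : ((hfin.toFinset.card : ℕ) : ℕ∞) = S := h2.symm.trans hS
    exact_mod_cast h3
  rw [hcard] at this
  rwa [Finset.sum_congr rfl fun C hC => by rw [(hE C hC).1]] at this

theorem triangularity_add_two_le (F : InwardFrame f φ γ' N κ) (hM : ¬ IsCircle f (bdry h)) :
    triangularity h f + 2 ≤ numSingular h f := by
  by_cases htop : numSingular h f = ⊤
  · rw [htop]; exact le_top
  obtain ⟨S, hS⟩ := ENat.ne_top_iff_exists.1 htop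
  have hsum := F.sum_rank_le hM hS.symm
  have h2 : 2 ≤ S := by simpa using hsum ∅ (fun _ => 0) (by simp)
  have hfinite : ∀ C ∈ triangularCircles h f, rank h C ≠ ⊤ := by
    intro C hC htop
    -- An infinite rank would allow any lower bound; `S + 3` yields `S + 3 ≤ S`.
    have := hsum {C} (fun _ => S + 3) (fun D hD => by
      rw [Finset.mem_singleton] at hD
      subst hD
      exact ⟨hC.1, by omega, by rw [htop]; exact le_top⟩)
    simp at this
    omega
  have htri : triangularity h f ≤ (S - 2 : ℕ) := by
    refine iSup₂_le fun A hA => ?_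
    have h3 := hsum A (fun C => (rank h C).toNat) (fun C hC => by
      have e := ENat.natCast_toNat (hfinite C (hA hC))
      refine ⟨(hA hC).1, ?_, e.le⟩
      have := (hA hC).2
      rw [← e] at this
      have : 3 ≤ (rank h C).toNat := by exact_mod_cast this
      omega)
    have h4 : ∑ C ∈ A, (rank h C - 2) = ((∑ C ∈ A, ((rank h C).toNat - 2) : ℕ) : ℕ∞) := by
      rw [Nat.cast_sum]
      refine Finset.sum_congr rfl fun C hC => ?_
      rw [ENat.natCast_sub, ENat.natCast_toNat (hfinite C (hA hC))]
      rfl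
    rw [h4]
    exact_mod_cast (by omega : ∑ C ∈ A, ((rank h C).toNat - 2) ≤ S - 2)
  calc triangularity h f + 2 ≤ (S - 2 : ℕ) + 2 := by gcongr
    _ = ((S - 2 + 2 : ℕ) : ℕ∞) := by push_cast; rfl
    _ = S := by rw [Nat.sub_add_cancel h2]
    _ = numSingular h f := hS

end InwardFrame

theorem numTriangular_le_triangularity {M : Type*} [TopologicalSpace M] (h : M ≃ₜ UnitDisk)
    (f : M → S2) : numTriangular h f ≤ triangularity h f := by
  by_contra! hlt
  obtain ⟨t, ht⟩ := ENat.ne_top_iff_exists.1 hlt.ne_top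
  rw [← ht] at hlt
  have h1 : ((t + 1 : ℕ) : ℕ∞) ≤ numTriangular h f := by
    push_cast
    exact Order.add_one_le_of_lt hlt
  obtain ⟨T, hT, hTn⟩ := exists_subset_encard_eq h1
  have hfin := finite_of_encard_eq_coe hTn
  have h2 : ∑ C ∈ hfin.toFinset, (rank h C - 2) ≤ triangularity h f :=
    le_iSup₂_of_le (f := fun (A : Finset (Set M)) (_ : (A : Set (Set M)) ⊆ triangularCircles h f) =>
      ∑ C ∈ A, (rank h C - 2)) hfin.toFinset (by rwa [hfin.coe_toFinset]) le_rfl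
  have h3 : ((hfin.toFinset.card : ℕ) : ℕ∞) ≤ ∑ C ∈ hfin.toFinset, (rank h C - 2) := by
    rw [Finset.card_eq_sum_ones, Nat.cast_sum]
    refine Finset.sum_le_sum fun C hC => ?_
    have : 3 ≤ rank h C := (hT (hfin.mem_toFinset.1 hC)).2
    calc ((1 : ℕ) : ℕ∞) = ((3 - 2 : ℕ) : ℕ∞) := rfl
      _ = 3 - 2 := by rw [ENat.natCast_sub]; rfl
      _ ≤ rank h C - 2 := tsub_le_tsub_right this 2
  rw [← hfin.encard_eq_coe_toFinset_card, hTn] at h3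
  rw [← ht] at h2
  have h4 : t + 1 ≤ t := by exact_mod_cast h3.trans h2
  omega

end ImmersedDisk

end

/-! ### Vertices and the curvature at singular circles -/

noncomputable section

open Set Filter Topology

namespace ImmersedDisk

/-- Equal values at two points would force a local extremum between them, so g is injective on the
interval. -/
theorem strictMonoOn_or_strictAntiOn {g : ℝ → ℝ} (hg : Continuous g) {a b : ℝ} (hab : a ≤ b)
    (hext : ∀ t ∈ Ioo a b, ¬ IsLocalExtr g t) :
    StrictMonoOn g (Icc a b) ∨ StrictAntiOn g (Icc a b) := by
  refine hg.continuousOn.strictMonoOn_of_injOn_Icc' hab ?_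
  have key : ∀ x ∈ Icc a b, ∀ y ∈ Icc a b, x < y → g x ≠ g y := fun x hx y hy hxy e => by
    obtain ⟨t, ht, h1⟩ := exists_isLocalExtr_Ioo hxy hg.continuousOn e
    exact hext t ⟨hx.1.trans_lt ht.1, ht.2.trans_le hy.2⟩ h1
  intro x hx y hy e
  rcases lt_trichotomy x y with h | h | h
  · exact absurd e (key x hx y hy h)
  · exact h
  · exact absurd e.symm (key y hy x hx h)

theorem eventually_not_isLocalExtr {g : ℝ → ℝ}
    (hfin : {z : Circle | ∃ θ, Circle.exp θ = z ∧ IsLocalExtr g θ}.Finite) (θ : ℝ) :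
    ∀ᶠ t in 𝓝[≠] θ, ¬ IsLocalExtr g t := by
  have hA : ({t | |t - θ| < 1 ∧ IsLocalExtr g t} : Set ℝ).Finite := by
    refine Finite.of_injOn (f := fun t : ℝ => Circle.exp t)
      (t := {z : Circle | ∃ θ, Circle.exp θ = z ∧ IsLocalExtr g θ}) (fun t ht => ⟨t, rfl, ht.2⟩) ?_ hfin
    intro x hx y hy e
    refine eq_of_circleExp_eq e ?_
    have h1 := abs_lt.1 hx.1
    have h2 := abs_lt.1 hy.1
    have h3 := Real.pi_gt_three
    rw [abs_lt]
    constructor <;> linarith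
  have h1 : ∀ᶠ t in 𝓝 θ, t ∉ ({t | |t - θ| < 1 ∧ IsLocalExtr g t} : Set ℝ) \ {θ} :=
    (hA.subset sdiff_subset).isClosed.isOpen_compl.mem_nhds fun hc => hc.2 rfl
  rw [eventually_nhdsWithin_iff]
  filter_upwards [h1, eventually_abs_sub_lt θ one_pos] with t h2 h3 h4 h5
  exact h2 ⟨⟨h3, h5⟩, h4⟩

theorem exists_strictMono_nhds {g : ℝ → ℝ} (hg : Continuous g)
    (hfin : {z : Circle | ∃ θ, Circle.exp θ = z ∧ IsLocalExtr g θ}.Finite) (θ : ℝ) :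
    ∃ δ > 0, (StrictMonoOn g (Icc θ (θ + δ)) ∨ StrictAntiOn g (Icc θ (θ + δ))) ∧
      (StrictMonoOn g (Icc (θ - δ) θ) ∨ StrictAntiOn g (Icc (θ - δ) θ)) := by
  obtain ⟨δ, hδ, hb⟩ := Metric.eventually_nhds_iff.1
    (eventually_nhdsWithin_iff.1 (eventually_not_isLocalExtr hfin θ))
  refine ⟨δ, hδ, strictMonoOn_or_strictAntiOn hg (by linarith) fun t ht => ?_,
    strictMonoOn_or_strictAntiOn hg (by linarith) fun t ht => ?_⟩
  · refine hb ?_ (ne_of_gt ht.1)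
    rw [Real.dist_eq, abs_lt]
    constructor <;> linarith [ht.1, ht.2]
  · refine hb ?_ (ne_of_lt ht.2)
    rw [Real.dist_eq, abs_lt]
    constructor <;> linarith [ht.1, ht.2]

/-- Between two strict local maxima there is a local minimum. -/
theorem exists_isLocalMin_Ioo {g : ℝ → ℝ} (hg : Continuous g) {a b : ℝ} (hab : a < b)
    (ha : ∀ᶠ t in 𝓝[≠] a, g t < g a) (hb : ∀ᶠ t in 𝓝[≠] b, g t < g b) :
    ∃ m ∈ Ioo a b, IsLocalMin g m := by
  obtain ⟨m, hm, hmin⟩ := isCompact_Icc.exists_isMinOn ⟨a, left_mem_Icc.2 hab.le⟩ hg.continuousOn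
  have h1 : m ≠ a := by
    rintro rfl
    obtain ⟨t, ht, htI⟩ := ((ha.filter_mono (nhdsWithin_mono (s := Ioi m) _ fun x hx => ne_of_gt hx)).and
      (Ioo_mem_nhdsGT hab)).exists
    exact absurd (isMinOn_iff.1 hmin t ⟨htI.1.le, htI.2.le⟩) (not_le.2 ht)
  have h2 : m ≠ b := by
    rintro rfl
    obtain ⟨t, ht, htI⟩ := ((hb.filter_mono (nhdsWithin_mono (s := Iio m) _ fun x hx => ne_of_lt hx)).and
      (Ioo_mem_nhdsLT hab)).exists
    exact absurd (isMinOn_iff.1 hmin t ⟨htI.1.le, htI.2.le⟩) (not_le.2 ht)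
  have hm' : m ∈ Ioo a b := ⟨lt_of_le_of_ne hm.1 h1.symm, lt_of_le_of_ne hm.2 h2⟩
  exact ⟨m, hm', hmin.isLocalMin (Icc_mem_nhds hm'.1 hm'.2)⟩

namespace InwardFrame

variable {M : Type*} [TopologicalSpace M] {h : M ≃ₜ UnitDisk}
variable {f : M → S2} {φ : Circle ≃ₜ bdry h} {γ' N : ℝ → E3} {κ : ℝ → ℝ}
variable [T2Space M] [CompactSpace M]

/-- With finitely many vertices, the boundary has no arc on a maximal circle. -/
theorem exists_circ_ne (F : InwardFrame f φ γ' N κ)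
    (hfin : {z : Circle | ∃ θ, Circle.exp θ = z ∧ IsLocalExtr κ θ}.Finite) {a b : ℝ} (hab : a < b) :
    ∃ x ∈ Ioo a b, F.circ x ≠ F.circ a := by
  by_contra! hall
  have hlev : ∀ x ∈ Ioo a b, F.lev a (F.crit a) (f (bd φ x)) = 0 := fun x hx =>
    mem_cir.1 (F.mem_cir_of_mem_circ (F.bd_mem_circ_iff.2 (hall x hx))).1
  obtain ⟨δ, hδ, hm, -⟩ := exists_strictMono_nhds F.continuous_curvature hfin a
  -- Immediately to the right of a the curvature is strictly monotone, so its difference from `crit`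
  -- has a strict sign. Comparison then puts the boundary strictly off the circle.
  have hsign : ∃ ε > 0, (∀ u ∈ Ioo a (a + ε), F.crit a < κ u) ∨ ∀ u ∈ Ioo a (a + ε), κ u < F.crit a := by
    have hI : ∀ u ∈ Ioo a (a + δ), u ∈ Icc a (a + δ) := fun u hu => ⟨hu.1.le, hu.2.le⟩
    have ha : a ∈ Icc a (a + δ) := ⟨le_rfl, by linarith⟩
    have hnear : ∀ {P : ℝ → Prop}, (∀ᶠ u in 𝓝 a, P u) → ∃ ε > 0, ∀ u ∈ Ioo a (a + ε), P u := by
      intro P hP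
      obtain ⟨ε, hε, hb⟩ := Metric.eventually_nhds_iff.1 hP
      refine ⟨ε, hε, fun u hu => hb ?_⟩
      rw [Real.dist_eq, abs_lt]
      constructor <;> linarith [hu.1, hu.2]
    rcases lt_trichotomy (κ a) (F.crit a) with h1 | h1 | h1
    · obtain ⟨ε, hε, hb⟩ := hnear (F.continuous_curvature.continuousAt.eventually (gt_mem_nhds h1))
      exact ⟨ε, hε, Or.inr hb⟩
    · rcases hm with hm | hm
      · exact ⟨δ, hδ, Or.inl fun u hu => h1 ▸ hm ha (hI u hu) hu.1⟩
      · exact ⟨δ, hδ, Or.inr fun u hu => h1 ▸ hm ha (hI u hu) hu.1⟩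
    · obtain ⟨ε, hε, hb⟩ := hnear (F.continuous_curvature.continuousAt.eventually (lt_mem_nhds h1))
      exact ⟨ε, hε, Or.inl hb⟩
  obtain ⟨ε, hε, hs⟩ := hsign
  obtain ⟨η, hη, hc⟩ := F.exists_comparison a
  obtain ⟨s, hs0, hs1⟩ := exists_between (lt_min (sub_pos.2 hab) (lt_min hε hη))
  rw [lt_min_iff, lt_min_iff] at hs1
  have hb := fun c => hc (F.crit a) c (a + s) (by rw [add_sub_cancel_left, abs_of_pos hs0]; exact hs1.2.2)
    (by linarith)
  have h0 := hlev (a + s) ⟨by linarith, by linarith [hs1.1]⟩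
  rcases hs with hs | hs
  · have := hb 1 fun u hu => by
      rcases hu with hu | hu
      · linarith [hs u ⟨hu.1, by linarith [hs1.2.1, hu.2]⟩]
      · linarith [hu.1, hu.2]
    rw [h0] at this
    simp at this
  · have := hb (-1) fun u hu => by
      rcases hu with hu | hu
      · linarith [hs u ⟨hu.1, by linarith [hs1.2.1, hu.2]⟩]
      · linarith [hu.1, hu.2]
    rw [h0] at this
    simp at this

/-- With finitely many vertices both arcs between two contact points contain points off the circle.
These would cut the contact set into two closed pieces, whereas it is connected. -/
theorem circ_ne_of_isSingular (F : InwardFrame f φ γ' N κ)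
    (hfin : {z : Circle | ∃ θ, Circle.exp θ = z ∧ IsLocalExtr κ θ}.Finite) {θ t : ℝ}
    (hsing : IsSingular h (F.circ θ)) (ht : t ∈ Ioo θ (θ + 2 * Real.pi)) :
    F.circ t ≠ F.circ θ := by
  intro e
  obtain ⟨x, hx, hxq⟩ := F.exists_circ_ne hfin ht.1
  obtain ⟨y, hy, hyq⟩ := F.exists_circ_ne hfin ht.2
  rw [e] at hyq
  have hcl : ∀ a b, IsClosed (bd φ '' Icc a b) := fun a b =>
    (isCompact_Icc.image (continuous_bd φ)).isClosed
  obtain ⟨m, ⟨hmc, -⟩, ⟨u, hu, rfl⟩, v, hv, huv⟩ := isPreconnected_closed_iff.1 hsing.2 _ _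
    (hcl x y) (hcl y (x + 2 * Real.pi)) (by
      rintro m ⟨-, hm⟩
      obtain ⟨s, hs, rfl⟩ := exists_bd_eq φ hm x
      rcases le_total s y with h1 | h1
      · exact Or.inl ⟨s, ⟨hs.1, h1⟩, rfl⟩
      · exact Or.inr ⟨s, ⟨h1, hs.2.le⟩, rfl⟩)
    ⟨bd φ t, ⟨F.bd_mem_circ_iff.2 e, bd_mem φ t⟩, t, ⟨hx.2.le, hy.1.le⟩, rfl⟩
    ⟨bd φ θ, ⟨F.bd_mem_circ θ, bd_mem φ θ⟩, θ + 2 * Real.pi, ⟨hy.2.le, by linarith [hx.1]⟩,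
      bd_periodic φ θ⟩
  have huc := F.bd_mem_circ_iff.1 hmc
  -- The two closed arcs share only their end points: either both parameters equal y, or they are
  -- the ends x and `x + 2π`. Both points are off the circle.
  by_cases hlt : |v - u| < 2 * Real.pi
  · have := eq_of_bd_eq φ huv hlt
    subst this
    exact hyq (by rw [← le_antisymm hu.2 hv.1]; exact huc)
  · have h1 : u = x := by
      rw [abs_of_nonneg (by linarith [hu.2, hv.1])] at hlt
      linarith [hu.1, hv.2]
    exact hxq (h1 ▸ huc)

/-- There is no second contact, so the cap could grow if `crit` exceeded the curvature; hence `crit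
≤ κ θ`. If κ rose on leaving θ to either side, comparison would put the boundary strictly inside the
cap, contrary to `eventually_lev_nonpos`. -/
theorem eventually_curvature_lt (F : InwardFrame f φ γ' N κ)
    (hfin : {z : Circle | ∃ θ, Circle.exp θ = z ∧ IsLocalExtr κ θ}.Finite) {θ : ℝ}
    (hsing : IsSingular h (F.circ θ)) : ∀ᶠ t in 𝓝[≠] θ, κ t < κ θ := by
  have hcrit : F.crit θ ≤ κ θ := by
    by_contra! hlt
    obtain ⟨k, hk1, hk2⟩ := exists_between hlt
    obtain ⟨t, h1, h2, h3⟩ := F.exists_contact hk2 (F.eventually_lev_nonpos_of_lt hk1)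
    exact F.circ_ne_of_isSingular hfin hsing ⟨h1, h2⟩ (F.bd_mem_circ_iff.1 h3)
  have hlev := F.eventually_lev_nonpos ((F.isLift_sec θ).mono (cir_subset_cap _ _ _)) (F.sec_base θ)
  obtain ⟨ε, hε, hb⟩ := Metric.eventually_nhds_iff.1 hlev
  obtain ⟨δ, hδ, hr, hl⟩ := exists_strictMono_nhds F.continuous_curvature hfin θ
  obtain ⟨η, hη, hc⟩ := F.exists_comparison θ
  obtain ⟨s, hs0, hs1⟩ := exists_between (lt_min hδ (lt_min hε hη))
  rw [lt_min_iff, lt_min_iff] at hs1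
  have hr' : StrictAntiOn κ (Icc θ (θ + δ)) := by
    refine hr.resolve_left fun hm => ?_
    have h1 := hc (F.crit θ) 1 (θ + s) (by rw [add_sub_cancel_left, abs_of_pos hs0]; exact hs1.2.2)
      (by linarith) fun u hu => by
        rcases hu with hu | hu
        · have := hm ⟨le_rfl, by linarith⟩ ⟨hu.1.le, by linarith [hs1.1, hu.2]⟩ hu.1
          linarith
        · linarith [hu.1, hu.2]
    have h2 := hb (y := θ + s) (by
      rw [Real.dist_eq, add_sub_cancel_left, abs_of_pos hs0]; exact hs1.2.1)
    linarith
  have hl' : StrictMonoOn κ (Icc (θ - δ) θ) := by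
    refine hl.resolve_right fun hm => ?_
    have h0 : |θ - s - θ| = s := by rw [abs_of_neg (by linarith)]; ring
    have h1 := hc (F.crit θ) 1 (θ - s) (by rw [h0]; exact hs1.2.2)
      (by linarith) fun u hu => by
        rcases hu with hu | hu
        · linarith [hu.1, hu.2]
        · have := hm ⟨by linarith [hs1.1, hu.1], hu.2.le⟩ ⟨by linarith, le_rfl⟩ hu.2
          linarith
    have h2 := hb (y := θ - s) (by rw [Real.dist_eq, h0]; exact hs1.2.1)
    linarith
  rw [eventually_nhdsWithin_iff]
  filter_upwards [eventually_abs_sub_lt θ hδ] with t ht hne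
  rw [abs_lt] at ht
  rcases lt_or_gt_of_ne (show t ≠ θ from hne) with h1 | h1
  · exact hl' ⟨by linarith, h1.le⟩ ⟨by linarith, le_rfl⟩ h1
  · exact hr' ⟨le_rfl, by linarith⟩ ⟨h1.le, by linarith⟩ h1

theorem two_mul_card_le (F : InwardFrame f φ γ' N κ) {V : ℕ}
    (hV : {z : Circle | ∃ θ, Circle.exp θ = z ∧ IsLocalExtr κ θ}.encard = V) (A : Finset (Set M))
    (hA : ∀ C ∈ A, IsMaximalCircle h f C ∧ IsSingular h C) : 2 * A.card ≤ V := by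
  classical
  have hfin := finite_of_encard_eq_coe hV
  have hex : ∀ C : Set M, ∃ r : ℝ, C ∈ A → r ∈ Ico 0 (2 * Real.pi) ∧ F.circ r = C := by
    intro C
    by_cases hC : C ∈ A
    · obtain ⟨θ, rfl⟩ := F.isMaximalCircle_iff.1 (hA C hC).1
      obtain ⟨r, hr, e⟩ := exists_bd_eq φ (bd_mem φ θ) 0
      rw [zero_add] at hr
      exact ⟨r, fun _ => ⟨hr, F.circ_eq_of_mem (e ▸ F.bd_mem_circ θ)⟩⟩
    · exact ⟨0, fun hc => absurd hc hC⟩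
  choose r hr using hex
  let P : Finset ℝ := A.image r
  have hP : ∀ t ∈ P, t ∈ Ico 0 (2 * Real.pi) ∧ IsSingular h (F.circ t) := by
    intro t ht
    obtain ⟨C, hC, rfl⟩ := Finset.mem_image.1 ht
    exact ⟨(hr C hC).1, by rw [(hr C hC).2]; exact (hA C hC).2⟩
  have hPcard : P.card = A.card := Finset.card_image_of_injOn fun C hC D hD e => by
    rw [← (hr C hC).2, e, (hr D hD).2]
  rcases P.eq_empty_or_nonempty with hPe | hPne
  · rw [← hPcard, hPe]; simp
  have hmP := P.min'_mem hPne
  have hmle := fun t ht => P.min'_le t ht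
  set m := P.min' hPne
  let W : Set ℝ := {t | t ∈ Ico m (m + 2 * Real.pi) ∧ IsLocalExtr κ t}
  have hWmaps : MapsTo (fun t : ℝ => Circle.exp t) W
      {z : Circle | ∃ θ, Circle.exp θ = z ∧ IsLocalExtr κ θ} := fun t ht => ⟨t, rfl, ht.2⟩
  have hWinj : InjOn (fun t : ℝ => Circle.exp t) W := fun x hx y hy e => by
    refine eq_of_circleExp_eq e ?_
    rw [abs_lt]
    constructor <;> linarith [hx.1.1, hx.1.2, hy.1.1, hy.1.2]
  have hWfin : W.Finite := Finite.of_injOn hWmaps hWinj hfin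
  have hWcard : hWfin.toFinset.card ≤ V := by
    have h1 := encard_le_encard_of_injOn hWmaps hWinj
    rw [hV, hWfin.encard_eq_coe_toFinset_card] at h1
    exact_mod_cast h1
  -- The first maximum is repeated one period later, so that the minimum between the last and the
  -- first is counted as well.
  have hmax : ∀ t ∈ insert (m + 2 * Real.pi) P, ∀ᶠ u in 𝓝[≠] t, κ u < κ t := by
    intro t ht
    refine F.eventually_curvature_lt hfin ?_
    rcases Finset.mem_insert.1 ht with rfl | ht
    · rw [F.circ_eq_of_mem (θ := m) (by rw [bd_periodic]; exact F.bd_mem_circ m)]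
      exact (hP m hmP).2
    · exact (hP t ht).2
  have hwin : ∀ t ∈ insert (m + 2 * Real.pi) P, m ≤ t ∧ t ≤ m + 2 * Real.pi := by
    intro t ht
    rcases Finset.mem_insert.1 ht with rfl | ht
    · exact ⟨by linarith [Real.pi_pos], le_rfl⟩
    · exact ⟨hmle t ht, by linarith [(hP t ht).1.2, (hP m hmP).1.1]⟩
  have hPW : P ⊆ hWfin.toFinset := by
    intro t ht
    rw [hWfin.mem_toFinset]
    refine ⟨⟨hmle t ht, by linarith [(hP t ht).1.2, (hP m hmP).1.1]⟩, Or.inr ?_⟩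
    have h1 := eventually_nhdsWithin_iff.1 (hmax t (Finset.mem_insert_of_mem ht))
    filter_upwards [h1] with u hu
    by_cases e : u = t
    · rw [e]
    · exact (hu e).le
  have hnot : m + 2 * Real.pi ∉ P := fun hc => by
    linarith [(hP _ hc).1.2, (hP m hmP).1.1]
  -- The minima found between consecutive maxima are vertices outside P, so there are at least as
  -- many of them as maxima in P.
  have hint : (insert (m + 2 * Real.pi) P).card ≤ (hWfin.toFinset \ P).card + 1 := by
    refine Finset.card_le_of_interleaved fun x hx y hy hxy hno => ?_
    obtain ⟨u, hu, hmin⟩ := exists_isLocalMin_Ioo F.continuous_curvature hxy (hmax x hx) (hmax y hy)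
    refine ⟨u, Finset.mem_sdiff.2 ⟨hWfin.mem_toFinset.2 ⟨⟨?_, ?_⟩, Or.inl hmin⟩, fun hc =>
      hno u (Finset.mem_insert_of_mem hc) hu⟩, hu⟩
    · exact (hwin x hx).1.trans hu.1.le
    · exact hu.2.trans_le (hwin y hy).2
  rw [Finset.card_insert_of_notMem hnot, Finset.card_sdiff_of_subset hPW] at hint
  have := Finset.card_le_card hPW
  omega

theorem two_mul_numSingular_le (F : InwardFrame f φ γ' N κ) :
    2 * numSingular h f ≤
      {z : Circle | ∃ θ, Circle.exp θ = z ∧ IsLocalExtr κ θ}.encard := by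
  by_cases htop : {z : Circle | ∃ θ, Circle.exp θ = z ∧ IsLocalExtr κ θ}.encard = ⊤
  · rw [htop]; exact le_top
  obtain ⟨V, hV⟩ := ENat.ne_top_iff_exists.1 htop
  have key : ∀ n : ℕ, (n : ℕ∞) ≤ numSingular h f → 2 * n ≤ V := by
    intro n hn
    obtain ⟨T, hT, hTn⟩ := exists_subset_encard_eq hn
    have hTfin := finite_of_encard_eq_coe hTn
    have h1 := F.two_mul_card_le hV.symm hTfin.toFinset fun C hC => hT (hTfin.mem_toFinset.1 hC)
    have h2 : hTfin.toFinset.card = n := by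
      rw [hTfin.encard_eq_coe_toFinset_card] at hTn
      exact_mod_cast hTn
    rwa [h2] at h1
  have hS : numSingular h f ≠ ⊤ := fun e => by
    have := key (V + 1) (by rw [e]; exact le_top)
    omega
  obtain ⟨S, hS⟩ := ENat.ne_top_iff_exists.1 hS
  rw [← hV, ← hS]
  exact_mod_cast key S hS.le

theorem four_le_of_le {T S V : ℕ∞} (h1 : T + 2 ≤ S) (h2 : 2 * S ≤ V) : 4 ≤ V := by
  have h3 : (2 : ℕ∞) ≤ S := le_add_self.trans h1
  calc (4 : ℕ∞) = 2 * 2 := by norm_num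
    _ ≤ 2 * S := by gcongr
    _ ≤ V := h2

end InwardFrame

/-- Choosing the inward normal may change the sign of the curvature. This exchanges maxima and
minima and leaves the set of vertices unchanged. -/
theorem exists_inwardFrame_of_isC2Boundary {M : Type*} [TopologicalSpace M] {h : M ≃ₜ UnitDisk}
    {f : M → S2} (hf : IsTopImmersion f) {φ : Circle ≃ₜ bdry h} (hφ : IsC2Boundary h f φ) :
    ∃ γ' N κ, InwardFrame f φ γ' N κ ∧
      ∀ θ, IsLocalExtr κ θ ↔ IsLocalExtr (geodesicCurvature (boundaryCurve h f φ)) θ := by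
  obtain ⟨N, hN⟩ := exists_frame (γ := fun θ => f (bd φ θ)) hφ.1 hφ.2
  rcases exists_inwardFrame hf hN with F | F
  · exact ⟨_, _, _, F, fun θ => Iff.rfl⟩
  · refine ⟨_, _, _, F, fun θ => ⟨fun h1 => ?_, fun h1 => IsLocalExtr.neg h1⟩⟩
    have h2 := IsLocalExtr.neg h1
    simp only [Pi.neg_apply, neg_neg] at h2
    exact h2

end ImmersedDisk

end

open ImmersedDisk
theorem corollary2p4 {M : Type*} [TopologicalSpace M] (h : M ≃ₜ UnitDisk)
    (f : M → S2) (hf : IsTopImmersion f)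
    (φ : Circle ≃ₜ bdry h) (hφ : IsC2Boundary h f φ)
    (hM : ¬ IsCircle f (bdry h)) :
    (∀ p ∈ bdry h, ∃! C : Set M, IsMaximalCircleAt h f p C) ∧
    (∀ C : Set M, IsMaximalCircle h f C →
      ∀ I ∈ componentsOf (bdry h \ C),
        ∃ p ∈ I, ∃ C' : Set M, IsMaximalCircleAt h f p C' ∧ IsSingular h C') ∧
    triangularity h f + 2 ≤ numSingular h f ∧
    numTriangular h f + 2 ≤ numSingular h f ∧
    2 * numSingular h f ≤ numVertices h f φ ∧
    4 ≤ numVertices h f φ := by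
  have := t2Space_of_homeo h
  have := compactSpace_of_homeo h
  obtain ⟨γ', N, κ, F, hκ⟩ := exists_inwardFrame_of_isC2Boundary hf hφ
  have h1 := F.triangularity_add_two_le hM
  have h2 : 2 * numSingular h f ≤ numVertices h f φ := by
    have := F.two_mul_numSingular_le
    simp only [hκ] at this
    exact this
  refine ⟨fun p hp => ?_, fun C hC I hI => F.exists_singular_mem hM hC hI, h1,
    (by gcongr; exact numTriangular_le_triangularity h f : _ ≤ triangularity h f + 2).trans h1, h2,
    InwardFrame.four_le_of_le h1 h2⟩
  obtain ⟨θ, -, rfl⟩ := exists_bd_eq φ hp 0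
  exact ⟨F.circ θ, F.isMaximalCircleAt_circ θ, fun C hC => F.isMaximalCircleAt_iff.1 hC⟩
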